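/- Let $S(t)$ and $E(t)$ be continuous families ($t\in\mathbb R$) of real symmetric matrices of sizes $2d$ and $2N$, and $G(t)$ a continuous family of real $2d\times 2N$ matrices. For $z=(x,\xi)\in\mathbb R^{2d}$ and $u=(y,\eta)\in\mathbb R^{2N}$ put $H_S(t,z)=\frac12 z\cdot S(t)z$, $H_E(t,u)=\frac12 u\cdot E(t)u$ and $H(t,z,u)=H_S(t,z)+H_E(t,u)+z\cdot G(t)u$. Let $\Phi_S^t,\Phi_E^t,\Phi^t$ be the linear Hamiltonian flows of $H_S,H_E,H$ from time $0$ to time $t$, and $\Psi^t=\begin{pmatrix}\Phi_S^t&0\\0&\Phi_E^t\end{pmatrix}^{-1}\Phi^t$ the interacting flow. With respect to $\mathbb R^{2d}\oplus\mathbb R^{2N}$ write $$\Phi^t=\begin{pmatrix}\Phi_{ii}^t&\Phi_{ie}^t\\\Phi_{ei}^t&\Phi_{ee}^t\end{pmatrix},\qquad \Psi^t=\begin{pmatrix}\Psi_{ii}^t&\Psi_{ie}^t\\\Psi_{ei}^t&\Psi_{ee}^t\end{pmatrix}.$$ Let $U_S(t)$ on $L^2(\mathbb R^d)$ and $U(t)$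 on $L^2(\mathbb R^{d+N})=L^2(\mathbb R^d)\otimes L^2(\mathbb R^N)$ be the unitary propagators, from time $0$ to time $t$, of the Weyl quantizations (with $\hbar=1$) of $H_S$ and $H$: they preserve the Schwartz space, on which they solve the Schrödinger equation. Let $\hat\rho_S(0)$ be an operator on $L^2(\mathbb R^d)$ whose Weyl symbol $\rho_S(0,\cdot)$ is a Schwartz function, and let $\hat\rho_E(0)$ be the operator on $L^2(\mathbb R^N)$ whose Weyl symbol is the centred Gaussian $\det(\Gamma_E)^{-1/2}e^{-\frac12u\cdot\Gamma_E^{-1}u}$ with positive definite covariance matrix $\Gamma_E$. For $t\in\mathbb R$ put $\hat\rho(t)=U(t)\bigl(\hat\rho_S(0)\otimes\hat\rho_E(0)\bigr)U(t)^*$, $\Theta(t)=\Phi_{ie}^t\Gamma_E(\Phi_{ie}^t)^\top$ and $\Theta^{(I)}(t)=\Psi_{ie}^t\Gamma_E(\Psi_{ie}^t)^\top$. Then for every $t\in\mathbb R$ the reduced operator $\hat\rho_S(t)=\mathrm{tr}_E\,\hat\rho(t)$ and its interaction picture $\hat\rho_S^{(I)}(t)=U_S(t)^*\hat\rho_S(t)U_S(t)$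 exist and have Schwartz Weyl symbols $\rho_S(t,\cdot)$ and $\rho^{(I)}_S(t,\cdot)$, which are given as follows. 1. If $\det\Psi_{ii}^t\ne0$ and $\det\bigl(\Psi_{ie}^t(\Psi_{ie}^t)^\top\bigr)\neq0$, then for all $z\in\mathbb R^{2d}$ $$\rho^{(I)}_S(t,z)=c^{(I)}_S(t)\int_{\mathbb R^{2d}}\rho_S\bigl(0,(\Psi_{ii}^t)^{-1}z'\bigr)\,e^{-\frac12(z-z')\cdot\Theta^{(I)}(t)^{-1}(z-z')}\,dz',\qquad c^{(I)}_S(t)=(2\pi)^{-d}\,|\det\Psi_{ii}^t|^{-1}\det\bigl(\Theta^{(I)}(t)\bigr)^{-1/2}.$$ 2. If $\det\Phi_{ii}^t\ne0$ and $\det\bigl(\Phi_{ie}^t(\Phi_{ie}^t)^\top\bigr)\neq0$, then for all $z\in\mathbb R^{2d}$ $$\rho_S(t,z)=c_S(t)\int_{\mathbb R^{2d}}\rho_S\bigl(0,(\Phi_{ii}^t)^{-1}z'\bigr)\,e^{-\frac12(z-z')\cdot\Theta(t)^{-1}(z-z')}\,dz',\qquad c_S(t)=(2\pi)^{-d}\,|\det\Phi_{ii}^t|^{-1}\det\bigl(\Theta(t)\bigr)^{-1/2}.$$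 3. In all cases, degenerate or not, these formulas hold as convolutions of distributions: for every Schwartz function $\varphi$ on $\mathbb R^{2d}$ $$\int_{\mathbb R^{2d}}\rho_S(t,z)\varphi(z)\,dz=\int_{\mathbb R^{2d}}\rho_S(0,z)\int_{\mathbb R^{2d}}\varphi(\Phi_{ii}^tz+w)\,d\mathcal N(0,\Theta(t))(w)\,dz,$$ where $\mathcal N(0,\Theta)$ is the possibly degenerate centred Gaussian measure with covariance $\Theta$. That is, $\rho_S(t,\cdot)$ is the convolution of $\mathcal N(0,\Theta(t))$ with the image under $\Phi_{ii}^t$ of the distribution $\rho_S(0,z)\,dz$. The same holds for $\rho_S^{(I)}$ with $\Psi_{ii}^t$ and $\Theta^{(I)}(t)$ in place of $\Phi_{ii}^t$ and $\Theta(t)$. -/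

import Mathlib

open MeasureTheory ProbabilityTheory Matrix
open scoped SchwartzMap LineDeriv

noncomputable section

namespace OpenQuantum

/-- Configuration space `ℝⁿ`, with coordinates indexed by `ι`. -/
abbrev Config (ι : Type) [Fintype ι] : Type := EuclideanSpace ℝ ι

/-- Phase space `ℝ²ⁿ`: `z (Sum.inl j)` is the position `x_j` and `z (Sum.inr j)` the
momentum `ξ_j`. -/
abbrev Phase (ι : Type) [Fintype ι] : Type := EuclideanSpace ℝ (ι ⊕ ι)

/-- The Hilbert space `L²(ℝⁿ; ℂ)`. -/
abbrev L2 (ι : Type) [Fintype ι] : Type := Lp ℂ 2 (volume : Measure (Config ι))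

/-- Bounded operators on `L²(ℝⁿ; ℂ)`. -/
abbrev Op (ι : Type) [Fintype ι] : Type := L2 ι →L[ℂ] L2 ι

/-- A Schwartz function as an element of `L²`. -/
def toL2 {ι : Type} [Fintype ι] (ψ : 𝓢(Config ι, ℂ)) : L2 ι :=
  ψ.toLp 2 (volume : Measure (Config ι))

/-! ### Weyl quantization -/

/-- The phase space point `(x, ξ)`. -/
def phasePoint {ι : Type} [Fintype ι] (x ξ : Config ι) : Phase ι :=
  WithLp.toLp 2 (Sum.elim x.ofLp ξ.ofLp)

/-- `A` is the Weyl quantization (with `ħ = 1`) of the Schwartz symbol `a`: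
`(A ψ)(x) = (2π)⁻ⁿ ∬ exp(i (x - y)·ξ) a((x + y)/2, ξ) ψ(y) dξ dy` for all Schwartz `ψ`.
As Schwartz functions are dense in `L²`, each of `A` and `a` determines the other. -/
def IsWeylSymbol {ι : Type} [Fintype ι] (A : Op ι) (a : 𝓢(Phase ι, ℂ)) : Prop :=
  ∀ ψ : 𝓢(Config ι, ℂ),
    A (toL2 ψ) =ᵐ[volume] fun x : Config ι =>
      (((2 * Real.pi) ^ Fintype.card ι)⁻¹ : ℂ) *
        ∫ y : Config ι, ∫ ξ : Config ι,
          Complex.exp (Complex.I * ((inner ℝ (x - y) ξ : ℝ) : ℂ)) *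
            a (phasePoint ((1 / 2 : ℝ) • (x + y)) ξ) * ψ y

/-- The canonical operators on Schwartz functions: `Sum.inl j` is multiplication by `x_j`,
`Sum.inr j` is `-i ∂/∂x_j`. -/
def canonicalOp {ι : Type} [Fintype ι] [DecidableEq ι] :
    ι ⊕ ι → 𝓢(Config ι, ℂ) → 𝓢(Config ι, ℂ)
  | Sum.inl j => fun ψ => SchwartzMap.smulLeftCLM ℂ (fun x : Config ι => ((x j : ℝ) : ℂ)) ψ
  | Sum.inr j => fun ψ => (-Complex.I) • ∂_{(EuclideanSpace.single j (1 : ℝ) : Config ι)} ψ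

theorem canonicalOp_inl_apply {ι : Type} [Fintype ι] [DecidableEq ι] (j : ι)
    (ψ : 𝓢(Config ι, ℂ)) (x : Config ι) :
    canonicalOp (Sum.inl j) ψ x = ((x j : ℝ) : ℂ) * ψ x := by
  have h : Function.HasTemperateGrowth (fun x : Config ι => ((x j : ℝ) : ℂ)) :=
    (Complex.ofRealCLM.comp (EuclideanSpace.proj (𝕜 := ℝ) j)).hasTemperateGrowth
  simp [canonicalOp, SchwartzMap.smulLeftCLM_apply_apply h]

/-- Weyl quantization, on Schwartz functions, of the quadratic form `X ↦ (1/2) X · M X` with a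
symmetric matrix `M`: the operator `(1/2) ∑ M_ab X_a X_b`, with the `X_a` the canonical
operators (the symmetry of `M` makes the ordering the symmetric one). -/
def quadHamiltonian {ι : Type} [Fintype ι] [DecidableEq ι] (M : Matrix (ι ⊕ ι) (ι ⊕ ι) ℝ)
    (ψ : 𝓢(Config ι, ℂ)) : 𝓢(Config ι, ℂ) :=
  (1 / 2 : ℂ) • ∑ a, ∑ b, ((M a b : ℝ) : ℂ) • canonicalOp a (canonicalOp b ψ)

/-- `U t = U(t, 0)` is the unitary propagator of the time dependent quadratic Hamiltonian
`H(t, X) = (1/2) X · M(t) X`: it preserves the Schwartz space and, on it, solves the Schrödinger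
equation `i ∂U(t)ψ/∂t = Ĥ(t) U(t) ψ` in `L²`, with `U(0) = 1`. -/
structure IsPropagator {ι : Type} [Fintype ι] [DecidableEq ι]
    (M : ℝ → Matrix (ι ⊕ ι) (ι ⊕ ι) ℝ) (U : ℝ → unitary (Op ι)) : Prop where
  initial : U 0 = 1
  schrodinger : ∀ (t : ℝ) (ψ : 𝓢(Config ι, ℂ)), ∃ ψt : 𝓢(Config ι, ℂ),
    (U t : Op ι) (toL2 ψ) = toL2 ψt ∧
      HasDerivAt (fun s : ℝ => (U s : Op ι) (toL2 ψ))
        ((-Complex.I) • toL2 (quadHamiltonian (M t) ψt)) t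

/-! ### Composite systems -/

theorem memLp_tensor {ι κ : Type} [Fintype ι] [Fintype κ] (ψ : L2 ι) (φ : L2 κ) :
    MemLp (fun x : Config (ι ⊕ κ) =>
      ψ (WithLp.toLp 2 fun i => x (Sum.inl i)) * φ (WithLp.toLp 2 fun k => x (Sum.inr k)))
      2 volume := by
  have h1 : MemLp (fun p : Config ι × Config κ => ψ p.1 * φ p.2) 2
      ((volume : Measure (Config ι)).prod volume) := by
    have hψ := Lp.memLp ψ
    have hφ := Lp.memLp φ
    refine (memLp_two_iff_integrable_sq_norm (hψ.1.comp_fst.mul hφ.1.comp_snd)).2 ?_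
    have := ((memLp_two_iff_integrable_sq_norm hψ.1).1 hψ).mul_prod
      ((memLp_two_iff_integrable_sq_norm hφ.1).1 hφ)
    simpa [mul_pow] using this
  have h2 : MeasurePreserving (fun x : Config (ι ⊕ κ) =>
      ((WithLp.toLp 2 fun i => x (Sum.inl i), WithLp.toLp 2 fun k => x (Sum.inr k)) :
        Config ι × Config κ)) volume ((volume : Measure (Config ι)).prod volume) := by
    have ha := PiLp.volume_preserving_ofLp (ι ⊕ κ)
    have hb := volume_measurePreserving_sumPiEquivProdPi (fun _ : ι ⊕ κ => ℝ)
    have hc := (PiLp.volume_preserving_toLp ι).prod (PiLp.volume_preserving_toLp κ)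
    exact hc.comp (hb.comp ha)
  exact h1.comp_measurePreserving h2

/-- The product state `(ψ ⊗ φ)(x, y) = ψ(x) φ(y)` in `L²(ℝᵈ⁺ᴺ) = L²(ℝᵈ) ⊗ L²(ℝᴺ)`. -/
def tensor {ι κ : Type} [Fintype ι] [Fintype κ] (ψ : L2 ι) (φ : L2 κ) : L2 (ι ⊕ κ) :=
  (memLp_tensor ψ φ).toLp _

/-- `T = A ⊗ B`. -/
def IsTensorOp {ι κ : Type} [Fintype ι] [Fintype κ]
    (T : Op (ι ⊕ κ)) (A : Op ι) (B : Op κ) : Prop :=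
  ∀ (ψ : L2 ι) (φ : L2 κ), T (tensor ψ φ) = tensor (A ψ) (B φ)

/-- `R` is the partial trace of `T` over the second factor:
`⟨ψ, R φ⟩ = ∑ₖ ⟨ψ ⊗ eₖ, T (φ ⊗ eₖ)⟩` for every orthonormal basis `(eₖ)` of the second factor. -/
def IsPartialTrace {ι κ : Type} [Fintype ι] [Fintype κ] (T : Op (ι ⊕ κ)) (R : Op ι) : Prop :=
  ∀ (β : Type) (e : HilbertBasis β ℂ (L2 κ)) (ψ φ : L2 ι),
    HasSum (fun k : β => inner ℂ (tensor ψ (e k)) (T (tensor φ (e k)))) (inner ℂ ψ (R φ))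

/-- The Hessian matrix of `H(z, u) = (1/2) z · S z + (1/2) u · E u + z · G u` in the
variables `(z, u) ∈ ℝ²ᵈ ⊕ ℝ²ᴺ`. -/
def totalHessian {ι κ : Type} (S : Matrix (ι ⊕ ι) (ι ⊕ ι) ℝ) (E : Matrix (κ ⊕ κ) (κ ⊕ κ) ℝ)
    (G : Matrix (ι ⊕ ι) (κ ⊕ κ) ℝ) :
    Matrix ((ι ⊕ ι) ⊕ (κ ⊕ κ)) ((ι ⊕ ι) ⊕ (κ ⊕ κ)) ℝ :=
  fromBlocks S G Gᵀ E

/-- Reordering of the coordinates `((x, ξ), (y, η))` as `((x, y), (ξ, η))`, the order used for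
the quantization on `L²(ℝᵈ⁺ᴺ)`. -/
def positionsFirst {ι κ : Type}
    (M : Matrix ((ι ⊕ ι) ⊕ (κ ⊕ κ)) ((ι ⊕ ι) ⊕ (κ ⊕ κ)) ℝ) :
    Matrix ((ι ⊕ κ) ⊕ (ι ⊕ κ)) ((ι ⊕ κ) ⊕ (ι ⊕ κ)) ℝ :=
  M.submatrix (Equiv.sumSumSumComm ι κ ι κ) (Equiv.sumSumSumComm ι κ ι κ)

/-! ### Classical dynamics -/

/-- The matrix of the symplectic form on `ℝ²ⁿ`, so that Hamilton's equations
`x' = ∂H/∂ξ`, `ξ' = -∂H/∂x` read `z' = J ∇H(z)`. -/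
def sympJ (ι : Type) [DecidableEq ι] : Matrix (ι ⊕ ι) (ι ⊕ ι) ℝ := fromBlocks 0 1 (-1) 0

/-- The symplectic matrix on `ℝ²ᵈ ⊕ ℝ²ᴺ`. -/
def totalJ (ι κ : Type) [DecidableEq ι] [DecidableEq κ] :
    Matrix ((ι ⊕ ι) ⊕ (κ ⊕ κ)) ((ι ⊕ ι) ⊕ (κ ⊕ κ)) ℝ :=
  fromBlocks (sympJ ι) 0 0 (sympJ κ)

/-- `Φ t` is the linear Hamiltonian flow, from time `0` to time `t`, with symplectic matrix `J`
and Hessian `M(t)`: `Φ' = J M(t) Φ` (entrywise), `Φ(0) = 1`. -/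
structure IsHamiltonianFlow {n : Type} [Fintype n] [DecidableEq n] (J : Matrix n n ℝ)
    (M : ℝ → Matrix n n ℝ) (Φ : ℝ → Matrix n n ℝ) : Prop where
  initial : Φ 0 = 1
  hamilton : ∀ (t : ℝ) (i j : n), HasDerivAt (fun s => Φ s i j) ((J * M t * Φ t) i j) t

/-- The interacting flow `Ψ = Φ₀⁻¹ Φ`, where `Φ₀ = diag(ΦS, ΦE)` is the free flow. -/
def interactingFlow {m n : Type} [Fintype m] [DecidableEq m] [Fintype n] [DecidableEq n]
    (ΦS : Matrix m m ℝ) (ΦE : Matrix n n ℝ) (Φ : Matrix (m ⊕ n) (m ⊕ n) ℝ) :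
    Matrix (m ⊕ n) (m ⊕ n) ℝ :=
  (fromBlocks ΦS 0 0 ΦE)⁻¹ * Φ

/-- The matrix `Θ = Φ_ie Γ Φ_ieᵀ`, where `Φ_ie` is the upper right block of `Φ`. -/
def thermalCov {m n : Type} [Fintype m] [Fintype n] (Φ : Matrix (m ⊕ n) (m ⊕ n) ℝ)
    (Γ : Matrix n n ℝ) : Matrix m m ℝ :=
  Φ.toBlocks₁₂ * Γ * Φ.toBlocks₁₂ᵀ

/-! ### Gaussians and convolutions -/

/-- `exp(-(1/2) z · Γ⁻¹ z)`. -/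
def gaussKernel {n : Type} [Fintype n] [DecidableEq n] (Γ : Matrix n n ℝ)
    (z : EuclideanSpace ℝ n) : ℝ :=
  Real.exp (-(1 / 2) * (z.ofLp ⬝ᵥ (Γ⁻¹ *ᵥ z.ofLp)))

/-- The Weyl symbol of the centred Gaussian state with covariance matrix `Γ`. -/
def gaussSymbol {ι : Type} [Fintype ι] [DecidableEq ι] (Γ : Matrix (ι ⊕ ι) (ι ⊕ ι) ℝ)
    (u : Phase ι) : ℝ :=
  (√Γ.det)⁻¹ * gaussKernel Γ u

/-- The image under the linear map `A` of the distribution `ρ(z) dz`, as a functional: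
`φ ↦ ∫ ρ(z) φ(A z) dz`. If `A` is invertible it is the function `|det A|⁻¹ ρ(A⁻¹ z)`. -/
def imageDist {n : Type} [Fintype n] [DecidableEq n] (A : Matrix n n ℝ)
    (ρ : 𝓢(EuclideanSpace ℝ n, ℂ)) (φ : EuclideanSpace ℝ n → ℂ) : ℂ :=
  ∫ z, ρ z * φ (toEuclideanLin A z)

/-- The centred Gaussian distribution with covariance matrix `Θ`, possibly degenerate (it is then
supported by the range of `Θ`), as a functional. Its Fourier transform is
`exp(-(1/2) ζ · Θ ζ)`. -/
def gaussDist {n : Type} [Fintype n] [DecidableEq n] (Θ : Matrix n n ℝ)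
    (φ : EuclideanSpace ℝ n → ℂ) : ℂ :=
  ∫ w, φ w ∂(multivariateGaussian 0 Θ)

/-- The convolution of distributions, `⟨S * T, φ⟩ = ⟨S_x, ⟨T_y, φ(x + y)⟩⟩`. -/
def convDist {E : Type} [Add E] (S T : (E → ℂ) → ℂ) (φ : E → ℂ) : ℂ :=
  S fun x => T fun y => φ (x + y)

/-- The convolution integral
`(2π)⁻ᵈ |det A|⁻¹ (det Θ)^(-1/2) ∫ ρ(A⁻¹ z') exp(-(1/2) (z - z') · Θ⁻¹ (z - z')) dz'`. -/
def gaussConvolution {ι : Type} [Fintype ι] [DecidableEq ι] (A Θ : Matrix (ι ⊕ ι) (ι ⊕ ι) ℝ)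
    (ρ : 𝓢(Phase ι, ℂ)) (z : Phase ι) : ℂ :=
  ((((2 * Real.pi) ^ Fintype.card ι)⁻¹ * |A.det|⁻¹ * (√Θ.det)⁻¹ : ℝ) : ℂ) *
    ∫ z' : Phase ι, ρ (toEuclideanLin A⁻¹ z') * ((gaussKernel Θ (z - z') : ℝ) : ℂ)

/-- The symbol `r` is the convolution of the initial symbol `ρ` transported by the block `A`
with the Gaussian of covariance `Θ = B Γ Bᵀ`: always as a convolution of distributions, and by
the explicit convolution integral when `A` and `B Bᵀ` are nondegenerate. -/
structure IsReducedSymbol {ι : Type} [Fintype ι] [DecidableEq ι] {n : Type} [Fintype n]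
    (Φ : Matrix ((ι ⊕ ι) ⊕ n) ((ι ⊕ ι) ⊕ n) ℝ) (Γ : Matrix n n ℝ)
    (ρ r : 𝓢(Phase ι, ℂ)) : Prop where
  integral_formula : Φ.toBlocks₁₁.det ≠ 0 → (Φ.toBlocks₁₂ * Φ.toBlocks₁₂ᵀ).det ≠ 0 →
    ∀ z, r z = gaussConvolution Φ.toBlocks₁₁ (thermalCov Φ Γ) ρ z
  distribution_formula : ∀ φ : 𝓢(Phase ι, ℂ),
    ∫ z, r z * φ z = convDist (imageDist Φ.toBlocks₁₁ ρ) (gaussDist (thermalCov Φ Γ)) φ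

end OpenQuantum

end

/-! The proof takes place on the Fourier side of Weyl calculus. With `ζ = (p, q)` let `W(ζ) = exp(i
(p · x + q · D))`. An operator `A` is encoded by a function `τ` such that `A = ∫ τ(ζ) W(ζ) dζ`
weakly (`HasWeyl`). If `A` has Weyl symbol `a`, then `τ(ζ) = (2π)⁻²ⁿ (𝓕 a)(ζ / 2π)`;
`HasWeyl.isWeylSymbol` and `IsWeylSymbol.hasWeyl` give the two directions. Every operation in the
theorem acts simply on `τ`.

Evolution. For a quadratic Hamiltonian, conjugating `Ĥ` by `W(ζ)` adds exactly a linear operator and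
a scalar. Hence `U W(ζ) U* = W(Φ⁻ᵀ ζ)` holds with no remainder (`inner_propagator_weyl`), and, since
`|det Φ| = 1`, conjugating `A` by `U` replaces `τ` by `τ ∘ Φᵀ` (`HasWeyl.conj_propagator`).

Tensor product. Weyl operators of the composite system factor, so the transform of `A ⊗ B` is the
product of the two transforms (`IsTensorOp.hasWeyl`).

Partial trace. Tracing out the environment restricts `τ` to vanishing environment variables and
multiplies it by `(2π)ᴺ` (`HasWeyl.isPartialTrace`). This is the analytic core, because the series
must converge in every orthonormal basis. Coherent states `W(v) g` resolve the identity
(`integral_frame`), which turns the trace into the integral over `v` of diagonal matrix elements.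
Repeated integration by parts in `ζ` makes `T (φ ⊗ W(v) g)` decay rapidly in `v`
(`exists_oscInt_decay`), which justifies exchanging sum and integral (`hasSum_inner_of_decay`). The
diagonal elements depend on `v` through the characters `exp(-i σ(u, v))`, so Fourier inversion at
the origin evaluates the integral (`integral_symplectic_fourier`).

Together: `Φᵀ (ζ, 0) = (Φ_iiᵀ ζ, Φ_ieᵀ ζ)`, and the transform of the Gaussian at `Φ_ieᵀ ζ` is the
Gaussian factor with covariance `Θ = Φ_ie Γ Φ_ieᵀ`. Thus `𝓕 r(ζ) = 𝓕 ρ(Φ_iiᵀ ζ) exp(-2π² ζ · Θ ζ)`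
(`fourier_reduced`). The first factor is the transform of the image of `ρ` under `Φ_ii`, the second
that of the Gaussian measure, and the product corresponds to a convolution. Read against test
functions this needs no nondegeneracy (`integral_eq_convDist`); when `Φ_ii` is invertible and `Θ` is
definite it is the explicit integral (`eq_gaussConvolution`). The interaction picture composes
everything with `Φ_S⁻ᵀ`, which changes `Φ_ii`, `Φ_ie` into `Φ_S⁻¹ Φ_ii = Ψ_ii`, `Φ_S⁻¹ Φ_ie = Ψ_ie`.
-/

noncomputable section

namespace OpenQuantum

set_option linter.unusedSectionVars false
set_option linter.deprecated false

/-! ### Splitting Euclidean coordinates -/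

section Split

variable {α β : Type} [Fintype α] [Fintype β]

/-- The first block of coordinates. -/
def fstL : EuclideanSpace ℝ (α ⊕ β) →L[ℝ] EuclideanSpace ℝ α :=
  (ContinuousLinearMap.fst ℝ _ _).comp
    (EuclideanSpace.sumEquivProd (𝕜 := ℝ) (ι := α) (κ := β)).toContinuousLinearMap

/-- The second block of coordinates. -/
def sndL : EuclideanSpace ℝ (α ⊕ β) →L[ℝ] EuclideanSpace ℝ β :=
  (ContinuousLinearMap.snd ℝ _ _).comp
    (EuclideanSpace.sumEquivProd (𝕜 := ℝ) (ι := α) (κ := β)).toContinuousLinearMap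

/-- The vector with given blocks of coordinates. -/
def join (x : EuclideanSpace ℝ α) (y : EuclideanSpace ℝ β) : EuclideanSpace ℝ (α ⊕ β) :=
  WithLp.toLp 2 (Sum.elim x.ofLp y.ofLp)

@[simp] theorem fstL_apply (z : EuclideanSpace ℝ (α ⊕ β)) (i : α) :
    fstL z i = z (Sum.inl i) := rfl

@[simp] theorem sndL_apply (z : EuclideanSpace ℝ (α ⊕ β)) (i : β) :
    sndL z i = z (Sum.inr i) := rfl

@[simp] theorem join_inl (x : EuclideanSpace ℝ α) (y : EuclideanSpace ℝ β) (i : α) :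
    join x y (Sum.inl i) = x i := rfl

@[simp] theorem join_inr (x : EuclideanSpace ℝ α) (y : EuclideanSpace ℝ β) (i : β) :
    join x y (Sum.inr i) = y i := rfl

@[simp] theorem fstL_join (x : EuclideanSpace ℝ α) (y : EuclideanSpace ℝ β) :
    fstL (join x y) = x := rfl

@[simp] theorem sndL_join (x : EuclideanSpace ℝ α) (y : EuclideanSpace ℝ β) :
    sndL (join x y) = y := rfl

@[simp] theorem join_fstL_sndL (z : EuclideanSpace ℝ (α ⊕ β)) : join (fstL z) (sndL z) = z := by
  ext i; cases i <;> rfl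

theorem ext_blocks {z w : EuclideanSpace ℝ (α ⊕ β)} (h1 : fstL z = fstL w)
    (h2 : sndL z = sndL w) : z = w := by
  rw [← join_fstL_sndL z, h1, h2, join_fstL_sndL]

theorem inner_blocks (z w : EuclideanSpace ℝ (α ⊕ β)) :
    inner ℝ z w = inner ℝ (fstL z) (fstL w) + inner ℝ (sndL z) (sndL w) := by
  simp [PiLp.inner_apply, Fintype.sum_sum_type]

theorem norm_sq_blocks (z : EuclideanSpace ℝ (α ⊕ β)) :
    ‖z‖ ^ 2 = ‖fstL z‖ ^ 2 + ‖sndL z‖ ^ 2 := by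
  simp only [← real_inner_self_eq_norm_sq, inner_blocks]

theorem norm_fstL_le (z : EuclideanSpace ℝ (α ⊕ β)) : ‖fstL z‖ ≤ ‖z‖ := by
  have := norm_sq_blocks z
  exact le_of_sq_le_sq (by nlinarith [sq_nonneg ‖sndL z‖]) (norm_nonneg _)

theorem norm_sndL_le (z : EuclideanSpace ℝ (α ⊕ β)) : ‖sndL z‖ ≤ ‖z‖ := by
  have := norm_sq_blocks z
  exact le_of_sq_le_sq (by nlinarith [sq_nonneg ‖fstL z‖]) (norm_nonneg _)

theorem norm_le_blocks (z : EuclideanSpace ℝ (α ⊕ β)) : ‖z‖ ≤ ‖fstL z‖ + ‖sndL z‖ := by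
  have := norm_sq_blocks z
  exact le_of_sq_le_sq (by nlinarith [mul_nonneg (norm_nonneg (fstL z)) (norm_nonneg (sndL z))])
    (by positivity)

theorem norm_fstL_opNorm : ‖(fstL : EuclideanSpace ℝ (α ⊕ β) →L[ℝ] _)‖ ≤ 1 :=
  ContinuousLinearMap.opNorm_le_bound _ zero_le_one fun z => by simpa using norm_fstL_le z

theorem norm_sndL_opNorm : ‖(sndL : EuclideanSpace ℝ (α ⊕ β) →L[ℝ] _)‖ ≤ 1 :=
  ContinuousLinearMap.opNorm_le_bound _ zero_le_one fun z => by simpa using norm_sndL_le z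

@[fun_prop]
theorem continuous_join :
    Continuous fun p : EuclideanSpace ℝ α × EuclideanSpace ℝ β => join p.1 p.2 :=
  (EuclideanSpace.sumEquivProd (𝕜 := ℝ) (ι := α) (κ := β)).symm.continuous

/-- Splitting the coordinates, as a measurable equivalence. -/
def splitEquiv : EuclideanSpace ℝ (α ⊕ β) ≃ᵐ EuclideanSpace ℝ α × EuclideanSpace ℝ β where
  toFun z := (fstL z, sndL z)
  invFun p := join p.1 p.2
  left_inv z := join_fstL_sndL z
  right_inv _ := rfl
  measurable_toFun := (fstL.continuous.prodMk sndL.continuous).measurable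
  measurable_invFun := continuous_join.measurable

theorem measurePreserving_split :
    MeasurePreserving (fun z : EuclideanSpace ℝ (α ⊕ β) => (fstL z, sndL z)) volume
      ((volume : Measure (EuclideanSpace ℝ α)).prod volume) := by
  have ha := PiLp.volume_preserving_ofLp (α ⊕ β)
  have hb := volume_measurePreserving_sumPiEquivProdPi (fun _ : α ⊕ β => ℝ)
  have hc := (PiLp.volume_preserving_toLp α).prod (PiLp.volume_preserving_toLp β)
  exact hc.comp (hb.comp ha)

theorem integral_split {F : Type*} [NormedAddCommGroup F] [NormedSpace ℝ F]
    (f : EuclideanSpace ℝ α × EuclideanSpace ℝ β → F) :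
    ∫ z : EuclideanSpace ℝ (α ⊕ β), f (fstL z, sndL z) = ∫ p, f p :=
  measurePreserving_split.integral_comp (splitEquiv (α := α) (β := β)).measurableEmbedding f

theorem integrable_split_iff {F : Type*} [NormedAddCommGroup F]
    (f : EuclideanSpace ℝ α × EuclideanSpace ℝ β → F) :
    Integrable (fun z : EuclideanSpace ℝ (α ⊕ β) => f (fstL z, sndL z)) ↔ Integrable f :=
  measurePreserving_split.integrable_comp_emb
    (splitEquiv (α := α) (β := β)).measurableEmbedding

end Split

/-! ### Products of Schwartz functions of separate variables -/

section ExternalProduct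

variable {E F G : Type*} [NormedAddCommGroup E] [NormedSpace ℝ E] [NormedAddCommGroup F]
  [NormedSpace ℝ F] [NormedAddCommGroup G] [NormedSpace ℝ G]

theorem norm_iteratedFDeriv_comp_clm_le (f : 𝓢(F, ℂ)) (P : E →L[ℝ] F) (n : ℕ) (x : E) :
    ‖iteratedFDeriv ℝ n (fun x => f (P x)) x‖ ≤ ‖P‖ ^ n * ‖iteratedFDeriv ℝ n f (P x)‖ := by
  have := P.iteratedFDeriv_comp_right (f.smooth n) x (i := n) le_rfl
  change ‖iteratedFDeriv ℝ n (⇑f ∘ ⇑P) x‖ ≤ _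
  rw [this, mul_comm]
  refine (ContinuousMultilinearMap.norm_compContinuousLinearMap_le _ _).trans ?_
  simp

/-- The product `f(P x) g(Q x)` of Schwartz functions of complementary variables. -/
def externalProduct (f : 𝓢(F, ℂ)) (g : 𝓢(G, ℂ)) (P : E →L[ℝ] F) (Q : E →L[ℝ] G)
    (h : ∀ x, ‖x‖ ≤ ‖P x‖ + ‖Q x‖) : 𝓢(E, ℂ) where
  toFun x := f (P x) * g (Q x)
  smooth' := ((f.smooth ⊤).comp P.contDiff).mul ((g.smooth ⊤).comp Q.contDiff)
  decay' k n := by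
    have hf (j i : ℕ) : ∃ C, ∀ y, ‖y‖ ^ j * ‖iteratedFDeriv ℝ i f y‖ ≤ C := f.decay' j i
    have hg (j i : ℕ) : ∃ C, ∀ y, ‖y‖ ^ j * ‖iteratedFDeriv ℝ i g y‖ ≤ C := g.decay' j i
    choose Cf hCf using hf
    choose Cg hCg using hg
    have hC0 (j i) : 0 ≤ Cf j i := le_trans (by positivity) (hCf j i 0)
    have hG0 (j i) : 0 ≤ Cg j i := le_trans (by positivity) (hCg j i 0)
    -- The sum over `i` is the Leibniz rule. The weight is split by `(a + b)ᵏ ≤ 2ᵏ (aᵏ + bᵏ)`, and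
    -- each half is absorbed by the factor that depends on the same variable, the other factor being
    -- bounded with weight `0`.
    refine ⟨∑ i ∈ Finset.range (n + 1), (n.choose i : ℝ) *
      (2 ^ k * (‖P‖ ^ i * ‖Q‖ ^ (n - i) *
        (Cf k i * Cg 0 (n - i) + Cf 0 i * Cg k (n - i)))), fun x => ?_⟩
    have hL := norm_iteratedFDeriv_mul_le (𝕜 := ℝ) (n := n) (N := ((⊤ : ℕ∞) : WithTop ℕ∞))
      ((f.smooth ⊤).comp P.contDiff) ((g.smooth ⊤).comp Q.contDiff) x (by exact_mod_cast le_top)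
    refine (mul_le_mul_of_nonneg_left hL (by positivity)).trans ?_
    rw [Finset.mul_sum]
    refine Finset.sum_le_sum fun i _ => ?_
    have h1 := norm_iteratedFDeriv_comp_clm_le f P i x
    have h2 := norm_iteratedFDeriv_comp_clm_le g Q (n - i) x
    set a := ‖iteratedFDeriv ℝ i f (P x)‖
    set b := ‖iteratedFDeriv ℝ (n - i) g (Q x)‖
    have hx : ‖x‖ ^ k ≤ 2 ^ k * (‖P x‖ ^ k + ‖Q x‖ ^ k) := by
      refine (pow_le_pow_left₀ (norm_nonneg _) (h x) k).trans ?_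
      have h3 : ‖P x‖ + ‖Q x‖ ≤ 2 * max ‖P x‖ ‖Q x‖ := by
        linarith [le_max_left ‖P x‖ ‖Q x‖, le_max_right ‖P x‖ ‖Q x‖]
      refine (pow_le_pow_left₀ (by positivity) h3 k).trans ?_
      rw [mul_pow]
      gcongr
      rcases max_choice ‖P x‖ ‖Q x‖ with h | h <;> rw [h] <;> simp
    have e1 := hCf k i (P x)
    have e2 := hCg k (n - i) (Q x)
    have e3 := hCf 0 i (P x)
    have e4 := hCg 0 (n - i) (Q x)
    simp only [pow_zero, one_mul] at e3 e4
    have key : (‖P x‖ ^ k + ‖Q x‖ ^ k) * (a * b) ≤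
        Cf k i * Cg 0 (n - i) + Cf 0 i * Cg k (n - i) := by
      calc _ = (‖P x‖ ^ k * a) * b + a * (‖Q x‖ ^ k * b) := by ring
        _ ≤ _ := add_le_add
          (mul_le_mul e1 e4 (norm_nonneg _) (hC0 _ _))
          (mul_le_mul e3 e2 (by positivity) (hC0 _ _))
    calc ‖x‖ ^ k * ((n.choose i : ℝ) * ‖iteratedFDeriv ℝ i (⇑f ∘ ⇑P) x‖ *
          ‖iteratedFDeriv ℝ (n - i) (⇑g ∘ ⇑Q) x‖)
        ≤ (2 ^ k * (‖P x‖ ^ k + ‖Q x‖ ^ k)) * ((n.choose i : ℝ) * (‖P‖ ^ i * a) *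
          (‖Q‖ ^ (n - i) * b)) := by
          gcongr <;> assumption
      _ = (n.choose i : ℝ) * (2 ^ k * (‖P‖ ^ i * ‖Q‖ ^ (n - i) *
          ((‖P x‖ ^ k + ‖Q x‖ ^ k) * (a * b)))) := by ring
      _ ≤ _ := by gcongr

@[simp] theorem externalProduct_apply (f : 𝓢(F, ℂ)) (g : 𝓢(G, ℂ)) (P : E →L[ℝ] F)
    (Q : E →L[ℝ] G) (h : ∀ x, ‖x‖ ≤ ‖P x‖ + ‖Q x‖) (x : E) :
    externalProduct f g P Q h x = f (P x) * g (Q x) := rfl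

end ExternalProduct

/-! ### Weyl operators -/

section Weyl

variable {ι : Type} [Fintype ι]

/-- The symplectic form. -/
def symp (ζ v : Phase ι) : ℝ := inner ℝ (fstL ζ) (sndL v) - inner ℝ (sndL ζ) (fstL v)

theorem symp_add_left (ζ η v : Phase ι) : symp (ζ + η) v = symp ζ v + symp η v := by
  simp only [symp, map_add, inner_add_left]; ring

theorem symp_smul_left (c : ℝ) (ζ v : Phase ι) : symp (c • ζ) v = c * symp ζ v := by
  simp only [symp, map_smul, real_inner_smul_left]; ring

theorem symp_neg_left (ζ v : Phase ι) : symp (-ζ) v = -symp ζ v := by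
  simp only [symp, map_neg, inner_neg_left]; ring

theorem symp_neg_right (ζ v : Phase ι) : symp ζ (-v) = -symp ζ v := by
  simp only [symp, map_neg, inner_neg_right]; ring

theorem symp_swap (ζ v : Phase ι) : symp v ζ = -symp ζ v := by
  simp only [symp, real_inner_comm]; ring

@[simp] theorem symp_self (ζ : Phase ι) : symp ζ ζ = 0 := by
  simp only [symp, real_inner_comm]; ring

@[fun_prop]
theorem continuous_symp : Continuous fun p : Phase ι × Phase ι => symp p.1 p.2 := by
  unfold symp; fun_prop

/-- The phase of the Weyl operator with parameter `ζ = (p, q)`. -/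
def weylPhase (ζ : Phase ι) (x : Config ι) : ℝ :=
  inner ℝ (fstL ζ) x + inner ℝ (fstL ζ) (sndL ζ) / 2

@[fun_prop]
theorem continuous_weylPhase :
    Continuous fun p : Phase ι × Config ι => weylPhase p.1 p.2 := by
  unfold weylPhase; fun_prop

/-- The Weyl operator `exp(i (p · x + q · D))` with `ζ = (p, q)`, on functions. -/
def weylFun (ζ : Phase ι) (f : Config ι → ℂ) (x : Config ι) : ℂ :=
  Complex.exp ((weylPhase ζ x : ℝ) * Complex.I) * f (x + sndL ζ)

theorem norm_weylFun (ζ : Phase ι) (f : Config ι → ℂ) (x : Config ι) :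
    ‖weylFun ζ f x‖ = ‖f (x + sndL ζ)‖ := by
  simp [weylFun, Complex.norm_exp_ofReal_mul_I]

theorem weylFun_congr_ae (ζ : Phase ι) {f g : Config ι → ℂ} (h : f =ᵐ[volume] g) :
    weylFun ζ f =ᵐ[volume] weylFun ζ g := by
  have := (measurePreserving_add_right (volume : Measure (Config ι)) (sndL ζ)).quasiMeasurePreserving.ae_eq_comp h
  filter_upwards [this] with x hx
  simp only [Function.comp] at hx
  simp [weylFun, hx]

theorem aestronglyMeasurable_weylFun (ζ : Phase ι) {f : Config ι → ℂ}
    (h : AEStronglyMeasurable f volume) : AEStronglyMeasurable (weylFun ζ f) volume := by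
  have h1 : AEStronglyMeasurable (fun x => f (x + sndL ζ)) volume :=
    h.comp_measurePreserving (measurePreserving_add_right volume (sndL ζ))
  have h2 : Continuous fun x : Config ι => Complex.exp ((weylPhase ζ x : ℝ) * Complex.I) := by
    fun_prop
  exact h2.aestronglyMeasurable.mul h1

theorem eLpNorm_weylFun (ζ : Phase ι) {f : Config ι → ℂ} (h : AEStronglyMeasurable f volume) :
    eLpNorm (weylFun ζ f) 2 volume = eLpNorm f 2 volume := by
  rw [← eLpNorm_comp_measurePreserving h (measurePreserving_add_right volume (sndL ζ))]
  exact eLpNorm_congr_norm_ae (.of_forall fun x => norm_weylFun ζ f x)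

theorem memLp_weylFun (ζ : Phase ι) {f : Config ι → ℂ} (h : MemLp f 2 volume) :
    MemLp (weylFun ζ f) 2 volume :=
  ⟨aestronglyMeasurable_weylFun ζ h.1, by rw [eLpNorm_weylFun ζ h.1]; exact h.2⟩

/-- The Weyl operator `exp(i (p · x + q · D))` with `ζ = (p, q)`, on `L²`. -/
def weyl (ζ : Phase ι) : L2 ι →ₗᵢ[ℂ] L2 ι where
  toFun F := (memLp_weylFun ζ (Lp.memLp F)).toLp _
  map_add' F G := by
    refine Lp.ext ?_
    filter_upwards [(memLp_weylFun ζ (Lp.memLp (F + G))).coeFn_toLp,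
      Lp.coeFn_add ((memLp_weylFun ζ (Lp.memLp F)).toLp _) ((memLp_weylFun ζ (Lp.memLp G)).toLp _),
      (memLp_weylFun ζ (Lp.memLp F)).coeFn_toLp, (memLp_weylFun ζ (Lp.memLp G)).coeFn_toLp,
      weylFun_congr_ae ζ (Lp.coeFn_add F G)] with x h1 h2 h3 h4 h5
    rw [h1, h2, h5, Pi.add_apply, h3, h4]
    simp [weylFun, mul_add]
  map_smul' c F := by
    refine Lp.ext ?_
    filter_upwards [(memLp_weylFun ζ (Lp.memLp (c • F))).coeFn_toLp,
      Lp.coeFn_smul c ((memLp_weylFun ζ (Lp.memLp F)).toLp _),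
      (memLp_weylFun ζ (Lp.memLp F)).coeFn_toLp,
      weylFun_congr_ae ζ (Lp.coeFn_smul c F)] with x h1 h2 h3 h5
    rw [h1, RingHom.id_apply, h2, h5, Pi.smul_apply, h3]
    simp [weylFun]; ring
  norm_map' F := by
    change ‖(memLp_weylFun ζ (Lp.memLp F)).toLp _‖ = ‖F‖
    rw [Lp.norm_toLp, eLpNorm_weylFun ζ (Lp.memLp F).1, Lp.norm_def]

theorem weyl_coeFn (ζ : Phase ι) (F : L2 ι) : weyl ζ F =ᵐ[volume] weylFun ζ F :=
  (memLp_weylFun ζ (Lp.memLp F)).coeFn_toLp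

theorem weyl_coeFn_of (ζ : Phase ι) {F : L2 ι} {f : Config ι → ℂ} (h : F =ᵐ[volume] f) :
    weyl ζ F =ᵐ[volume] weylFun ζ f :=
  (weyl_coeFn ζ F).trans (weylFun_congr_ae ζ h)

/-- The Weyl relations. The term `p · q / 2` in `weylPhase` is what makes the cocycle antisymmetric,
so that `W(-ζ)` inverts `W(ζ)` without a phase. -/
theorem weyl_weyl (ζ v : Phase ι) (F : L2 ι) :
    weyl ζ (weyl v F) = Complex.exp ((-(symp ζ v / 2) : ℝ) * Complex.I) • weyl (ζ + v) F := by
  refine Lp.ext ?_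
  filter_upwards [weyl_coeFn_of ζ (weyl_coeFn v F), weyl_coeFn (ζ + v) F,
    Lp.coeFn_smul (Complex.exp ((-(symp ζ v / 2) : ℝ) * Complex.I)) (weyl (ζ + v) F)]
    with x h1 h2 h3
  rw [h1, h3, Pi.smul_apply, h2]
  simp only [weylFun, smul_eq_mul, ← mul_assoc, ← Complex.exp_add, map_add, add_assoc]
  congr 2
  rw [← add_mul, ← add_mul]
  congr 1
  norm_cast
  simp only [weylPhase, symp, map_add, inner_add_left, inner_add_right,
    real_inner_comm (fstL v) (sndL ζ)]
  ring

theorem weyl_zero (F : L2 ι) : weyl (0 : Phase ι) F = F := by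
  refine Lp.ext ?_
  filter_upwards [weyl_coeFn (0 : Phase ι) F] with x h
  rw [h]
  simp [weylFun, weylPhase]

theorem weyl_neg_weyl (ζ : Phase ι) (F : L2 ι) : weyl (-ζ) (weyl ζ F) = F := by
  rw [weyl_weyl, symp_neg_left, symp_self]
  simp [weyl_zero]

theorem weyl_weyl_neg (ζ : Phase ι) (F : L2 ι) : weyl ζ (weyl (-ζ) F) = F := by
  simpa using weyl_neg_weyl (-ζ) F

/-- Both orders produce `W(ζ + v)` with opposite half phases. Through this relation, translating
both vectors of a matrix element of `W(ζ)` by `W(v)` only multiplies it by a character. -/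
theorem weyl_comm (ζ v : Phase ι) (F : L2 ι) :
    weyl ζ (weyl v F) = Complex.exp ((-symp ζ v : ℝ) * Complex.I) • weyl v (weyl ζ F) := by
  rw [weyl_weyl, weyl_weyl, smul_smul, ← Complex.exp_add, symp_swap ζ v, add_comm v ζ]
  congr 2
  push_cast
  ring

theorem inner_weyl_left (ζ : Phase ι) (F G : L2 ι) :
    inner ℂ (weyl ζ F) G = inner ℂ F (weyl (-ζ) G) := by
  rw [← (weyl ζ).inner_map_map F, weyl_weyl_neg]

theorem norm_inner_weyl_le (ζ : Phase ι) (F G : L2 ι) :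
    ‖inner ℂ F (weyl ζ G)‖ ≤ ‖F‖ * ‖G‖ := by
  simpa using norm_inner_le_norm (𝕜 := ℂ) F (weyl ζ G)

theorem toL2_coeFn (ψ : 𝓢(Config ι, ℂ)) : toL2 ψ =ᵐ[volume] ψ := ψ.coeFn_toLp 2 volume

theorem denseRange_toL2 : DenseRange (toL2 : 𝓢(Config ι, ℂ) → L2 ι) :=
  SchwartzMap.denseRange_toLpCLM (F := ℂ) (E := Config ι) (p := 2) (by simp)

theorem toL2_smul (c : ℂ) (ψ : 𝓢(Config ι, ℂ)) : toL2 (c • ψ) = c • toL2 ψ :=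
  (SchwartzMap.toLpCLM ℂ (E := Config ι) ℂ 2 volume).map_smul c ψ

theorem toL2_sum {κ : Type*} (s : Finset κ) (f : κ → 𝓢(Config ι, ℂ)) :
    toL2 (∑ i ∈ s, f i) = ∑ i ∈ s, toL2 (f i) :=
  map_sum (SchwartzMap.toLpCLM ℂ (E := Config ι) ℂ 2 volume) f s

theorem inner_toL2_weyl (φ ψ : 𝓢(Config ι, ℂ)) (ζ : Phase ι) :
    inner ℂ (toL2 φ) (weyl ζ (toL2 ψ)) = ∫ x, star (φ x) * weylFun ζ ψ x := by
  rw [L2.inner_def]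
  refine integral_congr_ae ?_
  filter_upwards [toL2_coeFn φ, weyl_coeFn_of ζ (toL2_coeFn ψ)] with x h1 h2
  rw [h1, h2, RCLike.inner_apply, mul_comm]
  rfl

theorem continuous_weylFun (ψ : 𝓢(Config ι, ℂ)) :
    Continuous fun p : Phase ι × Config ι => weylFun p.1 ψ p.2 := by
  unfold weylFun
  have := ψ.continuous
  fun_prop

end Weyl

/-! ### Differentiating matrix elements of Weyl operators -/

section WeylDeriv

variable {ι : Type} [Fintype ι] [DecidableEq ι]

/-- The linear combination `v · X` of canonical operators. -/
def linOp (v : Phase ι) (ψ : 𝓢(Config ι, ℂ)) : 𝓢(Config ι, ℂ) :=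
  ∑ a, ((v a : ℝ) : ℂ) • canonicalOp a ψ

theorem canonicalOp_inr_apply (j : ι) (ψ : 𝓢(Config ι, ℂ)) (x : Config ι) :
    canonicalOp (Sum.inr j) ψ x =
      -Complex.I * fderiv ℝ ψ x (EuclideanSpace.single j (1 : ℝ)) := by
  simp [canonicalOp, SchwartzMap.lineDerivOp_apply_eq_fderiv]

theorem linOp_apply (v : Phase ι) (ψ : 𝓢(Config ι, ℂ)) (x : Config ι) :
    linOp v ψ x = ((inner ℝ (fstL v) x : ℝ) : ℂ) * ψ x - Complex.I * fderiv ℝ ψ x (sndL v) := by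
  have h : sndL v = ∑ j, v (Sum.inr j) • EuclideanSpace.single j (1 : ℝ) := by
    ext i
    simp [Finset.sum_apply, Pi.single_apply]
  have h2 : linOp v ψ x = ∑ a, ((v a : ℝ) : ℂ) * canonicalOp a ψ x := by
    simp [linOp, _root_.sum_apply]
  rw [h2, h, map_sum, Fintype.sum_sum_type, sub_eq_add_neg, Finset.mul_sum,
    ← Finset.sum_neg_distrib]
  congr 1
  · simp only [canonicalOp_inl_apply, PiLp.inner_apply, fstL_apply, Complex.ofReal_sum,
      Finset.sum_mul]
    refine Finset.sum_congr rfl fun i _ => ?_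
    simp; ring
  · refine Finset.sum_congr rfl fun i _ => ?_
    rw [canonicalOp_inr_apply, map_smul, Complex.real_smul]
    ring

theorem linOp_neg (v : Phase ι) (ψ : 𝓢(Config ι, ℂ)) : linOp (-v) ψ = (-1 : ℂ) • linOp v ψ := by
  simp [linOp, add_comm]

theorem linOp_single (a : ι ⊕ ι) (ψ : 𝓢(Config ι, ℂ)) :
    linOp (EuclideanSpace.single a (1 : ℝ)) ψ = canonicalOp a ψ := by
  unfold linOp
  rw [Finset.sum_eq_single a]
  · simp
  · intro b _ hb
    simp [hb]
  · simp

theorem hasFDerivAt_weylPhase (ζ : Phase ι) (x : Config ι) :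
    HasFDerivAt (fun ζ => weylPhase ζ x)
      ((innerSL ℝ (x + (1 / 2 : ℝ) • sndL ζ)).comp fstL +
        (1 / 2 : ℝ) • (innerSL ℝ (fstL ζ)).comp sndL) ζ := by
  have h1 : HasFDerivAt (fun ζ : Phase ι => fstL ζ) fstL ζ := fstL.hasFDerivAt
  have h2 : HasFDerivAt (fun ζ : Phase ι => sndL ζ) sndL ζ := sndL.hasFDerivAt
  have := (h1.inner ℝ (hasFDerivAt_const x ζ)).add ((h1.inner ℝ h2).mul_const (1 / 2 : ℝ))
  unfold weylPhase
  simp_rw [div_eq_mul_one_div (inner ℝ _ _ : ℝ) 2]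
  convert! this using 1
  ext v
  simp [real_inner_comm x, real_inner_comm (sndL ζ)]
  ring

/-- The derivative of `ζ ↦ weylFun ζ ψ x`. -/
def weylFunDeriv (ψ : 𝓢(Config ι, ℂ)) (ζ : Phase ι) (x : Config ι) : Phase ι →L[ℝ] ℂ :=
  Complex.exp ((weylPhase ζ x : ℝ) * Complex.I) • (fderiv ℝ ψ (x + sndL ζ)).comp sndL +
    (Complex.exp ((weylPhase ζ x : ℝ) * Complex.I) * Complex.I * ψ (x + sndL ζ)) •
      Complex.ofRealCLM.comp ((innerSL ℝ (x + (1 / 2 : ℝ) • sndL ζ)).comp fstL +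
        (1 / 2 : ℝ) • (innerSL ℝ (fstL ζ)).comp sndL)

theorem hasFDerivAt_weylFun (ψ : 𝓢(Config ι, ℂ)) (ζ : Phase ι) (x : Config ι) :
    HasFDerivAt (fun ζ => weylFun ζ ψ x) (weylFunDeriv ψ ζ x) ζ := by
  have h1 : HasFDerivAt (fun ζ => Complex.exp ((weylPhase ζ x : ℝ) * Complex.I)) _ ζ :=
    ((Complex.ofRealCLM.hasFDerivAt.comp ζ (hasFDerivAt_weylPhase ζ x)).mul_const Complex.I).cexp
  have h2 : HasFDerivAt (fun ζ : Phase ι => ψ (x + sndL ζ)) ((fderiv ℝ ψ (x + sndL ζ)).comp sndL) ζ :=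
    (ψ.hasFDerivAt (x + sndL ζ)).comp ζ (sndL.hasFDerivAt.const_add x)
  refine (h1.mul h2).congr_fderiv ?_
  ext v
  simp [weylFunDeriv]
  ring

/-- Infinitesimal form of `W(ζ + s v) = exp(i s σ(ζ, v) / 2) W(ζ) W(s v)`: the scalar term is the
price for `v · X` not commuting with the exponent of `W(ζ)`. -/
theorem weylFunDeriv_apply (ψ : 𝓢(Config ι, ℂ)) (ζ v : Phase ι) (x : Config ι) :
    weylFunDeriv ψ ζ x v =
      Complex.I * weylFun ζ (linOp v ψ) x + Complex.I / 2 * (symp ζ v : ℝ) * weylFun ζ ψ x := by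
  have h : ((inner ℝ (fstL v) (x + sndL ζ) : ℝ) : ℂ) + 1 / 2 * (symp ζ v : ℝ) =
      ((inner ℝ (x + (1 / 2 : ℝ) • sndL ζ) (fstL v) + 1 / 2 * inner ℝ (fstL ζ) (sndL v) : ℝ) : ℂ) := by
    simp only [symp, inner_add_right,
      real_inner_smul_right, real_inner_comm (fstL v)]
    push_cast
    ring
  simp only [weylFun, linOp_apply, weylFunDeriv, _root_.add_apply,
    _root_.smul_apply, ContinuousLinearMap.comp_apply, Complex.ofRealCLM_apply,
    innerSL_apply_apply, smul_eq_mul]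
  rw [← h]
  ring_nf
  simp only [Complex.I_sq]
  ring

/-- Growth linear in `x` is harmless against a Schwartz function, so this serves as the domination
for differentiating matrix elements under the integral. -/
theorem norm_weylFunDeriv_le (ψ : 𝓢(Config ι, ℂ)) {C₀ C₁ : ℝ} (h0 : ∀ x, ‖ψ x‖ ≤ C₀)
    (h1 : ∀ x, ‖fderiv ℝ ψ x‖ ≤ C₁) (ζ : Phase ι) (x : Config ι) :
    ‖weylFunDeriv ψ ζ x‖ ≤ C₁ + C₀ * (‖x‖ + ‖ζ‖) := by
  have hC0 : 0 ≤ C₀ := (norm_nonneg _).trans (h0 0)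
  have hC1 : 0 ≤ C₁ := (norm_nonneg _).trans (h1 0)
  have hF := norm_fstL_opNorm (α := ι) (β := ι)
  have hS := norm_sndL_opNorm (α := ι) (β := ι)
  refine (norm_add_le _ _).trans (add_le_add ?_ ?_)
  · rw [norm_smul, Complex.norm_exp_ofReal_mul_I, one_mul]
    refine (ContinuousLinearMap.opNorm_comp_le _ _).trans ?_
    calc _ ≤ C₁ * 1 := mul_le_mul (h1 _) hS (norm_nonneg _) hC1
      _ = _ := mul_one _
  · rw [norm_smul, norm_mul, norm_mul, Complex.norm_exp_ofReal_mul_I, Complex.norm_I, one_mul,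
      one_mul]
    refine mul_le_mul (h0 _) ?_ (norm_nonneg _) hC0
    refine ContinuousLinearMap.opNorm_le_bound _ (by positivity) fun v => ?_
    have e1 : |inner ℝ (x + (1 / 2 : ℝ) • sndL ζ) (fstL v)| ≤ (‖x‖ + 1 / 2 * ‖ζ‖) * ‖v‖ := by
      refine (abs_real_inner_le_norm _ _).trans ?_
      refine mul_le_mul ?_ (norm_fstL_le v) (norm_nonneg _) (by positivity)
      refine (norm_add_le _ _).trans ?_
      rw [norm_smul]
      have := norm_sndL_le ζ
      norm_num
      linarith
    have e2 : |inner ℝ (fstL ζ) (sndL v)| ≤ ‖ζ‖ * ‖v‖ :=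
      (abs_real_inner_le_norm _ _).trans
        (mul_le_mul (norm_fstL_le ζ) (norm_sndL_le v) (norm_nonneg _) (norm_nonneg _))
    simp only [_root_.add_apply, _root_.smul_apply,
      ContinuousLinearMap.comp_apply, Complex.ofRealCLM_apply, innerSL_apply_apply, smul_eq_mul,
      Complex.norm_real, Real.norm_eq_abs]
    refine (abs_add_le _ _).trans ?_
    rw [abs_mul, abs_of_pos (by norm_num : (0 : ℝ) < 1 / 2)]
    nlinarith

theorem exists_bound (ψ : 𝓢(Config ι, ℂ)) : ∃ C, ∀ x, ‖ψ x‖ ≤ C :=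
  ⟨_, fun x => SchwartzMap.norm_le_seminorm ℝ ψ x⟩

theorem exists_bound_fderiv (ψ : 𝓢(Config ι, ℂ)) : ∃ C, ∀ x, ‖fderiv ℝ ψ x‖ ≤ C :=
  ⟨_, fun x => SchwartzMap.norm_le_seminorm ℝ (SchwartzMap.fderivCLM ℝ (Config ι) ℂ ψ) x⟩

theorem integrable_mul_weylFun (φ ψ : 𝓢(Config ι, ℂ)) (ζ : Phase ι) :
    Integrable (fun x => star (φ x) * weylFun ζ ψ x) := by
  obtain ⟨C, hC⟩ := exists_bound ψ
  have hm : Continuous fun x => weylFun ζ ψ x := by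
    have := continuous_weylFun ψ
    fun_prop
  refine (φ.integrable (μ := volume)).norm.mul_const C |>.mono'
    ((φ.continuous.star.mul hm).aestronglyMeasurable) (.of_forall fun x => ?_)
  rw [norm_mul, norm_weylFun, norm_star]
  exact mul_le_mul_of_nonneg_left (hC _) (norm_nonneg _)

/-- The derivative of `ζ ↦ ⟨φ, W(ζ) ψ⟩` for Schwartz functions. -/
theorem hasFDerivAt_inner_weyl (φ ψ : 𝓢(Config ι, ℂ)) (ζ : Phase ι) :
    ∃ L : Phase ι →L[ℝ] ℂ,
      HasFDerivAt (fun ζ => inner ℂ (toL2 φ) (weyl ζ (toL2 ψ))) L ζ ∧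
      ∀ v, L v = Complex.I * inner ℂ (toL2 φ) (weyl ζ (toL2 (linOp v ψ))) +
        Complex.I / 2 * (symp ζ v : ℝ) * inner ℂ (toL2 φ) (weyl ζ (toL2 ψ)) := by
  obtain ⟨C₀, h0⟩ := exists_bound ψ
  obtain ⟨C₁, h1⟩ := exists_bound_fderiv ψ
  have hC0 : 0 ≤ C₀ := (norm_nonneg _).trans (h0 0)
  have hm (ζ : Phase ι) : Continuous fun x => weylFun ζ ψ x := by
    have := continuous_weylFun ψ
    fun_prop
  have hF' : Continuous fun x => weylFunDeriv ψ ζ x := by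
    unfold weylFunDeriv
    have c1 : Continuous fun x : Config ι => fderiv ℝ ψ (x + sndL ζ) :=
      (SchwartzMap.fderivCLM ℝ (Config ι) ℂ ψ).continuous.comp (by fun_prop)
    have c2 := ψ.continuous
    have c3 : Continuous fun x : Config ι => (innerSL ℝ (x + (1 / 2 : ℝ) • sndL ζ)) :=
      (innerSL ℝ).continuous.comp (by fun_prop)
    fun_prop
  -- The domination has to be uniform near `ζ`; `‖ζ‖ + 1` bounds the parameters in the unit ball
  -- around `ζ`.
  have hint : Integrable (fun x : Config ι => ‖φ x‖ * (C₁ + C₀ * (‖x‖ + (‖ζ‖ + 1)))) := by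
    have i1 := (φ.integrable (μ := volume)).norm.mul_const (C₁ + C₀ * (‖ζ‖ + 1))
    have i2 := (φ.integrable_pow_mul volume 1).mul_const C₀
    refine (i1.add i2).congr (.of_forall fun x => ?_)
    simp; ring
  have hd := hasFDerivAt_integral_of_dominated_of_fderiv_le (𝕜 := ℝ) (μ := volume) (x₀ := ζ)
    (F := fun ζ x => star (φ x) * weylFun ζ ψ x)
    (F' := fun ζ x => star (φ x) • weylFunDeriv ψ ζ x)
    (bound := fun x => ‖φ x‖ * (C₁ + C₀ * (‖x‖ + (‖ζ‖ + 1))))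
    (Metric.ball_mem_nhds ζ one_pos)
    (.of_forall fun η => (integrable_mul_weylFun φ ψ η).aestronglyMeasurable)
    (integrable_mul_weylFun φ ψ ζ)
    ((φ.continuous.star.smul hF').aestronglyMeasurable)
    (.of_forall fun x η hη => by
      rw [norm_smul, norm_star]
      refine mul_le_mul_of_nonneg_left ((norm_weylFunDeriv_le ψ h0 h1 η x).trans ?_) (norm_nonneg _)
      have : ‖η‖ ≤ ‖ζ‖ + 1 := by
        have h2 : ‖η - ζ‖ < 1 := by simpa [dist_eq_norm] using hη
        have := norm_sub_norm_le η ζ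
        linarith
      gcongr)
    hint
    (.of_forall fun x η _ => (hasFDerivAt_weylFun ψ η x).const_mul (star (φ x)))
  refine ⟨_, by simpa only [inner_toL2_weyl] using hd, fun v => ?_⟩
  rw [ContinuousLinearMap.integral_apply]
  · simp only [_root_.smul_apply, weylFunDeriv_apply, inner_toL2_weyl, smul_eq_mul]
    rw [← integral_const_mul, ← integral_const_mul, ← integral_add
      ((integrable_mul_weylFun φ _ ζ).const_mul _) ((integrable_mul_weylFun φ _ ζ).const_mul _)]
    refine integral_congr_ae (.of_forall fun x => ?_)
    ring
  · refine hint.mono' ((φ.continuous.star.smul hF').aestronglyMeasurable) (.of_forall fun x => ?_)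
    rw [norm_smul, norm_star]
    refine mul_le_mul_of_nonneg_left ((norm_weylFunDeriv_le ψ h0 h1 ζ x).trans ?_) (norm_nonneg _)
    gcongr
    linarith

/-- Commutation of Weyl operators with the canonical operators. -/
theorem inner_linOp_weyl (φ ψ : 𝓢(Config ι, ℂ)) (ζ v : Phase ι) :
    inner ℂ (toL2 (linOp v φ)) (weyl ζ (toL2 ψ)) =
      inner ℂ (toL2 φ) (weyl ζ (toL2 (linOp v ψ))) +
        (symp ζ v : ℝ) * inner ℂ (toL2 φ) (weyl ζ (toL2 ψ)) := by
  -- The same derivative is computed twice: directly, and as the conjugate of the derivative of `⟨ψ,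
  -- W(-ζ) φ⟩`. In the first the canonical operator falls on `ψ`, in the second on `φ`; equating
  -- them gives the commutation rule without an integration by parts in `x`.
  obtain ⟨L, hL, hLv⟩ := hasFDerivAt_inner_weyl φ ψ ζ
  obtain ⟨K, hK, hKv⟩ := hasFDerivAt_inner_weyl ψ φ (-ζ)
  have e1 := hL.hasLineDerivAt v
  have e2 := (hK.comp ζ (hasFDerivAt_id ζ).neg).star.hasLineDerivAt v
  have e3 : (fun x => star (((fun ζ => inner ℂ (toL2 ψ) (weyl ζ (toL2 φ))) ∘ Neg.neg) x)) =
      fun ζ => inner ℂ (toL2 φ) (weyl ζ (toL2 ψ)) := by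
    funext η
    simp only [Function.comp]
    rw [RCLike.star_def, inner_conj_symm, inner_weyl_left, neg_neg]
  have e4 := e1.unique (e3 ▸ e2)
  simp only [ContinuousLinearMap.comp_apply, _root_.neg_apply,
    ContinuousLinearMap.id_apply, hLv, hKv] at e4
  have e5 : symp (-ζ) (-v) = symp ζ v := by rw [symp_neg_left, symp_neg_right, neg_neg]
  have e6 (χ : 𝓢(Config ι, ℂ)) : (starRingEnd ℂ) (inner ℂ (toL2 ψ) (weyl (-ζ) (toL2 χ))) =
      inner ℂ (toL2 χ) (weyl ζ (toL2 ψ)) := by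
    rw [inner_conj_symm, inner_weyl_left, neg_neg]
  change _ = (starRingEnd ℂ) _ at e4
  rw [linOp_neg, toL2_smul, map_smul, inner_smul_right, e5] at e4
  simp only [map_add, map_mul, e6, Complex.conj_I, map_div₀, Complex.conj_ofReal, map_neg,
    map_one, map_ofNat] at e4
  have hI := Complex.I_mul_I
  linear_combination Complex.I * e4 + (inner ℂ (toL2 (linOp v φ)) (weyl ζ (toL2 ψ)) -
    inner ℂ (toL2 φ) (weyl ζ (toL2 (linOp v ψ))) -
    (symp ζ v : ℝ) * inner ℂ (toL2 φ) (weyl ζ (toL2 ψ))) * hI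

/-- For Schwartz vectors the matrix element is even differentiable. Since `W(ζ)` is isometric,
approximating either vector is uniform in `ζ`, and uniform limits stay continuous; the two slots are
treated one after the other. -/
theorem continuous_inner_weyl (F G : L2 ι) :
    Continuous fun ζ : Phase ι => inner ℂ F (weyl ζ G) := by
  have hS (φ ψ : 𝓢(Config ι, ℂ)) :
      Continuous fun ζ : Phase ι => inner ℂ (toL2 φ) (weyl ζ (toL2 ψ)) := by
    refine continuous_iff_continuousAt.2 fun ζ => ?_
    obtain ⟨L, hL, -⟩ := hasFDerivAt_inner_weyl φ ψ ζ
    exact hL.continuousAt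
  have h1 (F : L2 ι) (ψ : 𝓢(Config ι, ℂ)) :
      Continuous fun ζ : Phase ι => inner ℂ F (weyl ζ (toL2 ψ)) := by
    refine continuous_of_uniform_approx_of_continuous fun u hu => ?_
    obtain ⟨ε, hε, hεu⟩ := Metric.mem_uniformity_dist.1 hu
    obtain ⟨φ, hφ⟩ := denseRange_toL2.exists_dist_lt F (ε := ε / (‖toL2 ψ‖ + 1)) (by positivity)
    refine ⟨_, hS φ ψ, fun ζ => hεu ?_⟩
    rw [dist_eq_norm, ← inner_sub_left]
    refine (norm_inner_weyl_le _ _ _).trans_lt ?_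
    rw [dist_eq_norm] at hφ
    calc _ ≤ ε / (‖toL2 ψ‖ + 1) * ‖toL2 ψ‖ := by gcongr
      _ < ε / (‖toL2 ψ‖ + 1) * (‖toL2 ψ‖ + 1) := by gcongr; linarith
      _ = ε := by field_simp
  refine continuous_of_uniform_approx_of_continuous fun u hu => ?_
  obtain ⟨ε, hε, hεu⟩ := Metric.mem_uniformity_dist.1 hu
  obtain ⟨φ, hφ⟩ := denseRange_toL2.exists_dist_lt G (ε := ε / (‖F‖ + 1)) (by positivity)
  refine ⟨_, h1 F φ, fun ζ => hεu ?_⟩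
  rw [dist_eq_norm, ← inner_sub_right, ← map_sub]
  refine (norm_inner_weyl_le _ _ _).trans_lt ?_
  rw [dist_eq_norm] at hφ
  calc _ ≤ ‖F‖ * (ε / (‖F‖ + 1)) := by gcongr
    _ < (‖F‖ + 1) * (ε / (‖F‖ + 1)) := by gcongr; linarith
    _ = ε := by field_simp

/-- For isometries weak continuity is strong continuity: `‖W(ζ) G - W(ζ₀) G‖² = 2 ‖G‖² - 2 Re ⟨W(ζ₀)
G, W(ζ) G⟩`. -/
theorem continuous_weyl (G : L2 ι) : Continuous fun ζ : Phase ι => weyl ζ G := by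
  refine continuous_iff_continuousAt.2 fun ζ₀ => ?_
  rw [ContinuousAt, tendsto_iff_norm_sub_tendsto_zero]
  have h1 : Continuous fun ζ : Phase ι => inner ℂ (weyl ζ₀ G) (weyl ζ G) :=
    continuous_inner_weyl _ _
  have h2 (ζ : Phase ι) : ‖weyl ζ G - weyl ζ₀ G‖ =
      √(2 * ‖G‖ ^ 2 - 2 * (inner ℂ (weyl ζ₀ G) (weyl ζ G)).re) := by
    rw [eq_comm, Real.sqrt_eq_iff_eq_sq _ (norm_nonneg _)]
    · rw [@norm_sub_sq ℂ, ← inner_conj_symm]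
      simp only [LinearIsometry.norm_map, Complex.conj_re, RCLike.re_to_complex]
      ring
    · have := (Complex.re_le_norm (inner ℂ (weyl ζ₀ G) (weyl ζ G))).trans (norm_inner_le_norm _ _)
      simp at this
      nlinarith
  simp_rw [h2]
  have h3 : Continuous fun ζ : Phase ι =>
      √(2 * ‖G‖ ^ 2 - 2 * (inner ℂ (weyl ζ₀ G) (weyl ζ G)).re) := by fun_prop
  have h4 := h3.tendsto ζ₀
  have h5 : √(2 * ‖G‖ ^ 2 - 2 * (inner ℂ (weyl ζ₀ G) (weyl ζ₀ G)).re) = 0 := by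
    rw [inner_self_eq_norm_sq_to_K]
    simp [← Complex.ofReal_pow]
  rwa [h5] at h4

end WeylDeriv

open Filter Topology in
theorem continuous_weyl_uncurry {ι : Type} [Fintype ι] [DecidableEq ι] :
    Continuous fun p : Phase ι × L2 ι => weyl p.1 p.2 := by
  refine continuous_iff_continuousAt.2 fun ⟨ζ₀, F₀⟩ => ?_
  rw [ContinuousAt, tendsto_iff_norm_sub_tendsto_zero]
  have h1 : Tendsto (fun p : Phase ι × L2 ι => ‖p.2 - F₀‖ + ‖weyl p.1 F₀ - weyl ζ₀ F₀‖)
      (𝓝 (ζ₀, F₀)) (𝓝 0) := by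
    have h2 : Continuous fun p : Phase ι × L2 ι => ‖p.2 - F₀‖ + ‖weyl p.1 F₀ - weyl ζ₀ F₀‖ := by
      have := continuous_weyl F₀
      fun_prop
    simpa using h2.tendsto (ζ₀, F₀)
  refine squeeze_zero (fun _ => norm_nonneg _) (fun p => ?_) h1
  calc ‖weyl p.1 p.2 - weyl ζ₀ F₀‖ = ‖weyl p.1 (p.2 - F₀) + (weyl p.1 F₀ - weyl ζ₀ F₀)‖ := by
        rw [map_sub]; abel_nf
    _ ≤ _ := (norm_add_le _ _).trans (by rw [LinearIsometry.norm_map])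

/-! ### Matrices acting on Euclidean space -/

section MatrixAction

variable {n : Type} [Fintype n] [DecidableEq n]

theorem toEuclideanLin_mul (A B : Matrix n n ℝ) (x : EuclideanSpace ℝ n) :
    toEuclideanLin (A * B) x = toEuclideanLin A (toEuclideanLin B x) := by
  simp [toEuclideanLin_apply, mulVec_mulVec]

theorem toEuclideanLin_one (x : EuclideanSpace ℝ n) :
    toEuclideanLin (1 : Matrix n n ℝ) x = x := by
  simp

theorem continuous_toEuclideanLin {m n : Type} [Fintype m] [Fintype n] [DecidableEq n]
    (A : Matrix m n ℝ) :
    Continuous (toEuclideanLin A : EuclideanSpace ℝ n → EuclideanSpace ℝ m) :=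
  (toEuclideanLin A).continuous_of_finiteDimensional

theorem inner_toEuclideanLin {m n : Type} [Fintype m] [Fintype n] [DecidableEq m] [DecidableEq n]
    (A : Matrix m n ℝ) (x : EuclideanSpace ℝ m) (y : EuclideanSpace ℝ n) :
    inner ℝ x (toEuclideanLin A y) = inner ℝ (toEuclideanLin Aᵀ x) y := by
  simp only [EuclideanSpace.inner_eq_star_dotProduct, ofLp_toEuclideanLin_apply, star_trivial]
  rw [mulVec_transpose, dotProduct_comm, dotProduct_mulVec, dotProduct_comm]

theorem det_toEuclideanLin (A : Matrix n n ℝ) :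
    LinearMap.det (toEuclideanLin A : EuclideanSpace ℝ n →ₗ[ℝ] EuclideanSpace ℝ n) = A.det := by
  rw [toEuclideanLin_eq_toLin, LinearMap.det_toLin]

/-- Linear change of variables. -/
theorem integral_comp_toEuclideanLin {F : Type*} [NormedAddCommGroup F] [NormedSpace ℝ F]
    {A : Matrix n n ℝ} (hA : A.det ≠ 0) (f : EuclideanSpace ℝ n → F) :
    ∫ x, f (toEuclideanLin A x) = |A.det|⁻¹ • ∫ x, f x := by
  have hd : LinearMap.det (toEuclideanLin A : EuclideanSpace ℝ n →ₗ[ℝ] _) ≠ 0 := by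
    rwa [det_toEuclideanLin]
  let e := (LinearEquiv.ofIsUnitDet (f := (toEuclideanLin A : EuclideanSpace ℝ n →ₗ[ℝ] _))
    (v := (EuclideanSpace.basisFun n ℝ).toBasis) (v' := (EuclideanSpace.basisFun n ℝ).toBasis)
    (by rw [LinearMap.det_toMatrix]; exact hd.isUnit)).toContinuousLinearEquiv
  have he (x) : e x = toEuclideanLin A x := rfl
  have hm := Measure.map_linearMap_addHaar_eq_smul_addHaar
    (volume : Measure (EuclideanSpace ℝ n)) hd
  have := e.toHomeomorph.measurableEmbedding.integral_map (μ := volume) f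
  change ∫ y, f y ∂(Measure.map (toEuclideanLin A) volume) = ∫ x, f (toEuclideanLin A x) at this
  rw [← this, hm, integral_smul_measure, det_toEuclideanLin, abs_inv, ENNReal.toReal_ofReal
    (by positivity)]

theorem integrable_comp_toEuclideanLin {F : Type*} [NormedAddCommGroup F]
    {A : Matrix n n ℝ} (hA : A.det ≠ 0) {f : EuclideanSpace ℝ n → F} (hf : Integrable f) :
    Integrable fun x => f (toEuclideanLin A x) := by
  have hd : LinearMap.det (toEuclideanLin A : EuclideanSpace ℝ n →ₗ[ℝ] _) ≠ 0 := by
    rwa [det_toEuclideanLin]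
  have hm := Measure.map_linearMap_addHaar_eq_smul_addHaar
    (volume : Measure (EuclideanSpace ℝ n)) hd
  have h1 : Integrable f (Measure.map (toEuclideanLin A) volume) := by
    rw [hm]; exact hf.smul_measure ENNReal.ofReal_ne_top
  exact h1.comp_measurable (continuous_toEuclideanLin A).measurable

theorem hasDerivAt_toEuclideanLin {A : ℝ → Matrix n n ℝ} {A' : Matrix n n ℝ} {t : ℝ}
    (h : ∀ i j, HasDerivAt (fun s => A s i j) (A' i j) t) (x : EuclideanSpace ℝ n) :
    HasDerivAt (fun s => toEuclideanLin (A s) x) (toEuclideanLin A' x) t := by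
  have h1 : HasDerivAt (fun s => A s *ᵥ x.ofLp) (A' *ᵥ x.ofLp) t := by
    refine hasDerivAt_pi.2 fun i => ?_
    simp only [mulVec, dotProduct]
    exact HasDerivAt.fun_sum fun j _ => (h i j).mul_const _
  exact ((PiLp.continuousLinearEquiv 2 ℝ (fun _ : n => ℝ)).symm.toContinuousLinearMap.hasFDerivAt
    (x := A t *ᵥ x.ofLp)).comp_hasDerivAt t h1

theorem hasDerivAt_matrix_mul {l m n : Type} [Fintype m] {A : ℝ → Matrix l m ℝ}
    {B : ℝ → Matrix m n ℝ} {A' : Matrix l m ℝ} {B' : Matrix m n ℝ} {t : ℝ}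
    (hA : ∀ i j, HasDerivAt (fun s => A s i j) (A' i j) t)
    (hB : ∀ i j, HasDerivAt (fun s => B s i j) (B' i j) t) (i : l) (j : n) :
    HasDerivAt (fun s => (A s * B s) i j) ((A' * B t + A t * B') i j) t := by
  simp only [mul_apply, Matrix.add_apply, ← Finset.sum_add_distrib]
  exact HasDerivAt.fun_sum fun k _ => (hA i k).fun_mul (hB k j)

end MatrixAction

/-! ### The symplectic group -/

section Symplectic

variable {n : Type} [Fintype n] [DecidableEq n] {J : Matrix n n ℝ} {M Φ : ℝ → Matrix n n ℝ}

/-- The derivative of `Φᵀ J Φ` is `Φᵀ M Φ - Φᵀ M Φ`, by `Jᵀ = -J`, `J² = -1` and the symmetry of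
`M`. -/
theorem IsHamiltonianFlow.transpose_mul_mul (hΦ : IsHamiltonianFlow J M Φ) (hJ : J * J = -1)
    (hJt : Jᵀ = -J) (hM : ∀ t, (M t).IsSymm) (t : ℝ) : (Φ t)ᵀ * J * Φ t = J := by
  have hd (s : ℝ) (i j : n) : HasDerivAt (fun s => ((Φ s)ᵀ * J * Φ s) i j) 0 s := by
    have h1 (i j : n) : HasDerivAt (fun s => (Φ s)ᵀ i j) ((J * M s * Φ s)ᵀ i j) s :=
      hΦ.hamilton s j i
    have h2 := hasDerivAt_matrix_mul h1 (fun i j => hasDerivAt_const s (J i j))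
    have h3 := hasDerivAt_matrix_mul h2 (hΦ.hamilton s) i j
    refine h3.congr_deriv ?_
    have : (J * M s * Φ s)ᵀ * J + (Φ s)ᵀ * 0 = (Φ s)ᵀ * M s := by
      rw [Matrix.mul_zero, add_zero, transpose_mul, transpose_mul, hJt, (hM s).eq]
      simp only [Matrix.mul_assoc, Matrix.neg_mul, hJ, Matrix.mul_neg, neg_neg, Matrix.mul_one]
    change (((J * M s * Φ s)ᵀ * J + (Φ s)ᵀ * 0) * Φ s + (Φ s)ᵀ * J * (J * M s * Φ s) :
      Matrix n n ℝ) i j = 0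
    rw [this]
    have h4 : (Φ s)ᵀ * J * (J * M s * Φ s) = -((Φ s)ᵀ * M s * Φ s) := by
      calc _ = (Φ s)ᵀ * (J * J) * M s * Φ s := by simp only [Matrix.mul_assoc]
        _ = _ := by rw [hJ]; simp [Matrix.mul_assoc]
    rw [h4, add_neg_cancel]; rfl
  ext i j
  have := is_const_of_deriv_eq_zero (f := fun s => ((Φ s)ᵀ * J * Φ s) i j)
    (fun s => (hd s i j).differentiableAt) (fun s => (hd s i j).deriv) t 0
  simpa [hΦ.initial] using this

/-- The hypothesis exhibits `-J Aᵀ J` as a left inverse of `A`; for square matrices it is also a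
right inverse, which is the claim. -/
theorem mul_mul_transpose_of_symplectic {A : Matrix n n ℝ} (hJ : J * J = -1)
    (h : Aᵀ * J * A = J) : A * J * Aᵀ = J := by
  have h1 : (-(J * Aᵀ * J)) * A = 1 := by
    rw [Matrix.neg_mul, Matrix.mul_assoc, Matrix.mul_assoc, ← Matrix.mul_assoc Aᵀ, h, hJ, neg_neg]
  have h2 := mul_eq_one_comm.1 h1
  have h3 : A * J * Aᵀ * J * J = -J := by
    have : A * J * Aᵀ * J = -1 := by
      rw [Matrix.mul_neg] at h2
      rw [← h2, neg_neg]; simp only [Matrix.mul_assoc]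
    rw [this]; simp
  rw [Matrix.mul_assoc _ J J, hJ, Matrix.mul_neg, Matrix.mul_one] at h3
  exact neg_injective h3

theorem abs_det_of_symplectic {A : Matrix n n ℝ} (hJ : J * J = -1)
    (h : Aᵀ * J * A = J) : |A.det| = 1 := by
  have h0 : J.det ≠ 0 := by
    intro h0
    have : (J * J * (J * J)).det = 0 := by simp [h0]
    rw [hJ] at this; simp at this
  have h1 := congrArg det h
  rw [det_mul, det_mul, det_transpose] at h1
  have h2 : A.det ^ 2 = 1 := by
    apply mul_right_cancel₀ h0; linarith
  rwa [← sq_abs, pow_eq_one_iff_of_nonneg (abs_nonneg _) two_ne_zero] at h2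

theorem sympJ_mul_self (ι : Type) [Fintype ι] [DecidableEq ι] : sympJ ι * sympJ ι = -1 := by
  simp [sympJ, fromBlocks_multiply, ← fromBlocks_one, fromBlocks_neg]

theorem sympJ_transpose (ι : Type) [DecidableEq ι] : (sympJ ι)ᵀ = -sympJ ι := by
  simp [sympJ, fromBlocks_transpose, fromBlocks_neg]

end Symplectic

/-! ### Egorov's theorem for quadratic Hamiltonians -/

section Egorov

variable {ι : Type} [Fintype ι] [DecidableEq ι]

theorem symp_eq_inner (ζ v : Phase ι) : symp ζ v = inner ℝ (toEuclideanLin (-sympJ ι) ζ) v := by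
  have e1 : fstL (toEuclideanLin (-sympJ ι) ζ) = -sndL ζ := by
    ext i; simp [toEuclideanLin_apply, sympJ, neg_mulVec, fromBlocks_mulVec]
  have e2 : sndL (toEuclideanLin (-sympJ ι) ζ) = fstL ζ := by
    ext i; simp [toEuclideanLin_apply, sympJ, neg_mulVec, fromBlocks_mulVec]
  rw [inner_blocks, e1, e2, symp, inner_neg_left]; ring

theorem inner_canonicalOp_weyl (a : ι ⊕ ι) (φ ψ : 𝓢(Config ι, ℂ)) (ζ : Phase ι) :
    inner ℂ (toL2 (canonicalOp a φ)) (weyl ζ (toL2 ψ)) =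
      inner ℂ (toL2 φ) (weyl ζ (toL2 (canonicalOp a ψ))) +
        (toEuclideanLin (-sympJ ι) ζ a : ℝ) * inner ℂ (toL2 φ) (weyl ζ (toL2 ψ)) := by
  have := inner_linOp_weyl φ ψ ζ (EuclideanSpace.single a 1)
  rwa [linOp_single, linOp_single, symp_eq_inner, EuclideanSpace.inner_single_right, one_mul] at this

/-- Passing a canonical operator through `W(ζ)` shifts it by the scalar `d_a`, where `d = -J ζ`. So
`Ĥ` turns into the quantization of `(1/2) (X + d) · M (X + d)`, that is `Ĥ + (M d) · X + (1/2) d · M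
d`. That nothing of higher order appears is the reason why the evolution of Weyl operators is
exactly classical. -/
theorem inner_quadHamiltonian_weyl (M : Matrix (ι ⊕ ι) (ι ⊕ ι) ℝ) (hM : M.IsSymm)
    (φ ψ : 𝓢(Config ι, ℂ)) (ζ : Phase ι) :
    inner ℂ (toL2 (quadHamiltonian M φ)) (weyl ζ (toL2 ψ)) =
      inner ℂ (toL2 φ) (weyl ζ (toL2 (quadHamiltonian M ψ))) +
      inner ℂ (toL2 φ) (weyl ζ (toL2 (linOp (toEuclideanLin (M * -sympJ ι) ζ) ψ))) +
      (1 / 2) * (symp ζ (toEuclideanLin (M * -sympJ ι) ζ) : ℝ) *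
        inner ℂ (toL2 φ) (weyl ζ (toL2 ψ)) := by
  set d := toEuclideanLin (-sympJ ι) ζ with hd
  have hw : toEuclideanLin (M * -sympJ ι) ζ = toEuclideanLin M d := toEuclideanLin_mul _ _ _
  have hwa (a) : toEuclideanLin M d a = ∑ b, M a b * d b := by
    simp [toEuclideanLin_apply, mulVec, dotProduct]
  have hs : symp ζ (toEuclideanLin M d) = ∑ a, ∑ b, M a b * d a * d b := by
    rw [symp_eq_inner, ← hd, PiLp.inner_apply]
    refine Finset.sum_congr rfl fun a _ => ?_
    rw [hwa]
    simp only [Finset.sum_mul, inner]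
    exact Finset.sum_congr rfl fun b _ => by simp; ring
  have hMs (a b) : M b a = M a b := hM.apply a b
  have h2 (a b : ι ⊕ ι) : inner ℂ (toL2 (canonicalOp a (canonicalOp b φ))) (weyl ζ (toL2 ψ)) =
      inner ℂ (toL2 φ) (weyl ζ (toL2 (canonicalOp b (canonicalOp a ψ)))) +
      (d b : ℝ) * inner ℂ (toL2 φ) (weyl ζ (toL2 (canonicalOp a ψ))) +
      (d a : ℝ) * inner ℂ (toL2 φ) (weyl ζ (toL2 (canonicalOp b ψ))) +
      (d a : ℝ) * (d b : ℝ) * inner ℂ (toL2 φ) (weyl ζ (toL2 ψ)) := by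
    rw [inner_canonicalOp_weyl, inner_canonicalOp_weyl, inner_canonicalOp_weyl]
    ring
  rw [hw, hs]
  simp only [quadHamiltonian, linOp, toL2_smul, toL2_sum, inner_smul_left, sum_inner, inner_sum,
    map_smul, map_sum, inner_smul_right, h2, Complex.conj_ofReal, map_div₀, map_one, map_ofNat,
    Complex.ofReal_sum, hwa, Complex.ofReal_mul]
  simp only [mul_add, Finset.sum_add_distrib]
  -- Moving `X_a X_b` to the other side of the inner product reverses the order of the factors.
  -- Exchanging the indices, with `M` symmetric, restores the order here and merges the two cross
  -- terms in `s2`.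
  have s1 : ∑ a, ∑ b, (M a b : ℂ) * inner ℂ (toL2 φ) (weyl ζ (toL2 (canonicalOp b (canonicalOp a ψ)))) =
      ∑ a, ∑ b, (M a b : ℂ) * inner ℂ (toL2 φ) (weyl ζ (toL2 (canonicalOp a (canonicalOp b ψ)))) := by
    rw [Finset.sum_comm]
    exact Finset.sum_congr rfl fun a _ => Finset.sum_congr rfl fun b _ => by rw [hMs]
  have s2 : ∑ a, ∑ b, (M a b : ℂ) * ((d a : ℂ) * inner ℂ (toL2 φ) (weyl ζ (toL2 (canonicalOp b ψ)))) =
      ∑ a, ∑ b, (M a b : ℂ) * ((d b : ℂ) * inner ℂ (toL2 φ) (weyl ζ (toL2 (canonicalOp a ψ)))) := by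
    rw [Finset.sum_comm]
    exact Finset.sum_congr rfl fun a _ => Finset.sum_congr rfl fun b _ => by rw [hMs]
  have s3 : ∑ a, (∑ b, (M a b : ℂ) * (d b : ℂ)) * inner ℂ (toL2 φ) (weyl ζ (toL2 (canonicalOp a ψ))) =
      ∑ a, ∑ b, (M a b : ℂ) * ((d b : ℂ) * inner ℂ (toL2 φ) (weyl ζ (toL2 (canonicalOp a ψ)))) := by
    simp only [Finset.sum_mul, mul_assoc]
  have s4 : ∑ a, ∑ b, (M a b : ℂ) * ((d a : ℂ) * (d b : ℂ) * inner ℂ (toL2 φ) (weyl ζ (toL2 ψ))) =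
      (∑ a, ∑ b, (M a b : ℂ) * (d a : ℂ) * (d b : ℂ)) * inner ℂ (toL2 φ) (weyl ζ (toL2 ψ)) := by
    simp only [Finset.sum_mul, mul_assoc]
  rw [s1, s2, s3, s4]
  ring

open Filter Topology in
/-- Differentiating `s ↦ ⟨u(s), W(ζ(s)) v(s)⟩` when `u(t)` and `v(t)` are Schwartz functions. -/
theorem hasDerivAt_inner_weyl_curve {u v : ℝ → L2 ι} {u' v' : L2 ι} {ζ : ℝ → Phase ι}
    {ζ' : Phase ι} {t : ℝ} {φ ψ : 𝓢(Config ι, ℂ)} (hu : HasDerivAt u u' t) (hv : HasDerivAt v v' t)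
    (hζ : HasDerivAt ζ ζ' t) (hφ : u t = toL2 φ) (hψ : v t = toL2 ψ) :
    HasDerivAt (fun s => inner ℂ (u s) (weyl (ζ s) (v s)))
      (inner ℂ u' (weyl (ζ t) (toL2 ψ)) + inner ℂ (toL2 φ) (weyl (ζ t) v') +
        (Complex.I * inner ℂ (toL2 φ) (weyl (ζ t) (toL2 (linOp ζ' ψ))) +
        Complex.I / 2 * (symp (ζ t) ζ' : ℝ) * inner ℂ (toL2 φ) (weyl (ζ t) (toL2 ψ)))) t := by
  -- `W(ζ) F` need not be differentiable in `ζ` for general `F` in `L²`. The function is therefore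
  -- split as `⟨u(s) - u(t), W v(s)⟩ + ⟨u(t), W (v(s) - v(t))⟩ + ⟨u(t), W v(t)⟩`. Only the last term
  -- differentiates `W`, and there both vectors are Schwartz; the other two need only the joint
  -- continuity of `W`.
  obtain ⟨L, hL, hLv⟩ := hasFDerivAt_inner_weyl φ ψ (ζ t)
  have h3 := hL.comp_hasDerivAt t hζ
  rw [hLv] at h3
  have hW : ContinuousAt (fun s => weyl (ζ s) (v s)) t :=
    continuous_weyl_uncurry.continuousAt.comp (f := fun s => (ζ s, v s))
      (hζ.continuousAt.prodMk hv.continuousAt)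
  have h2 : HasDerivAt (fun s => inner ℂ (toL2 φ) (weyl (ζ s) (v s - v t)))
      (inner ℂ (toL2 φ) (weyl (ζ t) v')) t := by
    rw [hasDerivAt_iff_tendsto_slope]
    have e1 : Tendsto (fun s => inner ℂ (toL2 φ) (weyl (ζ s) (slope v t s))) (𝓝[≠] t)
        (𝓝 (inner ℂ (toL2 φ) (weyl (ζ t) v'))) := by
      have e2 := (continuous_weyl_uncurry.tendsto (ζ t, v')).comp
        ((hζ.continuousAt.tendsto.mono_left nhdsWithin_le_nhds).prodMk_nhds hv.tendsto_slope)
      exact tendsto_const_nhds.inner e2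
    refine e1.congr fun s => ?_
    simp only [slope, vsub_eq_sub, sub_self, map_zero, inner_zero_right, sub_zero]
    rw [RCLike.real_smul_eq_coe_smul (K := ℂ), RCLike.real_smul_eq_coe_smul (K := ℂ), map_smul,
      inner_smul_right, smul_eq_mul]
  have h1 : HasDerivAt (fun s => inner ℂ (u s - u t) (weyl (ζ s) (v s)))
      (inner ℂ u' (weyl (ζ t) (toL2 ψ))) t := by
    rw [hasDerivAt_iff_tendsto_slope]
    have e1 : Tendsto (fun s => inner ℂ (slope u t s) (weyl (ζ s) (v s))) (𝓝[≠] t)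
        (𝓝 (inner ℂ u' (weyl (ζ t) (toL2 ψ)))) := by
      rw [← hψ]
      exact hu.tendsto_slope.inner (hW.tendsto.mono_left nhdsWithin_le_nhds)
    refine e1.congr fun s => ?_
    simp only [slope, vsub_eq_sub, sub_self, inner_zero_left, sub_zero]
    rw [RCLike.real_smul_eq_coe_smul (K := ℂ), RCLike.real_smul_eq_coe_smul (K := ℂ),
      inner_smul_left, smul_eq_mul, RCLike.conj_ofReal]
  refine ((h1.add h2).add h3).congr_of_eventuallyEq (.of_forall fun s => ?_)
  simp only [Pi.add_apply, Function.comp, hφ, hψ, map_sub, inner_sub_left, inner_sub_right]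
  ring

/-- Egorov's theorem: `U W(ζ) U* = W(Φ⁻ᵀ ζ)`, with `Φ⁻ᵀ = -J Φ J` because `Φ` is symplectic. The
parameter pairs with phase space, hence the contragredient action. On Schwartz functions the time
derivative of the left side vanishes: the commutator with `Ĥ`, a linear operator plus a scalar,
cancels the motion of the parameter. Density extends the identity to `L²`. -/
theorem inner_propagator_weyl {M : ℝ → Matrix (ι ⊕ ι) (ι ⊕ ι) ℝ} (hM : ∀ t, (M t).IsSymm)
    {U : ℝ → unitary (Op ι)} (hU : IsPropagator M U) {Φ : ℝ → Matrix (ι ⊕ ι) (ι ⊕ ι) ℝ}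
    (hΦ : IsHamiltonianFlow (sympJ ι) M Φ) (t : ℝ) (ζ : Phase ι) (F G : L2 ι) :
    inner ℂ ((U t : Op ι) F)
        (weyl (toEuclideanLin (-(sympJ ι * Φ t * sympJ ι)) ζ) ((U t : Op ι) G)) =
      inner ℂ F (weyl ζ G) := by
  have hJ := sympJ_mul_self ι
  set z : ℝ → Phase ι := fun s => toEuclideanLin (-(sympJ ι * Φ s * sympJ ι)) ζ with hz
  have hz' (s : ℝ) : HasDerivAt z (-toEuclideanLin (M s * -sympJ ι) (z s)) s := by
    have h1 := hasDerivAt_matrix_mul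
      (fun i j => hasDerivAt_const s ((sympJ ι) i j)) (hΦ.hamilton s)
    have h2 := hasDerivAt_matrix_mul h1 (fun i j => hasDerivAt_const s ((sympJ ι) i j))
    have h3 := hasDerivAt_toEuclideanLin (A := fun s => -(sympJ ι * Φ s * sympJ ι))
      (A' := -(sympJ ι * (sympJ ι * M s * Φ s) * sympJ ι)) (t := s) (fun i j => by
        refine (h2 i j).neg.congr_deriv ?_
        change (-((0 * Φ s + sympJ ι * (sympJ ι * M s * Φ s)) * sympJ ι +
          (sympJ ι * Φ s) * 0) : Matrix (ι ⊕ ι) (ι ⊕ ι) ℝ) i j = _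
        simp) ζ
    refine h3.congr_deriv ?_
    rw [hz, ← toEuclideanLin_mul, ← LinearMap.neg_apply, ← map_neg]
    congr 2
    calc -(sympJ ι * (sympJ ι * M s * Φ s) * sympJ ι)
        = -((sympJ ι * sympJ ι) * M s * Φ s * sympJ ι) := by simp only [Matrix.mul_assoc]
      _ = M s * Φ s * sympJ ι := by rw [hJ]; simp
      _ = -(M s * (sympJ ι * sympJ ι) * Φ s * sympJ ι) := by rw [hJ]; simp
      _ = _ := by simp [Matrix.mul_assoc]
  have key (φ ψ : 𝓢(Config ι, ℂ)) : inner ℂ ((U t : Op ι) (toL2 φ))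
      (weyl (z t) ((U t : Op ι) (toL2 ψ))) = inner ℂ (toL2 φ) (weyl ζ (toL2 ψ)) := by
    have hd (s : ℝ) : HasDerivAt (fun s => inner ℂ ((U s : Op ι) (toL2 φ))
        (weyl (z s) ((U s : Op ι) (toL2 ψ)))) 0 s := by
      obtain ⟨φs, hφ, hφ'⟩ := hU.schrodinger s φ
      obtain ⟨ψs, hψ, hψ'⟩ := hU.schrodinger s ψ
      refine (hasDerivAt_inner_weyl_curve hφ' hψ' (hz' s) hφ hψ).congr_deriv ?_
      rw [linOp_neg, toL2_smul, map_smul, map_smul, symp_neg_right]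
      simp only [inner_smul_left, inner_smul_right, inner_quadHamiltonian_weyl (M s) (hM s),
        map_neg, Complex.conj_I, Complex.ofReal_neg]
      ring
    have h0 := is_const_of_deriv_eq_zero (fun s => (hd s).differentiableAt)
      (fun s => (hd s).deriv) t 0
    rw [h0, hU.initial, hz]
    simp only [hΦ.initial, Matrix.mul_one, hJ, neg_neg, toEuclideanLin_one]
    rfl
  refine denseRange_toL2.induction_on₂ (p := fun F G => inner ℂ ((U t : Op ι) F)
    (weyl (z t) ((U t : Op ι) G)) = inner ℂ F (weyl ζ G)) ?_ key F G
  refine isClosed_eq ?_ ?_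
  · have := (weyl (z t)).continuous
    fun_prop
  · have := (weyl ζ).continuous
    fun_prop

/-- `A = ∫ τ(ζ) W(ζ) dζ`. -/
def HasWeyl (A : Op ι) (τ : Phase ι → ℂ) : Prop :=
  ∀ F G : L2 ι, inner ℂ F (A G) = ∫ ζ, τ ζ * inner ℂ F (weyl ζ G)

theorem unitary_star_apply (V : unitary (Op ι)) (F : L2 ι) :
    (V : Op ι) (star (V : Op ι) F) = F := by
  exact congrArg (fun T : Op ι => T F) (Unitary.mul_star_self_of_mem V.2)

theorem unitary_inner_star (V : Op ι) (F G : L2 ι) :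
    inner ℂ F (V G) = inner ℂ (star V F) G := by
  rw [ContinuousLinearMap.star_eq_adjoint, ContinuousLinearMap.adjoint_inner_left]

/-- The classical flow acting on the parameters of the Weyl operators. -/
theorem HasWeyl.conj_propagator {M : ℝ → Matrix (ι ⊕ ι) (ι ⊕ ι) ℝ} (hM : ∀ t, (M t).IsSymm)
    {U : ℝ → unitary (Op ι)} (hU : IsPropagator M U) {Φ : ℝ → Matrix (ι ⊕ ι) (ι ⊕ ι) ℝ}
    (hΦ : IsHamiltonianFlow (sympJ ι) M Φ) (t : ℝ) {A : Op ι} {τ : Phase ι → ℂ}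
    (hA : HasWeyl A τ) :
    HasWeyl ((U t : Op ι) * A * star (U t : Op ι)) (fun ζ => τ (toEuclideanLin (Φ t)ᵀ ζ)) := by
  intro F G
  have hJ := sympJ_mul_self ι
  have hs := hΦ.transpose_mul_mul hJ (sympJ_transpose ι) hM t
  have hs2 := mul_mul_transpose_of_symplectic hJ hs
  have hdet := abs_det_of_symplectic hJ hs
  have hdet0 : (Φ t)ᵀ.det ≠ 0 := by
    rw [det_transpose]; intro h; rw [h] at hdet; simp at hdet
  have e1 : inner ℂ F (((U t : Op ι) * A * star (U t : Op ι)) G) =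
      inner ℂ (star (U t : Op ι) F) (A (star (U t : Op ι) G)) := by
    rw [← unitary_inner_star]; rfl
  rw [e1, hA]
  have e2 := integral_comp_toEuclideanLin hdet0
    (fun ζ => τ ζ * inner ℂ (star (U t : Op ι) F) (weyl ζ (star (U t : Op ι) G)))
  rw [det_transpose, hdet, inv_one, one_smul] at e2
  rw [← e2]
  refine integral_congr_ae (.of_forall fun ζ => ?_)
  have e3 : toEuclideanLin (-(sympJ ι * Φ t * sympJ ι)) (toEuclideanLin (Φ t)ᵀ ζ) = ζ := by
    rw [← toEuclideanLin_mul, Matrix.neg_mul, Matrix.mul_assoc, Matrix.mul_assoc,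
      ← Matrix.mul_assoc (Φ t), hs2, hJ, neg_neg, toEuclideanLin_one]
  simp only
  rw [← inner_propagator_weyl hM hU hΦ t, e3, unitary_star_apply, unitary_star_apply]

theorem HasWeyl.conj_star_propagator {M : ℝ → Matrix (ι ⊕ ι) (ι ⊕ ι) ℝ}
    (hM : ∀ t, (M t).IsSymm)
    {U : ℝ → unitary (Op ι)} (hU : IsPropagator M U) {Φ : ℝ → Matrix (ι ⊕ ι) (ι ⊕ ι) ℝ}
    (hΦ : IsHamiltonianFlow (sympJ ι) M Φ) (t : ℝ) {A : Op ι} {τ : Phase ι → ℂ}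
    (hA : HasWeyl A τ) :
    HasWeyl (star (U t : Op ι) * A * (U t : Op ι))
      (fun ζ => τ (toEuclideanLin ((Φ t)⁻¹)ᵀ ζ)) := by
  intro F G
  have hJ := sympJ_mul_self ι
  have hs := hΦ.transpose_mul_mul hJ (sympJ_transpose ι) hM t
  have hdet := abs_det_of_symplectic hJ hs
  have hdet1 : |((Φ t)⁻¹)ᵀ.det| = 1 := by
    rw [det_transpose, det_nonsing_inv, Ring.inverse_eq_inv', abs_inv, hdet, inv_one]
  have hdet0 : ((Φ t)⁻¹)ᵀ.det ≠ 0 := by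
    intro h; rw [h] at hdet1; simp at hdet1
  have e0 : ((Φ t)⁻¹)ᵀ = -(sympJ ι * Φ t * sympJ ι) := by
    have : (Φ t)⁻¹ = -(sympJ ι * (Φ t)ᵀ * sympJ ι) := by
      refine inv_eq_left_inv ?_
      rw [Matrix.neg_mul, Matrix.mul_assoc, Matrix.mul_assoc, ← Matrix.mul_assoc (Φ t)ᵀ, hs, hJ,
        neg_neg]
    rw [this]
    simp only [transpose_neg, transpose_mul, transpose_transpose, sympJ_transpose,
      Matrix.mul_neg, Matrix.neg_mul, neg_neg, Matrix.mul_assoc]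
  have e1 : inner ℂ F ((star (U t : Op ι) * A * (U t : Op ι)) G) =
      inner ℂ ((U t : Op ι) F) (A ((U t : Op ι) G)) := by
    have := unitary_inner_star (star (U t : Op ι)) F (A ((U t : Op ι) G))
    rw [star_star] at this
    rw [← this]; rfl
  rw [e1, hA]
  have e2 := integral_comp_toEuclideanLin hdet0
    (fun ζ => τ ζ * inner ℂ ((U t : Op ι) F) (weyl ζ ((U t : Op ι) G)))
  rw [hdet1, inv_one, one_smul] at e2
  rw [← e2]
  refine integral_congr_ae (.of_forall fun ζ => ?_)
  simp only
  rw [← inner_propagator_weyl hM hU hΦ t ζ, e0]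

end Egorov

/-! ### Composite systems -/

section Composite

variable {ι κ : Type} [Fintype ι] [Fintype κ]

theorem ae_comp_fstL {α β : Type} [Fintype α] [Fintype β] {p : EuclideanSpace ℝ α → Prop}
    (h : ∀ᵐ x, p x) : ∀ᵐ z : EuclideanSpace ℝ (α ⊕ β), p (fstL z) :=
  (Measure.quasiMeasurePreserving_fst.comp
    measurePreserving_split.quasiMeasurePreserving).ae h

theorem ae_comp_sndL {α β : Type} [Fintype α] [Fintype β] {p : EuclideanSpace ℝ β → Prop}
    (h : ∀ᵐ x, p x) : ∀ᵐ z : EuclideanSpace ℝ (α ⊕ β), p (sndL z) :=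
  (Measure.quasiMeasurePreserving_snd.comp
    measurePreserving_split.quasiMeasurePreserving).ae h

theorem tensor_coeFn (ψ : L2 ι) (φ : L2 κ) :
    tensor ψ φ =ᵐ[volume] fun x => ψ (fstL x) * φ (sndL x) :=
  (memLp_tensor ψ φ).coeFn_toLp

theorem inner_tensor (ψ ψ' : L2 ι) (φ φ' : L2 κ) :
    inner ℂ (tensor ψ φ) (tensor ψ' φ') = inner ℂ ψ ψ' * inner ℂ φ φ' := by
  rw [L2.inner_def, L2.inner_def, L2.inner_def, ← integral_prod_mul]
  rw [← Measure.volume_eq_prod, ← integral_split]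
  refine integral_congr_ae ?_
  filter_upwards [tensor_coeFn ψ φ, tensor_coeFn ψ' φ'] with x h1 h2
  rw [h1, h2]
  simp only [RCLike.inner_apply, map_mul]
  ring

theorem norm_tensor (ψ : L2 ι) (φ : L2 κ) : ‖tensor ψ φ‖ = ‖ψ‖ * ‖φ‖ := by
  have h := inner_tensor ψ ψ φ φ
  simp only [inner_self_eq_norm_sq_to_K] at h
  norm_cast at h
  rw [← mul_pow] at h
  exact (pow_left_inj₀ (norm_nonneg _) (by positivity) two_ne_zero).1 h

theorem tensor_add_right (ψ : L2 ι) (φ φ' : L2 κ) :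
    tensor ψ (φ + φ') = tensor ψ φ + tensor ψ φ' := by
  refine Lp.ext ?_
  filter_upwards [tensor_coeFn ψ (φ + φ'), tensor_coeFn ψ φ, tensor_coeFn ψ φ',
    Lp.coeFn_add (tensor ψ φ) (tensor ψ φ'), ae_comp_sndL (Lp.coeFn_add φ φ')] with x h1 h2 h3 h4 h5
  rw [h1, h4, Pi.add_apply, h2, h3, h5, Pi.add_apply, mul_add]

theorem tensor_smul_right (c : ℂ) (ψ : L2 ι) (φ : L2 κ) :
    tensor ψ (c • φ) = c • tensor ψ φ := by
  refine Lp.ext ?_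
  filter_upwards [tensor_coeFn ψ (c • φ), tensor_coeFn ψ φ,
    Lp.coeFn_smul c (tensor ψ φ), ae_comp_sndL (Lp.coeFn_smul c φ)] with x h1 h2 h4 h5
  rw [h1, h4, Pi.smul_apply, h2, h5, Pi.smul_apply, smul_eq_mul, smul_eq_mul]
  ring

theorem tensor_sub_left (ψ ψ' : L2 ι) (φ : L2 κ) :
    tensor (ψ - ψ') φ = tensor ψ φ - tensor ψ' φ := by
  refine Lp.ext ?_
  filter_upwards [tensor_coeFn (ψ - ψ') φ, tensor_coeFn ψ φ, tensor_coeFn ψ' φ,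
    Lp.coeFn_sub (tensor ψ φ) (tensor ψ' φ), ae_comp_fstL (Lp.coeFn_sub ψ ψ')] with x h1 h2 h3 h4 h5
  rw [h1, h4, Pi.sub_apply, h2, h3, h5, Pi.sub_apply, sub_mul]

/-- `φ ↦ ψ ⊗ φ`. -/
def tensorCLM (ψ : L2 ι) : L2 κ →L[ℂ] L2 (ι ⊕ κ) :=
  LinearMap.mkContinuous
    { toFun := tensor ψ
      map_add' := tensor_add_right ψ
      map_smul' := fun c φ => tensor_smul_right c ψ φ } ‖ψ‖ fun φ => (norm_tensor ψ φ).le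

@[simp] theorem tensorCLM_apply (ψ : L2 ι) (φ : L2 κ) : tensorCLM ψ φ = tensor ψ φ := rfl

theorem continuous_tensor_left (φ : L2 κ) : Continuous fun ψ : L2 ι => tensor ψ φ := by
  refine LipschitzWith.continuous (K := ‖φ‖₊) (LipschitzWith.of_dist_le_mul fun ψ ψ' => ?_)
  rw [dist_eq_norm, dist_eq_norm, ← tensor_sub_left, norm_tensor, mul_comm]
  rfl

/-- The tensor product of Schwartz functions. -/
def tensorS (φ : 𝓢(Config ι, ℂ)) (g : 𝓢(Config κ, ℂ)) : 𝓢(Config (ι ⊕ κ), ℂ) :=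
  externalProduct φ g fstL sndL norm_le_blocks

theorem toL2_tensorS (φ : 𝓢(Config ι, ℂ)) (g : 𝓢(Config κ, ℂ)) :
    toL2 (tensorS φ g) = tensor (toL2 φ) (toL2 g) := by
  refine Lp.ext ?_
  filter_upwards [toL2_coeFn (tensorS φ g), tensor_coeFn (toL2 φ) (toL2 g),
    ae_comp_fstL (toL2_coeFn φ), ae_comp_sndL (toL2_coeFn g)] with x h1 h2 h3 h4
  rw [h1, h2, h3, h4]
  rfl

/-! ### The phase space of the composite system -/

/-- Reordering `((x, y), (ξ, η))` as `((x, ξ), (y, η))`. -/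
def reorder (ι κ : Type) [Fintype ι] [Fintype κ] :
    Phase (ι ⊕ κ) ≃ₗᵢ[ℝ] EuclideanSpace ℝ ((ι ⊕ ι) ⊕ (κ ⊕ κ)) :=
  LinearIsometryEquiv.piLpCongrLeft 2 ℝ ℝ (Equiv.sumSumSumComm ι κ ι κ)

/-- The phase space variables of the first subsystem. -/
def phaseFst : Phase (ι ⊕ κ) →L[ℝ] Phase ι :=
  fstL.comp (reorder ι κ).toContinuousLinearEquiv.toContinuousLinearMap

/-- The phase space variables of the second subsystem. -/
def phaseSnd : Phase (ι ⊕ κ) →L[ℝ] Phase κ :=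
  sndL.comp (reorder ι κ).toContinuousLinearEquiv.toContinuousLinearMap

/-- The phase space point of the composite system. -/
def phaseJoin (z : Phase ι) (u : Phase κ) : Phase (ι ⊕ κ) := (reorder ι κ).symm (join z u)

@[simp] theorem phaseFst_join (z : Phase ι) (u : Phase κ) : phaseFst (phaseJoin z u) = z := by
  simp [phaseFst, phaseJoin]

@[simp] theorem phaseSnd_join (z : Phase ι) (u : Phase κ) : phaseSnd (phaseJoin z u) = u := by
  simp [phaseSnd, phaseJoin]

@[simp] theorem phaseJoin_fst_snd (ζ : Phase (ι ⊕ κ)) :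
    phaseJoin (phaseFst ζ) (phaseSnd ζ) = ζ := by
  simp [phaseFst, phaseSnd, phaseJoin]

@[fun_prop]
theorem continuous_phaseJoin :
    Continuous fun p : Phase ι × Phase κ => phaseJoin p.1 p.2 :=
  (reorder ι κ).symm.continuous.comp continuous_join

theorem norm_le_phase (ζ : Phase (ι ⊕ κ)) : ‖ζ‖ ≤ ‖phaseFst ζ‖ + ‖phaseSnd ζ‖ := by
  rw [← (reorder ι κ).norm_map ζ]
  exact norm_le_blocks _

theorem norm_phaseFst_le (ζ : Phase (ι ⊕ κ)) : ‖phaseFst ζ‖ ≤ ‖ζ‖ := by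
  rw [← (reorder ι κ).norm_map ζ]
  exact norm_fstL_le _

theorem measurePreserving_phase :
    MeasurePreserving (fun ζ : Phase (ι ⊕ κ) => (phaseFst ζ, phaseSnd ζ)) volume
      ((volume : Measure (Phase ι)).prod volume) :=
  measurePreserving_split.comp (reorder ι κ).measurePreserving

theorem measurableEmbedding_phase :
    MeasurableEmbedding fun ζ : Phase (ι ⊕ κ) => (phaseFst ζ, phaseSnd ζ) :=
  (splitEquiv (α := ι ⊕ ι) (β := κ ⊕ κ)).measurableEmbedding.comp
    (reorder ι κ).toHomeomorph.measurableEmbedding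

theorem integral_phase {F : Type*} [NormedAddCommGroup F] [NormedSpace ℝ F]
    (f : Phase ι × Phase κ → F) :
    ∫ ζ : Phase (ι ⊕ κ), f (phaseFst ζ, phaseSnd ζ) = ∫ p, f p :=
  measurePreserving_phase.integral_comp measurableEmbedding_phase f

theorem integrable_phase_iff {F : Type*} [NormedAddCommGroup F] (f : Phase ι × Phase κ → F) :
    Integrable (fun ζ : Phase (ι ⊕ κ) => f (phaseFst ζ, phaseSnd ζ)) ↔ Integrable f :=
  measurePreserving_phase.integrable_comp_emb measurableEmbedding_phase

theorem fstL_phaseFst (ζ : Phase (ι ⊕ κ)) : fstL (phaseFst ζ) = fstL (fstL ζ) := by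
  ext i; rfl

theorem sndL_phaseFst (ζ : Phase (ι ⊕ κ)) : sndL (phaseFst ζ) = fstL (sndL ζ) := by
  ext i; rfl

theorem fstL_phaseSnd (ζ : Phase (ι ⊕ κ)) : fstL (phaseSnd ζ) = sndL (fstL ζ) := by
  ext i; rfl

theorem sndL_phaseSnd (ζ : Phase (ι ⊕ κ)) : sndL (phaseSnd ζ) = sndL (sndL ζ) := by
  ext i; rfl

theorem symp_phase (ζ v : Phase (ι ⊕ κ)) :
    symp ζ v = symp (phaseFst ζ) (phaseFst v) + symp (phaseSnd ζ) (phaseSnd v) := by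
  simp only [symp, fstL_phaseFst, sndL_phaseFst, fstL_phaseSnd, sndL_phaseSnd, inner_blocks]
  ring

theorem weylPhase_phase (ζ : Phase (ι ⊕ κ)) (x : Config (ι ⊕ κ)) :
    weylPhase ζ x = weylPhase (phaseFst ζ) (fstL x) + weylPhase (phaseSnd ζ) (sndL x) := by
  simp only [weylPhase, fstL_phaseFst, sndL_phaseFst, fstL_phaseSnd, sndL_phaseSnd,
    inner_blocks (fstL ζ)]
  ring

/-- The phase of a Weyl operator is a sum over the two subsystems and its translation acts on each
separately. -/
theorem weyl_tensor (ζ : Phase (ι ⊕ κ)) (ψ : L2 ι) (φ : L2 κ) :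
    weyl ζ (tensor ψ φ) = tensor (weyl (phaseFst ζ) ψ) (weyl (phaseSnd ζ) φ) := by
  refine Lp.ext ?_
  filter_upwards [weyl_coeFn_of ζ (tensor_coeFn ψ φ),
    tensor_coeFn (weyl (phaseFst ζ) ψ) (weyl (phaseSnd ζ) φ),
    ae_comp_fstL (weyl_coeFn (phaseFst ζ) ψ), ae_comp_sndL (weyl_coeFn (phaseSnd ζ) φ)]
    with x h1 h2 h3 h4
  rw [h1, h2, h3, h4]
  simp only [weylFun, map_add, weylPhase_phase ζ x, sndL_phaseFst, sndL_phaseSnd]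
  push_cast
  rw [add_mul, Complex.exp_add]
  ring

end Composite

/-! ### Coherent states -/

section Frame

variable {ι : Type} [Fintype ι] [DecidableEq ι]

/-- Any nonzero Schwartz function can serve as the window of the coherent states; no explicit
Gaussian is needed. -/
theorem exists_toL2_ne_zero (ι : Type) [Fintype ι] :
    ∃ g : 𝓢(Config ι, ℂ), toL2 g ≠ 0 := by
  let b : ContDiffBump (0 : Config ι) := ⟨1, 2, by norm_num, by norm_num⟩
  have h1 : HasCompactSupport fun x => ((b x : ℝ) : ℂ) :=
    b.hasCompactSupport.comp_left Complex.ofReal_zero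
  have h2 : ContDiff ℝ ((⊤ : ℕ∞) : WithTop ℕ∞) fun x => ((b x : ℝ) : ℂ) :=
    Complex.ofRealCLM.contDiff.comp b.contDiff
  refine ⟨h1.toSchwartzMap h2, fun h => ?_⟩
  have h3 : h1.toSchwartzMap h2 = 0 :=
    SchwartzMap.injective_toLp 2 volume (h.trans (SchwartzMap.toLpCLM ℂ (E := Config ι) ℂ 2
      volume).map_zero.symm)
  have h4 := congrArg (fun f : 𝓢(Config ι, ℂ) => f 0) h3
  have h5 : b 0 = 1 := b.one_of_mem_closedBall (by simp [b])
  change ((b 0 : ℝ) : ℂ) = 0 at h4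
  rw [h5] at h4
  simp at h4

/-- The Schwartz function `x ↦ φ̄(x) g(x + q)`. -/
def translateProduct (φ g : 𝓢(Config ι, ℂ)) (q : Config ι) : 𝓢(Config ι, ℂ) :=
  SchwartzMap.pairing (ContinuousLinearMap.mul ℂ ℂ)
    (φ.postcompCLM (𝕜 := ℝ) Complex.conjCLE.toContinuousLinearMap)
    (SchwartzMap.compSubConstCLM ℂ (-q) g)

theorem translateProduct_apply (φ g : 𝓢(Config ι, ℂ)) (q x : Config ι) :
    translateProduct φ g q x = star (φ x) * g (x + q) := by
  simp [translateProduct]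

-- For fixed `q`, the matrix element is, up to the unimodular factor `exp(i p · q / 2)`, a Fourier
-- integral of `φ̄(x) g(x + q)`. The scaling by `-(2π)⁻¹` passes from the character `exp(i p · x)`
-- to the normalization of `𝓕`.
open FourierTransform in
theorem norm_inner_weyl_eq_fourier (φ g : 𝓢(Config ι, ℂ)) (p q : Config ι) :
    ‖inner ℂ (toL2 φ) (weyl (join p q) (toL2 g))‖ =
      ‖𝓕 (translateProduct φ g q) (-(2 * Real.pi)⁻¹ • p)‖ := by
  rw [inner_toL2_weyl, SchwartzMap.fourier_coe, Real.fourier_eq']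
  have h : (fun x => star (φ x) * weylFun (join p q) g x) = fun x =>
      Complex.exp ((inner ℝ p q / 2 : ℝ) * Complex.I) *
        (Complex.exp (((-2 * Real.pi * inner ℝ x (-(2 * Real.pi)⁻¹ • p) : ℝ) : ℂ) * Complex.I) •
          translateProduct φ g q x) := by
    funext x
    have : weylPhase (join p q) x =
        -2 * Real.pi * inner ℝ x (-(2 * Real.pi)⁻¹ • p) + inner ℝ p q / 2 := by
      have := Real.pi_ne_zero
      simp only [weylPhase, fstL_join, sndL_join, real_inner_smul_right, real_inner_comm p]
      field_simp
    rw [weylFun, this, translateProduct_apply]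
    push_cast
    rw [add_mul, Complex.exp_add]
    simp only [smul_eq_mul, sndL_join]
    ring
  rw [h, integral_const_mul, norm_mul, Complex.norm_exp_ofReal_mul_I, one_mul]

-- Moyal's identity: Plancherel in `p` for each `q`, with Jacobian `(2π)ⁿ`, then Tonelli and
-- translation invariance in `q`. Lower Lebesgue integrals make it unnecessary to know integrability
-- beforehand.
open FourierTransform in
theorem lintegral_inner_weyl_schwartz (φ g : 𝓢(Config ι, ℂ)) :
    ∫⁻ v : Phase ι, ‖inner ℂ (toL2 φ) (weyl v (toL2 g))‖ₑ ^ 2 =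
      ENNReal.ofReal ((2 * Real.pi) ^ Fintype.card ι) * (‖toL2 φ‖ₑ ^ 2 * ‖toL2 g‖ₑ ^ 2) := by
  have hsq (f : 𝓢(Config ι, ℂ)) : ∫⁻ x, ‖f x‖ₑ ^ 2 = ENNReal.ofReal (∫ x, ‖f x‖ ^ 2) := by
    rw [ofReal_integral_eq_lintegral_ofReal]
    · simp [← ofReal_norm, ENNReal.ofReal_pow]
    · exact (memLp_two_iff_integrable_sq_norm (f.memLp 2).1).1 (f.memLp 2)
    · exact .of_forall fun x => by positivity
  have hn (f : 𝓢(Config ι, ℂ)) : ∫⁻ x, ‖f x‖ₑ ^ 2 = ‖toL2 f‖ₑ ^ 2 := by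
    have : ‖toL2 f‖ ^ 2 = ∫ x, ‖f x‖ ^ 2 := by
      have h1 := f.inner_toL2_toL2_eq f volume
      change inner ℂ (toL2 f) (toL2 f) = _ at h1
      simp only [inner_self_eq_norm_sq_to_K] at h1
      have h2 := integral_ofReal (𝕜 := ℂ) (f := fun x => ‖f x‖ ^ 2) (μ := volume)
      push_cast at h2
      exact_mod_cast h1.trans h2
    rw [hsq, ← this, ENNReal.ofReal_pow (norm_nonneg _), ofReal_norm]
  have hp (q : Config ι) : ∫⁻ p : Config ι, ‖inner ℂ (toL2 φ) (weyl (join p q) (toL2 g))‖ₑ ^ 2 =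
      ENNReal.ofReal ((2 * Real.pi) ^ Fintype.card ι) *
        ∫⁻ x, ‖φ x‖ₑ ^ 2 * ‖g (x + q)‖ₑ ^ 2 := by
    have e1 (x) : ‖φ x‖ₑ ^ 2 * ‖g (x + q)‖ₑ ^ 2 = ‖translateProduct φ g q x‖ₑ ^ 2 := by
      rw [translateProduct_apply, enorm_mul, mul_pow, ← ofReal_norm (star _), norm_star,
        ofReal_norm]
    simp_rw [e1]
    rw [hsq, ← SchwartzMap.integral_norm_sq_fourier, ← ENNReal.ofReal_mul (by positivity)]
    have e2 := Measure.integral_comp_smul (volume : Measure (Config ι))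
      (fun p => ‖𝓕 (translateProduct φ g q) p‖ ^ 2) (-(2 * Real.pi)⁻¹)
    have e3 : |((-(2 * Real.pi)⁻¹) ^ Module.finrank ℝ (Config ι))⁻¹| =
        (2 * Real.pi) ^ Fintype.card ι := by
      rw [finrank_euclideanSpace, abs_inv, abs_pow, abs_neg, abs_inv,
        abs_of_pos (by positivity), inv_pow, inv_inv]
    rw [e3, smul_eq_mul] at e2
    rw [← e2, ofReal_integral_eq_lintegral_ofReal]
    · refine lintegral_congr fun p => ?_
      rw [← norm_inner_weyl_eq_fourier, ENNReal.ofReal_pow (norm_nonneg _), ofReal_norm]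
    · have h1 := (memLp_two_iff_integrable_sq_norm
        ((𝓕 (translateProduct φ g q)).memLp 2 volume).1).1 ((𝓕 (translateProduct φ g q)).memLp 2)
      exact h1.comp_smul (by simp [Real.pi_ne_zero])
    · exact .of_forall fun x => by positivity
  have hc : Measurable fun v : Phase ι => ‖inner ℂ (toL2 φ) (weyl v (toL2 g))‖ₑ ^ 2 := by
    have := continuous_inner_weyl (toL2 φ) (toL2 g)
    exact (this.enorm.measurable).pow_const 2
  have h1 := measurePreserving_split.lintegral_comp_emb
    (splitEquiv (α := ι) (β := ι)).measurableEmbedding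
    (fun p => ‖inner ℂ (toL2 φ) (weyl (join p.1 p.2) (toL2 g))‖ₑ ^ 2)
  simp only [join_fstL_sndL] at h1
  have hj : Measurable fun p : Config ι × Config ι =>
      ‖inner ℂ (toL2 φ) (weyl (join p.1 p.2) (toL2 g))‖ₑ ^ 2 := hc.comp continuous_join.measurable
  rw [h1, lintegral_prod_symm' _ hj]
  simp only [hp]
  have hm : Measurable fun x : Config ι × Config ι => ‖φ x.2‖ₑ ^ 2 * ‖g (x.2 + x.1)‖ₑ ^ 2 := by
    have c1 := φ.continuous
    have c2 := g.continuous
    exact (Continuous.measurable (by fun_prop)).enorm.pow_const 2 |>.mul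
      ((Continuous.measurable (by fun_prop)).enorm.pow_const 2)
  rw [lintegral_const_mul _ hm.lintegral_prod_right', lintegral_lintegral_swap hm.aemeasurable]
  congr 1
  have hg (x : Config ι) : ∫⁻ q, ‖φ x‖ₑ ^ 2 * ‖g (x + q)‖ₑ ^ 2 = ‖φ x‖ₑ ^ 2 * ‖toL2 g‖ₑ ^ 2 := by
    have c2 : Continuous fun q => g (x + q) := g.continuous.comp (by fun_prop)
    rw [lintegral_const_mul _ (c2.measurable.enorm.pow_const 2),
      lintegral_add_left_eq_self (fun q => ‖g q‖ₑ ^ 2), hn]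
  simp_rw [hg]
  rw [lintegral_mul_const _ (φ.continuous.measurable.enorm.pow_const 2), hn]

/-- Approximation by Schwartz functions and Fatou's lemma. An inequality is enough to define the
coherent state transform as a bounded map; equality then follows from density and continuity in
`norm_frameMap_sq`. -/
theorem lintegral_inner_weyl_le (F : L2 ι) (g : 𝓢(Config ι, ℂ)) :
    ∫⁻ v : Phase ι, ‖inner ℂ F (weyl v (toL2 g))‖ₑ ^ 2 ≤
      ENNReal.ofReal ((2 * Real.pi) ^ Fintype.card ι) * (‖F‖ₑ ^ 2 * ‖toL2 g‖ₑ ^ 2) := by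
  obtain ⟨u, hu, huF⟩ := mem_closure_iff_seq_limit.1 (denseRange_toL2 F)
  choose φ hφ using hu
  have h1 : ∀ v : Phase ι, ‖inner ℂ F (weyl v (toL2 g))‖ₑ ^ 2 =
      Filter.liminf (fun n => ‖inner ℂ (u n) (weyl v (toL2 g))‖ₑ ^ 2) Filter.atTop := fun v =>
    (((ENNReal.continuous_pow 2).tendsto _ |>.comp
      (huF.inner tendsto_const_nhds).enorm).liminf_eq).symm
  simp_rw [h1]
  refine (lintegral_liminf_le fun n =>
    ((continuous_inner_weyl (u n) (toL2 g)).enorm.measurable).pow_const 2).trans ?_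
  have h2 (n) : ∫⁻ v : Phase ι, ‖inner ℂ (u n) (weyl v (toL2 g))‖ₑ ^ 2 =
      ENNReal.ofReal ((2 * Real.pi) ^ Fintype.card ι) * (‖u n‖ₑ ^ 2 * ‖toL2 g‖ₑ ^ 2) := by
    rw [← hφ n, lintegral_inner_weyl_schwartz]
  simp_rw [h2]
  refine le_of_eq (Filter.Tendsto.liminf_eq ?_)
  refine ENNReal.Tendsto.const_mul (ENNReal.Tendsto.mul_const
    ((ENNReal.continuous_pow 2).tendsto _ |>.comp huF.enorm) ?_) ?_
  · right; simp
  · right; exact ENNReal.ofReal_ne_top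

theorem eLpNorm_two_sq {α : Type*} [MeasurableSpace α] (μ : Measure α) (f : α → ℂ) :
    eLpNorm f 2 μ ^ 2 = ∫⁻ x, ‖f x‖ₑ ^ 2 ∂μ := by
  have := eLpNorm_nnreal_pow_eq_lintegral (f := f) (μ := μ) (p := 2) two_ne_zero
  simpa using this

theorem continuous_inner_weyl_left (F G : L2 ι) :
    Continuous fun v : Phase ι => inner ℂ (weyl v G) F :=
  (continuous_weyl G).inner continuous_const

theorem memLp_frame (g : 𝓢(Config ι, ℂ)) (F : L2 ι) :
    MemLp (fun v : Phase ι => inner ℂ (weyl v (toL2 g)) F) 2 volume := by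
  refine ⟨(continuous_inner_weyl_left F (toL2 g)).aestronglyMeasurable, ?_⟩
  have h1 := eLpNorm_two_sq volume fun v : Phase ι => inner ℂ (weyl v (toL2 g)) F
  have h2 (v : Phase ι) : ‖inner ℂ (weyl v (toL2 g)) F‖ₑ = ‖inner ℂ F (weyl v (toL2 g))‖ₑ := by
    rw [← ofReal_norm, norm_inner_symm, ofReal_norm]
  simp_rw [h2] at h1
  have h3 := h1.trans_le (lintegral_inner_weyl_le F g)
  have h4 : eLpNorm (fun v : Phase ι => inner ℂ (weyl v (toL2 g)) F) 2 volume ^ 2 < ⊤ :=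
    h3.trans_lt (by finiteness)
  exact (ENNReal.pow_lt_top_iff).1 h4 |>.resolve_right two_ne_zero

theorem enorm_frame_sq (g : 𝓢(Config ι, ℂ)) (F : L2 ι) :
    ‖(memLp_frame g F).toLp _‖ₑ ^ 2 = ∫⁻ v : Phase ι, ‖inner ℂ F (weyl v (toL2 g))‖ₑ ^ 2 := by
  rw [Lp.enorm_toLp, eLpNorm_two_sq]
  refine lintegral_congr fun v => ?_
  rw [← ofReal_norm, norm_inner_symm, ofReal_norm]

/-- The coherent state transform `F ↦ (v ↦ ⟨W(v) g, F⟩)`. -/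
def frameMap (g : 𝓢(Config ι, ℂ)) : L2 ι →L[ℂ] Lp ℂ 2 (volume : Measure (Phase ι)) :=
  LinearMap.mkContinuous
    { toFun := fun F => (memLp_frame g F).toLp _
      map_add' := fun F G => by
        rw [← MemLp.toLp_add]
        congr 1
        funext v
        simp [inner_add_right]
      map_smul' := fun c F => by
        rw [RingHom.id_apply, ← MemLp.toLp_const_smul]
        congr 1
        funext v
        simp [inner_smul_right] }
    (√((2 * Real.pi) ^ Fintype.card ι) * ‖toL2 g‖) fun F => by
      have h1 := (enorm_frame_sq g F).trans_le (lintegral_inner_weyl_le F g)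
      have h2 := ENNReal.toReal_mono (by finiteness) h1
      simp only [ENNReal.toReal_pow, toReal_enorm, ENNReal.toReal_mul] at h2
      rw [ENNReal.toReal_ofReal (by positivity)] at h2
      refine le_of_sq_le_sq (h2.trans_eq ?_) (by positivity)
      rw [mul_pow (_ * _), mul_pow (√_), Real.sq_sqrt (by positivity)]
      ring

theorem frameMap_coeFn (g : 𝓢(Config ι, ℂ)) (F : L2 ι) :
    frameMap g F =ᵐ[volume] fun v => inner ℂ (weyl v (toL2 g)) F :=
  (memLp_frame g F).coeFn_toLp

theorem enorm_frameMap_sq (g : 𝓢(Config ι, ℂ)) (F : L2 ι) :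
    ‖frameMap g F‖ₑ ^ 2 = ∫⁻ v : Phase ι, ‖inner ℂ F (weyl v (toL2 g))‖ₑ ^ 2 :=
  enorm_frame_sq g F

theorem norm_frameMap_sq (g : 𝓢(Config ι, ℂ)) (F : L2 ι) :
    ‖frameMap g F‖ ^ 2 = (2 * Real.pi) ^ Fintype.card ι * ‖toL2 g‖ ^ 2 * ‖F‖ ^ 2 := by
  refine denseRange_toL2.induction_on (p := fun F => ‖frameMap g F‖ ^ 2 =
    (2 * Real.pi) ^ Fintype.card ι * ‖toL2 g‖ ^ 2 * ‖F‖ ^ 2) F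
    (isClosed_eq (by fun_prop) (by fun_prop)) fun φ => ?_
  have h1 := enorm_frameMap_sq g (toL2 φ)
  rw [lintegral_inner_weyl_schwartz] at h1
  have h2 := congrArg ENNReal.toReal h1
  simp only [ENNReal.toReal_pow, toReal_enorm, ENNReal.toReal_mul] at h2
  rw [h2, ENNReal.toReal_ofReal (by positivity)]
  ring

theorem inner_map_eq_of_norm_sq_eq {E F : Type*} [NormedAddCommGroup E] [InnerProductSpace ℂ E]
    [NormedAddCommGroup F] [InnerProductSpace ℂ F] (T : E →L[ℂ] F) {c : ℝ}
    (h : ∀ x, ‖T x‖ ^ 2 = c * ‖x‖ ^ 2) (x y : E) : inner ℂ (T x) (T y) = c * inner ℂ x y := by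
  have h1 (X : E) : (‖T X‖ : ℂ) ^ 2 = c * (‖X‖ : ℂ) ^ 2 := by
    exact_mod_cast congrArg (fun r : ℝ => (r : ℂ)) (h X)
  rw [inner_eq_sum_norm_sq_div_four (𝕜 := ℂ), inner_eq_sum_norm_sq_div_four (𝕜 := ℂ) x y]
  simp only [← map_add, ← map_sub, ← map_smul, RCLike.ofReal_eq_complex_ofReal, h1]
  ring

theorem inner_frameMap (g : 𝓢(Config ι, ℂ)) (F G : L2 ι) :
    inner ℂ (frameMap g F) (frameMap g G) =
      ((2 * Real.pi) ^ Fintype.card ι * ‖toL2 g‖ ^ 2 : ℝ) * inner ℂ F G :=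
  inner_map_eq_of_norm_sq_eq (frameMap g) (norm_frameMap_sq g) F G

/-- Resolution of the identity by coherent states: the frame map is a multiple of an isometry, and
polarization turns norms into inner products. -/
theorem integral_frame (g : 𝓢(Config ι, ℂ)) (F G : L2 ι) :
    ∫ v : Phase ι, inner ℂ F (weyl v (toL2 g)) * inner ℂ (weyl v (toL2 g)) G =
      ((2 * Real.pi) ^ Fintype.card ι * ‖toL2 g‖ ^ 2 : ℝ) * inner ℂ F G := by
  rw [← inner_frameMap, L2.inner_def]
  refine integral_congr_ae ?_
  filter_upwards [frameMap_coeFn g F, frameMap_coeFn g G] with v h1 h2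
  rw [h1, h2, RCLike.inner_apply, inner_conj_symm, mul_comm]

/-- Coherent states separate the elements of `L²`. -/
theorem eq_zero_of_inner_frame {g : 𝓢(Config ι, ℂ)} (hg : toL2 g ≠ 0) {F : L2 ι}
    (h : ∀ v : Phase ι, inner ℂ (weyl v (toL2 g)) F = 0) : F = 0 := by
  have h1 := integral_frame g F F
  simp only [h, mul_zero, integral_zero] at h1
  have hp : ((2 * Real.pi) ^ Fintype.card ι * ‖toL2 g‖ ^ 2 : ℝ) ≠ 0 := by
    have := norm_ne_zero_iff.2 hg
    positivity
  exact inner_self_eq_zero.1 ((mul_eq_zero.1 h1.symm).resolve_left (by exact_mod_cast hp))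

/-! ### Operators with an integrable Fourier–Weyl transform -/

theorem integrable_smul_weyl {τ : Phase ι → ℂ} (hτ : Integrable τ) (G : L2 ι) :
    Integrable fun ζ => τ ζ • weyl ζ G :=
  (hτ.norm.mul_const ‖G‖).mono'
    (hτ.aestronglyMeasurable.smul (continuous_weyl G).aestronglyMeasurable)
    (.of_forall fun ζ => by rw [norm_smul, LinearIsometry.norm_map])

theorem integrable_mul_inner_weyl {τ : Phase ι → ℂ} (hτ : Integrable τ) (F G : L2 ι) :
    Integrable fun ζ => τ ζ * inner ℂ F (weyl ζ G) :=
  (hτ.norm.mul_const (‖F‖ * ‖G‖)).mono'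
    (hτ.aestronglyMeasurable.mul (continuous_inner_weyl F G).aestronglyMeasurable)
    (.of_forall fun ζ => by
      rw [norm_mul]; exact mul_le_mul_of_nonneg_left (norm_inner_weyl_le _ _ _) (norm_nonneg _))

theorem exists_hasWeyl {τ : Phase ι → ℂ} (hτ : Integrable τ) : ∃ A : Op ι, HasWeyl A τ := by
  refine ⟨LinearMap.mkContinuous
    { toFun := fun G => ∫ ζ, τ ζ • weyl ζ G
      map_add' := fun F G => by
        simp only [map_add, smul_add]
        exact integral_add (integrable_smul_weyl hτ F) (integrable_smul_weyl hτ G)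
      map_smul' := fun c F => by
        simp only [map_smul, RingHom.id_apply, ← integral_smul, smul_comm c] }
    (∫ ζ, ‖τ ζ‖) fun G => ?_, fun F G => ?_⟩
  · refine (norm_integral_le_integral_norm _).trans (le_of_eq ?_)
    simp only [norm_smul, LinearIsometry.norm_map, integral_mul_const]
  · change inner ℂ F (∫ ζ, τ ζ • weyl ζ G) = _
    rw [← integral_inner (integrable_smul_weyl hτ G)]
    simp only [inner_smul_right]

/-- The Weyl transform of a tensor product. -/
theorem IsTensorOp.hasWeyl {κ : Type} [Fintype κ] [DecidableEq κ] {T : Op (ι ⊕ κ)} {A : Op ι}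
    {B : Op κ} (hT : IsTensorOp T A B) {τ : Phase ι → ℂ} {σ : Phase κ → ℂ} (hτ : Integrable τ)
    (hσ : Integrable σ) (hA : HasWeyl A τ) (hB : HasWeyl B σ) :
    HasWeyl T fun ζ => τ (phaseFst ζ) * σ (phaseSnd ζ) := by
  have hint : Integrable fun ζ : Phase (ι ⊕ κ) => τ (phaseFst ζ) * σ (phaseSnd ζ) :=
    (integrable_phase_iff fun p : Phase ι × Phase κ => τ p.1 * σ p.2).2 (hτ.mul_prod hσ)
  obtain ⟨T', hT'⟩ := exists_hasWeyl hint
  obtain ⟨g, hg⟩ := exists_toL2_ne_zero ι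
  obtain ⟨k, hk⟩ := exists_toL2_ne_zero κ
  have hgk : toL2 (tensorS g k) ≠ 0 := by
    rw [toL2_tensorS, ← norm_ne_zero_iff, norm_tensor]
    exact mul_ne_zero (norm_ne_zero_iff.2 hg) (norm_ne_zero_iff.2 hk)
  have h1 (ψ φ : L2 ι) (ψ' φ' : L2 κ) :
      inner ℂ (tensor ψ ψ') (T' (tensor φ φ')) = inner ℂ (tensor ψ ψ') (T (tensor φ φ')) := by
    rw [hT' _ _, hT, inner_tensor, hA, hB, ← integral_prod_mul, ← Measure.volume_eq_prod,
      ← integral_phase]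
    refine integral_congr_ae (.of_forall fun ζ => ?_)
    simp only [weyl_tensor, inner_tensor]
    ring
  -- By `h1` the operators agree between product vectors, and every Weyl translate of `g ⊗ k` is
  -- one. Such translates separate `L²`: this is used once here, and once more for the adjoint in
  -- `h3`.
  have h2 (v : Phase (ι ⊕ κ)) : (T - T') (weyl v (toL2 (tensorS g k))) = 0 := by
    refine eq_zero_of_inner_frame hgk fun w => ?_
    rw [toL2_tensorS, weyl_tensor, weyl_tensor, _root_.sub_apply, inner_sub_right, h1, sub_self]
  have h3 (F : L2 (ι ⊕ κ)) : star (T - T') F = 0 := by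
    refine eq_zero_of_inner_frame hgk fun w => ?_
    rw [unitary_inner_star, star_star, h2, inner_zero_left]
  have h4 : T = T' := by
    rw [← sub_eq_zero, ← star_eq_zero]
    exact ContinuousLinearMap.ext h3
  rwa [h4]

end Frame

/-! ### Rapid decay of `T (φ ⊗ W(v) g)` in `v` -/

section Decay

variable {ι κ : Type} [Fintype ι] [DecidableEq ι] [Fintype κ] [DecidableEq κ]

theorem fderiv_tensorS (φ : 𝓢(Config ι, ℂ)) (g : 𝓢(Config κ, ℂ)) (x : Config (ι ⊕ κ))
    (w : Config κ) :
    fderiv ℝ (tensorS φ g) x (join 0 w) = φ (fstL x) * fderiv ℝ g (sndL x) w := by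
  have h1 := (φ.hasFDerivAt (fstL x)).comp x fstL.hasFDerivAt
  have h2 := (g.hasFDerivAt (sndL x)).comp x sndL.hasFDerivAt
  have h3 : HasFDerivAt (tensorS φ g) _ x := h1.mul h2
  rw [h3.fderiv]
  simp

/-- Observables of the second subsystem act on the second factor. -/
theorem linOp_tensorS (φ : 𝓢(Config ι, ℂ)) (g : 𝓢(Config κ, ℂ)) (b : Phase κ) :
    linOp (phaseJoin 0 b) (tensorS φ g) = tensorS φ (linOp b g) := by
  ext x
  have e1 : fstL (phaseJoin (0 : Phase ι) b) = join 0 (fstL b) :=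
    ext_blocks (by rw [← fstL_phaseFst]; simp) (by rw [← fstL_phaseSnd]; simp)
  have e2 : sndL (phaseJoin (0 : Phase ι) b) = join 0 (sndL b) :=
    ext_blocks (by rw [← sndL_phaseFst]; simp) (by rw [← sndL_phaseSnd]; simp)
  rw [linOp_apply, e1, e2, fderiv_tensorS, inner_blocks]
  simp only [tensorS, externalProduct_apply, linOp_apply, fstL_join, sndL_join, inner_zero_left]
  push_cast
  ring

/-- `ζ ↦ σ(ζ, w)` as a continuous linear map. -/
def sympCLM (w : Phase ι) : Phase ι →L[ℝ] ℝ :=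
  LinearMap.toContinuousLinearMap
    { toFun := fun ζ => symp ζ w
      map_add' := fun ζ η => symp_add_left ζ η w
      map_smul' := fun c ζ => symp_smul_left c ζ w }

@[simp] theorem sympCLM_apply (w ζ : Phase ι) : sympCLM w ζ = symp ζ w := rfl

/-- Multiplication of a Schwartz function by `σ(·, w)`. -/
def sympMul (w : Phase ι) (τ : 𝓢(Phase ι, ℂ)) : 𝓢(Phase ι, ℂ) :=
  SchwartzMap.smulLeftCLM ℂ (fun ζ => ((symp ζ w : ℝ) : ℂ)) τ

@[simp] theorem sympMul_apply (w : Phase ι) (τ : 𝓢(Phase ι, ℂ)) (ζ : Phase ι) :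
    sympMul w τ ζ = (symp ζ w : ℝ) * τ ζ := by
  have h : Function.HasTemperateGrowth fun ζ : Phase ι => ((symp ζ w : ℝ) : ℂ) :=
    (Complex.ofRealCLM.comp (sympCLM w)).hasTemperateGrowth
  simp [sympMul, SchwartzMap.smulLeftCLM_apply_apply h]

/-- Matrix elements of `∫ τ(ζ) W(ζ) dζ` between `χ` and `Ψ`, both translated by `v`. -/
def oscInt (τ : 𝓢(Phase ι, ℂ)) (v : Phase ι) (χ Ψ : 𝓢(Config ι, ℂ)) : ℂ :=
  ∫ ζ, τ ζ * (Complex.exp ((-symp ζ v : ℝ) * Complex.I) * inner ℂ (toL2 χ) (weyl ζ (toL2 Ψ)))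

theorem integrable_oscInt (τ : 𝓢(Phase ι, ℂ)) (v : Phase ι) (χ Ψ : 𝓢(Config ι, ℂ)) :
    Integrable fun ζ => τ ζ * (Complex.exp ((-symp ζ v : ℝ) * Complex.I) *
      inner ℂ (toL2 χ) (weyl ζ (toL2 Ψ))) := by
  have h := integrable_mul_inner_weyl (τ.integrable (μ := volume)) (toL2 χ) (toL2 Ψ)
  have hc : Continuous fun ζ => τ ζ * (Complex.exp ((-symp ζ v : ℝ) * Complex.I) *
      inner ℂ (toL2 χ) (weyl ζ (toL2 Ψ))) := by
    have h1 := continuous_inner_weyl (toL2 χ) (toL2 Ψ)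
    have h2 := τ.continuous
    fun_prop
  refine h.mono hc.aestronglyMeasurable (.of_forall fun ζ => ?_)
  rw [norm_mul, norm_mul, norm_mul, Complex.norm_exp_ofReal_mul_I, one_mul]

theorem norm_oscInt_le (τ : 𝓢(Phase ι, ℂ)) (v : Phase ι) (χ Ψ : 𝓢(Config ι, ℂ)) :
    ‖oscInt τ v χ Ψ‖ ≤ (∫ ζ, ‖τ ζ‖) * (‖toL2 χ‖ * ‖toL2 Ψ‖) := by
  refine (norm_integral_le_integral_norm _).trans ?_
  rw [← integral_mul_const]
  refine integral_mono (integrable_oscInt τ v χ Ψ).norm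
    ((τ.integrable (μ := volume)).norm.mul_const _) fun ζ => ?_
  simp only [norm_mul, Complex.norm_exp_ofReal_mul_I, one_mul]
  exact mul_le_mul_of_nonneg_left (norm_inner_weyl_le _ _ _) (norm_nonneg _)

/-- Integration by parts in the direction `w`. -/
theorem symp_mul_oscInt (τ : 𝓢(Phase ι, ℂ)) (v w : Phase ι) (χ Ψ : 𝓢(Config ι, ℂ)) :
    (symp w v : ℝ) * oscInt τ v χ Ψ = oscInt τ v χ (linOp w Ψ) +
      1 / 2 * oscInt (sympMul w τ) v χ Ψ - Complex.I * oscInt (∂_{w} τ) v χ Ψ := by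
  set A : Phase ι → ℂ := fun ζ => inner ℂ (toL2 χ) (weyl ζ (toL2 Ψ)) with hA
  set e : Phase ι → ℂ := fun ζ => Complex.exp ((-symp ζ v : ℝ) * Complex.I) with he
  -- The derivative of `e A` along `w`. The exponential contributes the wanted factor `σ(w, v)`; the
  -- matrix element contributes the other two terms.
  set g' : Phase ι → ℂ := fun ζ => -Complex.I * (symp w v : ℝ) * (e ζ * A ζ) +
    (Complex.I * (e ζ * inner ℂ (toL2 χ) (weyl ζ (toL2 (linOp w Ψ)))) +
      Complex.I / 2 * ((symp ζ w : ℝ) * (e ζ * A ζ))) with hg'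
  have hd (ζ : Phase ι) : HasLineDerivAt ℝ (fun ζ => e ζ * A ζ) (g' ζ) ζ w := by
    obtain ⟨L, hL, hLw⟩ := hasFDerivAt_inner_weyl χ Ψ ζ
    have h1 : HasFDerivAt (fun ζ : Phase ι => -symp ζ v) (-sympCLM v) ζ :=
      (sympCLM v).hasFDerivAt.neg
    have h2 : HasFDerivAt e _ ζ :=
      ((Complex.ofRealCLM.hasFDerivAt.comp ζ h1).mul_const Complex.I).cexp
    have h3 := (h2.mul hL).hasLineDerivAt w
    have h4 : (fun ζ => e ζ * A ζ) = e * A := rfl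
    rw [h4]
    convert! h3 using 1
    simp [hLw, hg', he, hA]
    ring
  have i0 := integrable_oscInt τ v χ Ψ
  have i1 := integrable_oscInt τ v χ (linOp w Ψ)
  have i2 := integrable_oscInt (sympMul w τ) v χ Ψ
  have i3 := integrable_oscInt (∂_{w} τ) v χ Ψ
  have hsplit (ζ : Phase ι) : τ ζ * g' ζ = -Complex.I * (symp w v : ℝ) * (τ ζ * (e ζ * A ζ)) +
      (Complex.I * (τ ζ * (e ζ * inner ℂ (toL2 χ) (weyl ζ (toL2 (linOp w Ψ))))) +
      Complex.I / 2 * (sympMul w τ ζ * (e ζ * A ζ))) := by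
    rw [sympMul_apply, hg']; ring
  have j1 : Integrable fun ζ => -Complex.I * (symp w v : ℝ) * (τ ζ * (e ζ * A ζ)) :=
    i0.const_mul _
  have j2 : Integrable fun ζ =>
      Complex.I * (τ ζ * (e ζ * inner ℂ (toL2 χ) (weyl ζ (toL2 (linOp w Ψ))))) := i1.const_mul _
  have j3 : Integrable fun ζ => Complex.I / 2 * (sympMul w τ ζ * (e ζ * A ζ)) := i2.const_mul _
  have j4 : Integrable fun ζ =>
      Complex.I * (τ ζ * (e ζ * inner ℂ (toL2 χ) (weyl ζ (toL2 (linOp w Ψ))))) +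
        Complex.I / 2 * (sympMul w τ ζ * (e ζ * A ζ)) := j2.add j3
  have key := integral_bilinear_hasLineDerivAt_right_eq_neg_left_of_integrable (μ := volume)
    (f := τ) (f' := ⇑(∂_{w} τ : 𝓢(Phase ι, ℂ))) (g := fun ζ => e ζ * A ζ) (g' := g') (v := w)
    (B := ContinuousLinearMap.mul ℝ ℂ) i3
    (by simp only [ContinuousLinearMap.mul_apply', hsplit]; exact j1.add j4) i0
    (fun ζ _ => by
      rw [SchwartzMap.lineDerivOp_apply_eq_fderiv]
      exact (τ.hasFDerivAt ζ).hasLineDerivAt w)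
    (fun ζ _ => hd ζ)
  simp only [ContinuousLinearMap.mul_apply', hsplit] at key
  rw [integral_add j1 j4, integral_add j2 j3, integral_const_mul, integral_const_mul,
    integral_const_mul] at key
  change -Complex.I * (symp w v : ℝ) * oscInt τ v χ Ψ + (Complex.I * oscInt τ v χ (linOp w Ψ) +
    Complex.I / 2 * oscInt (sympMul w τ) v χ Ψ) = -oscInt (∂_{w} τ) v χ Ψ at key
  have hI := Complex.I_mul_I
  linear_combination Complex.I * key + ((symp w v : ℝ) * oscInt τ v χ Ψ -
    oscInt τ v χ (linOp w Ψ) - 1 / 2 * oscInt (sympMul w τ) v χ Ψ) * hI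

/-- Pairing with the coordinate vectors recovers every coordinate of `v` up to sign, so a power of
`‖v‖` can be traded for integrations by parts in the coordinate directions. -/
theorem norm_le_sum_symp (v : Phase κ) :
    ‖v‖ ≤ ∑ b, |symp (EuclideanSpace.single b (1 : ℝ)) v| := by
  have h1 (j : κ) : symp (EuclideanSpace.single (Sum.inl j) (1 : ℝ)) v = v (Sum.inr j) := by
    rw [symp_swap, symp_eq_inner, EuclideanSpace.inner_single_right]
    simp [toEuclideanLin_apply, sympJ, neg_mulVec, fromBlocks_mulVec]
  have h2 (j : κ) : symp (EuclideanSpace.single (Sum.inr j) (1 : ℝ)) v = -v (Sum.inl j) := by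
    rw [symp_swap, symp_eq_inner, EuclideanSpace.inner_single_right]
    simp [toEuclideanLin_apply, sympJ, neg_mulVec, fromBlocks_mulVec]
  have h3 : v = ∑ b, v b • EuclideanSpace.single b (1 : ℝ) := by
    ext i
    rcases i with i | i <;> simp [Finset.sum_apply, Pi.single_apply]
  calc ‖v‖ = ‖∑ b, v b • EuclideanSpace.single b (1 : ℝ)‖ := by rw [← h3]
    _ ≤ ∑ b, |v b| := (norm_sum_le _ _).trans (by simp [norm_smul])
    _ = _ := by
      rw [Fintype.sum_sum_type, Fintype.sum_sum_type, add_comm]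
      simp only [h1, h2, abs_neg]

/-- Each power of `1 + ‖v‖` costs one integration by parts per coordinate direction of the
environment, which replaces `τ` or `g` by another Schwartz function; the induction therefore
quantifies over all `τ` and `g`. These directions do not touch the first factor, so `φ` and `χ`
enter only through their `L²` norms. This uniformity later yields a bound in operator terms. -/
theorem exists_oscInt_decay (k : ℕ) : ∀ (τ : 𝓢(Phase (ι ⊕ κ), ℂ)) (g : 𝓢(Config κ, ℂ)),
    ∃ C : ℝ, ∀ (φ : 𝓢(Config ι, ℂ)) (χ : 𝓢(Config (ι ⊕ κ), ℂ)) (v : Phase κ),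
      (1 + ‖v‖) ^ k * ‖oscInt τ (phaseJoin 0 v) χ (tensorS φ g)‖ ≤
        C * (‖toL2 χ‖ * ‖toL2 φ‖) := by
  induction k with
  | zero =>
    intro τ g
    refine ⟨(∫ ζ, ‖τ ζ‖) * ‖toL2 g‖, fun φ χ v => ?_⟩
    rw [pow_zero, one_mul]
    refine (norm_oscInt_le _ _ _ _).trans (le_of_eq ?_)
    rw [toL2_tensorS, norm_tensor]
    ring
  | succ k ih =>
    choose C hC using ih
    intro τ g
    let w (b : κ ⊕ κ) : Phase (ι ⊕ κ) := phaseJoin 0 (EuclideanSpace.single b (1 : ℝ))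
    refine ⟨C τ g + ∑ b, (C τ (linOp (EuclideanSpace.single b (1 : ℝ)) g) +
      1 / 2 * C (sympMul (w b) τ) g + C (∂_{w b} τ) g), fun φ χ v => ?_⟩
    set I0 := oscInt τ (phaseJoin 0 v) χ (tensorS φ g)
    set N := ‖toL2 χ‖ * ‖toL2 φ‖
    have hb (b : κ ⊕ κ) : (1 + ‖v‖) ^ k * (|symp (EuclideanSpace.single b (1 : ℝ)) v| * ‖I0‖) ≤
        (C τ (linOp (EuclideanSpace.single b (1 : ℝ)) g) +
          1 / 2 * C (sympMul (w b) τ) g + C (∂_{w b} τ) g) * N := by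
      have h1 := symp_mul_oscInt τ (phaseJoin 0 v) (w b) χ (tensorS φ g)
      have h2 : symp (w b) (phaseJoin 0 v) = symp (EuclideanSpace.single b (1 : ℝ)) v := by
        rw [symp_phase]; simp [w, symp]
      rw [h2, linOp_tensorS] at h1
      have h3 := congrArg norm h1
      rw [norm_mul, Complex.norm_real, Real.norm_eq_abs] at h3
      rw [h3]
      have h4 : ‖oscInt τ (phaseJoin 0 v) χ (tensorS φ (linOp (EuclideanSpace.single b 1) g)) +
          1 / 2 * oscInt (sympMul (w b) τ) (phaseJoin 0 v) χ (tensorS φ g) -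
          Complex.I * oscInt (∂_{w b} τ) (phaseJoin 0 v) χ (tensorS φ g)‖ ≤
          ‖oscInt τ (phaseJoin 0 v) χ (tensorS φ (linOp (EuclideanSpace.single b 1) g))‖ +
          1 / 2 * ‖oscInt (sympMul (w b) τ) (phaseJoin 0 v) χ (tensorS φ g)‖ +
          ‖oscInt (∂_{w b} τ) (phaseJoin 0 v) χ (tensorS φ g)‖ := by
        refine (norm_sub_le _ _).trans (add_le_add ((norm_add_le _ _).trans ?_) ?_)
        · rw [norm_mul]; norm_num
        · rw [norm_mul, Complex.norm_I, one_mul]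
      refine (mul_le_mul_of_nonneg_left h4 (by positivity)).trans ?_
      have := hC τ (linOp (EuclideanSpace.single b 1) g) φ χ v
      have := hC (sympMul (w b) τ) g φ χ v
      have := hC (∂_{w b} τ) g φ χ v
      linarith
    have h0 := hC τ g φ χ v
    calc (1 + ‖v‖) ^ (k + 1) * ‖I0‖ = (1 + ‖v‖) ^ k * ‖I0‖ + (1 + ‖v‖) ^ k * (‖v‖ * ‖I0‖) := by
          ring
      _ ≤ (1 + ‖v‖) ^ k * ‖I0‖ +
          (1 + ‖v‖) ^ k * ((∑ b, |symp (EuclideanSpace.single b (1 : ℝ)) v|) * ‖I0‖) := by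
          gcongr; exact norm_le_sum_symp v
      _ = (1 + ‖v‖) ^ k * ‖I0‖ +
          ∑ b, (1 + ‖v‖) ^ k * (|symp (EuclideanSpace.single b (1 : ℝ)) v| * ‖I0‖) := by
          rw [Finset.sum_mul, Finset.mul_sum]
      _ ≤ _ := by
          rw [add_mul, Finset.sum_mul]
          exact add_le_add h0 (Finset.sum_le_sum fun b _ => hb b)

theorem norm_le_of_forall_toL2 {X : L2 ι} {M : ℝ}
    (h : ∀ χ : 𝓢(Config ι, ℂ), ‖inner ℂ (toL2 χ) X‖ ≤ M * ‖toL2 χ‖) : ‖X‖ ≤ M := by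
  have h1 : ∀ F : L2 ι, ‖inner ℂ F X‖ ≤ M * ‖F‖ := fun F =>
    denseRange_toL2.induction_on (p := fun F => ‖inner ℂ F X‖ ≤ M * ‖F‖) F
      (isClosed_le (by fun_prop) (by fun_prop)) h
  by_cases hX : X = 0
  · subst hX
    -- For `X = 0` the claim is `0 ≤ M`, which needs a test function of nonzero norm.
    obtain ⟨g, hg⟩ := exists_toL2_ne_zero ι
    have h2 := h g
    rw [inner_zero_right, norm_zero] at h2
    rw [norm_zero]
    exact nonneg_of_mul_nonneg_left h2 (norm_pos_iff.2 hg)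
  · have h2 := h1 X
    rw [inner_self_eq_norm_sq_to_K, norm_pow, RCLike.norm_ofReal, abs_norm] at h2
    exact le_of_mul_le_mul_right (by linarith) (norm_pos_iff.2 hX)

theorem phaseJoin_zero_weyl (v : Phase κ) (φ : L2 ι) (g : L2 κ) :
    weyl (phaseJoin 0 v) (tensor φ g) = tensor φ (weyl v g) := by
  rw [weyl_tensor, phaseFst_join, phaseSnd_join, weyl_zero]

/-- Applying `W(0, -v)` does not change the norm and, after commuting past `W(ζ)`, leaves only the
character `exp(-i σ(ζ, (0, v)))` under the integral. The oscillatory estimate is uniform in the test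
vector, so it bounds the norm. -/
theorem exists_norm_apply_tensor_le {T : Op (ι ⊕ κ)} {τ : 𝓢(Phase (ι ⊕ κ), ℂ)}
    (hT : HasWeyl T τ) (g : 𝓢(Config κ, ℂ)) (k : ℕ) :
    ∃ C : ℝ, ∀ (φ : L2 ι) (v : Phase κ),
      (1 + ‖v‖) ^ k * ‖T (tensor φ (weyl v (toL2 g)))‖ ≤ C * ‖φ‖ := by
  obtain ⟨C, hC⟩ := exists_oscInt_decay (ι := ι) k τ g
  refine ⟨C, fun φ v => ?_⟩
  refine denseRange_toL2.induction_on (p := fun φ : L2 ι =>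
    (1 + ‖v‖) ^ k * ‖T (tensor φ (weyl v (toL2 g)))‖ ≤ C * ‖φ‖) φ ?_ fun φ => ?_
  · have := continuous_tensor_left (ι := ι) (weyl v (toL2 g))
    exact isClosed_le (by fun_prop) (by fun_prop)
  set X := T (tensor (toL2 φ) (weyl v (toL2 g)))
  set V : Phase (ι ⊕ κ) := phaseJoin 0 v
  have hp : 0 < (1 + ‖v‖) ^ k := by positivity
  rw [mul_comm, ← le_div_iff₀ hp, ← (weyl (-V)).norm_map]
  refine norm_le_of_forall_toL2 fun χ => ?_
  have h1 : inner ℂ (toL2 χ) (weyl (-V) X) = oscInt τ V χ (tensorS φ g) := by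
    rw [← inner_weyl_left, hT]
    refine integral_congr_ae (.of_forall fun ζ => ?_)
    simp only
    rw [← phaseJoin_zero_weyl, weyl_comm ζ, inner_smul_right, (weyl V).inner_map_map,
      ← toL2_tensorS]
  rw [h1, div_mul_eq_mul_div, le_div_iff₀ hp, mul_comm ‖_‖, mul_assoc, mul_comm ‖toL2 φ‖]
  exact hC φ χ v

end Decay

/-! ### Partial traces -/

section Trace

/-- Orthonormal vectors are `√2` apart, so balls of radius `1/2` around them are disjoint.
Countability is what dominated convergence for series asks for. -/
theorem HilbertBasis.countable_index {β E : Type*} [NormedAddCommGroup E] [InnerProductSpace ℂ E]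
    [TopologicalSpace.SeparableSpace E] (e : HilbertBasis β ℂ E) : Countable β := by
  refine Pairwise.countable_of_isOpen_disjoint (s := fun i => Metric.ball (e i) (1 / 2))
    (fun i j hij => ?_) (fun _ => Metric.isOpen_ball) fun i => ⟨e i, by simp⟩
  refine Metric.ball_disjoint_ball ?_
  have h1 : ‖e i - e j‖ ^ 2 = 2 := by
    rw [@norm_sub_sq ℂ, e.orthonormal.1 i, e.orthonormal.1 j, e.orthonormal.2 hij]
    norm_num
  rw [dist_eq_norm]
  nlinarith [norm_nonneg (e i - e j)]

theorem HilbertBasis.hasSum_norm_inner_sq {β E : Type*} [NormedAddCommGroup E]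
    [InnerProductSpace ℂ E] (e : HilbertBasis β ℂ E) (x : E) :
    HasSum (fun k => ‖inner ℂ (e k) x‖ ^ 2) (‖x‖ ^ 2) := by
  have h := e.hasSum_inner_mul_inner x x
  have h1 (k : β) : inner ℂ x (e k) * inner ℂ (e k) x = ((‖inner ℂ (e k) x‖ ^ 2 : ℝ) : ℂ) := by
    rw [← inner_conj_symm, ← Complex.normSq_eq_conj_mul_self, Complex.normSq_eq_norm_sq]
  simp only [h1, inner_self_eq_norm_sq_to_K] at h
  have h2 := Complex.hasSum_re h
  simpa [← Complex.ofReal_pow] using h2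

variable {ι κ : Type} [Fintype ι] [DecidableEq ι] [Fintype κ] [DecidableEq κ]

/-- The trace of an operator which decays on coherent states. -/
theorem hasSum_inner_of_decay (B : Op κ) (g : 𝓢(Config κ, ℂ)) {C : ℝ} {m : Phase κ → ℝ}
    (hm : Continuous m) (hm0 : ∀ v, 0 < m v) (hmi : Integrable m)
    (hB : ∀ v, ‖B (weyl v (toL2 g))‖ ≤ C * m v) {β : Type} (e : HilbertBasis β ℂ (L2 κ)) :
    HasSum (fun k => ((2 * Real.pi) ^ Fintype.card κ * ‖toL2 g‖ ^ 2 : ℝ) * inner ℂ (e k) (B (e k)))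
      (∫ v, inner ℂ (weyl v (toL2 g)) (B (weyl v (toL2 g)))) := by
  have : Fact ((2 : ENNReal) ≠ ⊤) := ⟨ENNReal.ofNat_ne_top⟩
  have : Countable β := HilbertBasis.countable_index e
  have hw := continuous_weyl (toL2 g)
  -- The resolution of the identity, applied to `B* e_k` and `e_k`.
  have h1 (k : β) : ((2 * Real.pi) ^ Fintype.card κ * ‖toL2 g‖ ^ 2 : ℝ) * inner ℂ (e k) (B (e k)) =
      ∫ v, inner ℂ (e k) (B (weyl v (toL2 g))) * inner ℂ (weyl v (toL2 g)) (e k) := by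
    simp only [unitary_inner_star B]
    rw [integral_frame]
  simp only [h1]
  -- The dominating series comes from `a b ≤ (a² / m + m b²) / 2`. Parseval sums it over the basis,
  -- and the weight `m` balances the decay of `B W(v) g` against the constant norm of `W(v) g`: both
  -- parts of the sum are at most a constant times `m`.
  have hs (v : Phase κ) : HasSum (fun k => 1 / 2 * (‖inner ℂ (e k) (B (weyl v (toL2 g)))‖ ^ 2 / m v +
      m v * ‖inner ℂ (e k) (weyl v (toL2 g))‖ ^ 2))
      (1 / 2 * (‖B (weyl v (toL2 g))‖ ^ 2 / m v + m v * ‖toL2 g‖ ^ 2)) := by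
    have a1 := (HilbertBasis.hasSum_norm_inner_sq e (B (weyl v (toL2 g)))).div_const (m v)
    have a2 := (HilbertBasis.hasSum_norm_inner_sq e (weyl v (toL2 g))).mul_left (m v)
    rw [LinearIsometry.norm_map] at a2
    exact (a1.add a2).mul_left _
  refine hasSum_integral_of_dominated_convergence
    (fun k v => 1 / 2 * (‖inner ℂ (e k) (B (weyl v (toL2 g)))‖ ^ 2 / m v +
      m v * ‖inner ℂ (e k) (weyl v (toL2 g))‖ ^ 2)) (fun k => ?_)
    (fun k => .of_forall fun v => ?_) (.of_forall fun v => (hs v).summable) ?_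
    (.of_forall fun v => ?_)
  · exact Continuous.aestronglyMeasurable (by fun_prop)
  · rw [norm_mul, norm_inner_symm (weyl v (toL2 g))]
    set a := ‖inner ℂ (e k) (B (weyl v (toL2 g)))‖
    set b := ‖inner ℂ (e k) (weyl v (toL2 g))‖
    have hv := hm0 v
    have h2 : a ^ 2 / m v + m v * b ^ 2 - 2 * (a * b) = (a - m v * b) ^ 2 / m v := by
      field_simp
      ring
    have h3 : 0 ≤ (a - m v * b) ^ 2 / m v := by positivity
    linarith
  · simp only [(hs _).tsum_eq]
    refine (hmi.const_mul (1 / 2 * (C ^ 2 + ‖toL2 g‖ ^ 2))).mono'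
      (Continuous.aestronglyMeasurable ?_) (.of_forall fun v => ?_)
    · have : ∀ v, m v ≠ 0 := fun v => (hm0 v).ne'
      fun_prop (disch := assumption)
    · have hv := hm0 v
      have h4 : ‖B (weyl v (toL2 g))‖ ^ 2 / m v ≤ C ^ 2 * m v := by
        rw [div_le_iff₀ hv]
        calc _ ≤ (C * m v) ^ 2 := pow_le_pow_left₀ (norm_nonneg _) (hB v) 2
          _ = _ := by ring
      rw [Real.norm_of_nonneg (by positivity)]
      nlinarith
  · have := e.hasSum_inner_mul_inner (weyl v (toL2 g)) (B (weyl v (toL2 g)))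
    exact this.congr_fun fun k => mul_comm _ _

theorem exists_schwartz_decay {E : Type*} [NormedAddCommGroup E] [NormedSpace ℝ E]
    (τ : 𝓢(E, ℂ)) (k : ℕ) : ∃ C, ∀ x, ‖τ x‖ ≤ C * (1 + ‖x‖) ^ (-(k : ℝ)) := by
  refine ⟨2 ^ k * (Finset.Iic (k, 0)).sup (fun m => SchwartzMap.seminorm ℝ m.1 m.2) τ,
    fun x => ?_⟩
  have h := SchwartzMap.one_add_le_sup_seminorm_apply (𝕜 := ℝ) (m := (k, 0)) le_rfl le_rfl τ x
  rw [norm_iteratedFDeriv_zero] at h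
  rw [Real.rpow_neg (by positivity), Real.rpow_natCast, ← div_eq_mul_inv,
    le_div_iff₀ (by positivity), mul_comm]
  exact h

/-- The exponent exceeds the phase space dimension `2N` by one. -/
theorem integrable_bracket (κ : Type) [Fintype κ] :
    Integrable fun v : Phase κ => (1 + ‖v‖) ^ (-((2 * Fintype.card κ + 1 : ℕ) : ℝ)) := by
  refine integrable_one_add_norm ?_
  rw [finrank_euclideanSpace, Fintype.card_sum]
  norm_cast
  omega

theorem continuous_bracket (E : Type*) [NormedAddCommGroup E] (r : ℝ) :
    Continuous fun v : E => (1 + ‖v‖) ^ r :=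
  Continuous.rpow_const (by fun_prop) fun v => Or.inl (by positivity)

open FourierTransform in
/-- Fourier inversion at the origin with respect to the symplectic form. -/
theorem integral_symplectic_fourier {b f : Phase κ → ℂ} (hb : Continuous b) (hbi : Integrable b)
    (hfi : Integrable f)
    (hf : ∀ v, f v = ∫ u, b u * Complex.exp ((-symp u v : ℝ) * Complex.I)) :
    ∫ v, f v = ((2 * Real.pi) ^ (2 * Fintype.card κ) : ℝ) * b 0 := by
  have hJ := sympJ_mul_self κ
  have hdJ : |(sympJ κ).det| = 1 := abs_det_of_symplectic hJ (by
    rw [sympJ_transpose, Matrix.neg_mul, hJ]; simp)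
  have hJ0 : (sympJ κ).det ≠ 0 := by intro h; rw [h] at hdJ; simp at hdJ
  have hpi : (2 * Real.pi) ≠ 0 := by positivity
  -- The substitution `v = -2π J w` turns the symplectic character into the Euclidean one; its
  -- Jacobian is the constant of the statement.
  have h1 (w : Phase κ) : 𝓕 b w = f (toEuclideanLin (-(2 * Real.pi) • sympJ κ) w) := by
    rw [hf, Real.fourier_eq']
    refine integral_congr_ae (.of_forall fun u => ?_)
    have : symp u (toEuclideanLin (-(2 * Real.pi) • sympJ κ) w) = 2 * Real.pi * inner ℝ u w := by
      rw [symp_eq_inner, inner_toEuclideanLin, ← toEuclideanLin_mul, transpose_smul,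
        sympJ_transpose, Matrix.smul_mul, neg_mul_neg, hJ, smul_neg, neg_smul, neg_neg, map_smul,
        LinearMap.smul_apply, toEuclideanLin_one, real_inner_smul_left]
    simp only [this, smul_eq_mul]
    rw [mul_comm]
    congr 3
    push_cast
    ring
  have hdet : |(-(2 * Real.pi) • sympJ κ).det| = (2 * Real.pi) ^ (2 * Fintype.card κ) := by
    rw [det_smul, abs_mul, hdJ, mul_one, abs_pow, abs_neg, abs_of_pos (by positivity),
      Fintype.card_sum, ← two_mul (Fintype.card κ)]
  have hdet0 : (-(2 * Real.pi) • sympJ κ).det ≠ 0 := by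
    rw [← abs_ne_zero, hdet]; positivity
  have hFi : Integrable (𝓕 b) := by
    have := integrable_comp_toEuclideanLin hdet0 hfi
    exact this.congr (.of_forall fun w => (h1 w).symm)
  have h2 := hbi.fourierInv_fourier_eq hFi (v := 0) hb.continuousAt
  rw [Real.fourierInv_eq'] at h2
  simp only [inner_zero_right, mul_zero, Complex.ofReal_zero, zero_mul, Complex.exp_zero,
    one_smul] at h2
  have h3 := integral_comp_toEuclideanLin hdet0 f
  simp only [← h1] at h3
  rw [h2, hdet] at h3
  rw [h3, Complex.real_smul, ← mul_assoc, ← Complex.ofReal_mul, mul_inv_cancel₀ (by positivity),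
    Complex.ofReal_one, one_mul]

/-- The partial matrix element of a Weyl operator in the first factor. -/
def weylSlice (τ : 𝓢(Phase (ι ⊕ κ), ℂ)) (ψ φ : L2 ι) (u : Phase κ) : ℂ :=
  ∫ z, τ (phaseJoin z u) * inner ℂ ψ (weyl z φ)

theorem continuous_slice_integrand (τ : 𝓢(Phase (ι ⊕ κ), ℂ)) (ψ φ : L2 ι) :
    Continuous fun p : Phase ι × Phase κ => τ (phaseJoin p.1 p.2) * inner ℂ ψ (weyl p.1 φ) := by
  have h1 := τ.continuous
  have h2 : Continuous fun p : Phase ι × Phase κ => inner ℂ ψ (weyl p.1 φ) :=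
    (continuous_inner_weyl ψ φ).comp continuous_fst
  exact Continuous.mul (by fun_prop) h2

theorem integrable_slice_integrand (τ : 𝓢(Phase (ι ⊕ κ), ℂ)) (ψ φ : L2 ι) :
    Integrable fun p : Phase ι × Phase κ =>
      τ (phaseJoin p.1 p.2) * inner ℂ ψ (weyl p.1 φ) := by
  have hτi : Integrable fun p : Phase ι × Phase κ => τ (phaseJoin p.1 p.2) := by
    rw [← integrable_phase_iff]
    simpa using τ.integrable (μ := volume)
  refine (hτi.norm.mul_const (‖ψ‖ * ‖φ‖)).mono'
    (continuous_slice_integrand τ ψ φ).aestronglyMeasurable (.of_forall fun p => ?_)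
  rw [norm_mul]
  exact mul_le_mul_of_nonneg_left (norm_inner_weyl_le _ _ _) (norm_nonneg _)

theorem norm_slice_integrand_le (τ : 𝓢(Phase (ι ⊕ κ), ℂ)) (ψ φ : L2 ι) (k : ℕ) :
    ∃ D, ∀ (z : Phase ι) (u : Phase κ), ‖τ (phaseJoin z u) * inner ℂ ψ (weyl z φ)‖ ≤
      D * (1 + ‖z‖) ^ (-(k : ℝ)) := by
  obtain ⟨D, hD⟩ := exists_schwartz_decay τ k
  have hD0 : 0 ≤ D := by
    have := (norm_nonneg _).trans (hD 0)
    rwa [norm_zero, add_zero, Real.one_rpow, mul_one] at this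
  refine ⟨D * (‖ψ‖ * ‖φ‖), fun z u => ?_⟩
  rw [norm_mul, mul_right_comm]
  refine mul_le_mul ((hD _).trans ?_) (norm_inner_weyl_le _ _ _) (norm_nonneg _) (by positivity)
  refine mul_le_mul_of_nonneg_left ?_ hD0
  refine Real.rpow_le_rpow_of_nonpos (by positivity) ?_ (neg_nonpos.2 (Nat.cast_nonneg _))
  have := norm_phaseFst_le (phaseJoin z u)
  rw [phaseFst_join] at this
  linarith

theorem continuous_weylSlice (τ : 𝓢(Phase (ι ⊕ κ), ℂ)) (ψ φ : L2 ι) :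
    Continuous (weylSlice τ ψ φ) := by
  have hbr := integrable_bracket ι
  obtain ⟨D, hD⟩ := norm_slice_integrand_le τ ψ φ (2 * Fintype.card ι + 1)
  have hc := continuous_slice_integrand τ ψ φ
  unfold weylSlice
  refine continuous_of_dominated (fun u => ?_) (fun u => .of_forall fun z => hD z u)
    (hbr.const_mul D) (.of_forall fun z => ?_)
  · have h1 : Continuous fun z : Phase ι => (z, u) := by fun_prop
    exact (hc.comp h1).aestronglyMeasurable
  · have h1 : Continuous fun u : Phase κ => (z, u) := by fun_prop
    have h2 := hc.comp h1
    simp only [Function.comp_def] at h2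
    exact h2

theorem integrable_weylSlice (τ : 𝓢(Phase (ι ⊕ κ), ℂ)) (ψ φ : L2 ι) :
    Integrable (weylSlice τ ψ φ) :=
  (integrable_slice_integrand τ ψ φ).integral_prod_right

/-- The matrix elements of a Weyl operator between coherent states of the second factor. -/
theorem HasWeyl.inner_tensor_weyl {T : Op (ι ⊕ κ)} {τ : 𝓢(Phase (ι ⊕ κ), ℂ)} (hT : HasWeyl T τ)
    (ψ φ : L2 ι) (g : L2 κ) (v : Phase κ) :
    inner ℂ (tensor ψ (weyl v g)) (T (tensor φ (weyl v g))) =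
      ∫ u, weylSlice τ ψ φ u * inner ℂ g (weyl u g) *
        Complex.exp ((-symp u v : ℝ) * Complex.I) := by
  have e1 : inner ℂ (tensor ψ (weyl v g)) (T (tensor φ (weyl v g))) =
      ∫ ζ : Phase (ι ⊕ κ), (fun p : Phase ι × Phase κ =>
        (τ (phaseJoin p.1 p.2) * inner ℂ ψ (weyl p.1 φ)) * (inner ℂ g (weyl p.2 g) *
          Complex.exp ((-symp p.2 v : ℝ) * Complex.I))) (phaseFst ζ, phaseSnd ζ) := by
    rw [hT]
    refine integral_congr_ae (.of_forall fun ζ => ?_)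
    simp only [phaseJoin_fst_snd]
    -- Commuting `W(v)` to the left cancels it against the bra; only the character `exp(-i σ(u, v))`
    -- remembers `v`.
    rw [weyl_tensor, inner_tensor, weyl_comm (phaseSnd ζ) v, inner_smul_right,
      (weyl v).inner_map_map]
    ring
  rw [e1, integral_phase fun p : Phase ι × Phase κ =>
    (τ (phaseJoin p.1 p.2) * inner ℂ ψ (weyl p.1 φ)) * (inner ℂ g (weyl p.2 g) *
      Complex.exp ((-symp p.2 v : ℝ) * Complex.I)), Measure.volume_eq_prod, integral_prod_symm]
  · refine integral_congr_ae (.of_forall fun u => ?_)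
    simp only [weylSlice]
    rw [integral_mul_const, mul_assoc]
  · have hgc : Continuous fun p : Phase ι × Phase κ => inner ℂ g (weyl p.2 g) :=
      (continuous_inner_weyl g g).comp continuous_snd
    have hec : Continuous fun p : Phase ι × Phase κ =>
        Complex.exp ((-symp p.2 v : ℝ) * Complex.I) := by fun_prop
    have hc := continuous_slice_integrand τ ψ φ
    refine ((integrable_slice_integrand τ ψ φ).norm.mul_const (‖g‖ * ‖g‖)).mono'
      ((hc.mul (hgc.mul hec)).aestronglyMeasurable)
      (.of_forall fun p => ?_)
    rw [norm_mul, norm_mul (inner ℂ g (weyl p.2 g)), Complex.norm_exp_ofReal_mul_I, mul_one]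
    exact mul_le_mul_of_nonneg_left (norm_inner_weyl_le _ _ _) (norm_nonneg _)

/-- The matrix of an operator in the second factor. -/
def sndMatrixOp (T : Op (ι ⊕ κ)) (ψ φ : L2 ι) : Op κ :=
  (ContinuousLinearMap.adjoint (tensorCLM ψ)).comp (T.comp (tensorCLM φ))

theorem inner_sndMatrixOp (T : Op (ι ⊕ κ)) (ψ φ : L2 ι) (x y : L2 κ) :
    inner ℂ x (sndMatrixOp T ψ φ y) = inner ℂ (tensor ψ x) (T (tensor φ y)) := by
  rw [sndMatrixOp, ContinuousLinearMap.comp_apply, ContinuousLinearMap.adjoint_inner_right]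
  rfl

theorem norm_sndMatrixOp_le (T : Op (ι ⊕ κ)) (ψ φ : L2 ι) (y : L2 κ) :
    ‖sndMatrixOp T ψ φ y‖ ≤ ‖ψ‖ * ‖T (tensor φ y)‖ := by
  have h := norm_inner_le_norm (𝕜 := ℂ) (tensor ψ (sndMatrixOp T ψ φ y)) (T (tensor φ y))
  rw [← inner_sndMatrixOp, norm_tensor, inner_self_eq_norm_sq_to_K] at h
  norm_cast at h
  rw [abs_of_nonneg (by positivity)] at h
  rcases (norm_nonneg (sndMatrixOp T ψ φ y)).eq_or_lt with h0 | h0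
  · rw [← h0]; positivity
  · nlinarith

/-- The partial trace of a Weyl operator with Schwartz symbol. -/
theorem HasWeyl.isPartialTrace {T : Op (ι ⊕ κ)} {τ : 𝓢(Phase (ι ⊕ κ), ℂ)} (hT : HasWeyl T τ)
    {R : Op ι}
    (hR : HasWeyl R fun z => ((2 * Real.pi) ^ Fintype.card κ : ℝ) * τ (phaseJoin z 0)) :
    IsPartialTrace T R := by
  intro β e ψ φ
  obtain ⟨g, hg⟩ := exists_toL2_ne_zero κ
  obtain ⟨C, hC⟩ := exists_norm_apply_tensor_le hT g (2 * Fintype.card κ + 1)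
  have hB (v : Phase κ) : ‖sndMatrixOp T ψ φ (weyl v (toL2 g))‖ ≤
      ‖ψ‖ * (C * ‖φ‖) * (1 + ‖v‖) ^ (-((2 * Fintype.card κ + 1 : ℕ) : ℝ)) := by
    refine (norm_sndMatrixOp_le _ _ _ _).trans ?_
    rw [mul_assoc]
    refine mul_le_mul_of_nonneg_left ?_ (norm_nonneg _)
    rw [Real.rpow_neg (by positivity), Real.rpow_natCast, ← div_eq_mul_inv,
      le_div_iff₀ (by positivity), mul_comm]
    exact hC φ v
  have hsum := hasSum_inner_of_decay (sndMatrixOp T ψ φ) g (continuous_bracket (Phase κ) _)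
    (fun v => by positivity) (integrable_bracket κ) hB e
  have hgc := continuous_inner_weyl (toL2 g) (toL2 g)
  have hbc : Continuous fun u => weylSlice τ ψ φ u * inner ℂ (toL2 g) (weyl u (toL2 g)) :=
    (continuous_weylSlice τ ψ φ).mul hgc
  have hbi : Integrable fun u => weylSlice τ ψ φ u * inner ℂ (toL2 g) (weyl u (toL2 g)) := by
    refine ((integrable_weylSlice τ ψ φ).norm.mul_const (‖toL2 g‖ * ‖toL2 g‖)).mono'
      hbc.aestronglyMeasurable (.of_forall fun u => ?_)
    rw [norm_mul]
    exact mul_le_mul_of_nonneg_left (norm_inner_weyl_le _ _ _) (norm_nonneg _)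
  have hfi : Integrable fun v =>
      inner ℂ (weyl v (toL2 g)) (sndMatrixOp T ψ φ (weyl v (toL2 g))) := by
    refine (((integrable_bracket κ).const_mul (‖ψ‖ * (C * ‖φ‖))).const_mul ‖toL2 g‖).mono' ?_
      (.of_forall fun v => ?_)
    · have := continuous_weyl (toL2 g)
      exact Continuous.aestronglyMeasurable (by fun_prop)
    · refine (norm_inner_le_norm _ _).trans ?_
      rw [LinearIsometry.norm_map]
      exact mul_le_mul_of_nonneg_left (hB v) (norm_nonneg _)
  -- The inversion gives `(2π)²ᴺ ‖g‖²` times the slice at `u = 0`. Dividing by the frame constant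
  -- `(2π)ᴺ ‖g‖²` removes the window and leaves `(2π)ᴺ`.
  have hval := integral_symplectic_fourier hbc hbi hfi fun v => by
    rw [inner_sndMatrixOp, hT.inner_tensor_weyl]
  rw [hval] at hsum
  have hg0 : ‖toL2 g‖ ≠ 0 := norm_ne_zero_iff.2 hg
  have hc : (((2 * Real.pi) ^ Fintype.card κ * ‖toL2 g‖ ^ 2 : ℝ) : ℂ) ≠ 0 :=
    Complex.ofReal_ne_zero.2 (by positivity)
  have hsum2 := hsum.mul_left ((((2 * Real.pi) ^ Fintype.card κ * ‖toL2 g‖ ^ 2 : ℝ) : ℂ)⁻¹)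
  simp only [inv_mul_cancel_left₀ hc, inner_sndMatrixOp] at hsum2
  convert! hsum2 using 1
  rw [hR, eq_inv_mul_iff_mul_eq₀ hc, weyl_zero, inner_self_eq_norm_sq_to_K]
  simp only [weylSlice, mul_assoc, integral_const_mul]
  simp only [RCLike.ofReal_eq_complex_ofReal]
  push_cast
  ring

end Trace

/-! ### Weyl symbols and their Fourier transforms -/

section Symbol

variable {ι : Type} [Fintype ι] [DecidableEq ι]

theorem integrable_config_bracket (α : Type) [Fintype α] :
    Integrable fun v : Config α => (1 + ‖v‖) ^ (-((Fintype.card α + 1 : ℕ) : ℝ)) := by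
  refine integrable_one_add_norm ?_
  rw [finrank_euclideanSpace]
  norm_cast
  omega

theorem exists_decay_fst (a : 𝓢(Phase ι, ℂ)) :
    ∃ C, ∀ x ξ, ‖a (join x ξ)‖ ≤ C * (1 + ‖x‖) ^ (-((Fintype.card ι + 1 : ℕ) : ℝ)) := by
  obtain ⟨C, hC⟩ := exists_schwartz_decay a (Fintype.card ι + 1)
  have hC0 : 0 ≤ C := by
    have := (norm_nonneg _).trans (hC 0)
    rwa [norm_zero, add_zero, Real.one_rpow, mul_one] at this
  refine ⟨C, fun x ξ => (hC _).trans (mul_le_mul_of_nonneg_left ?_ hC0)⟩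
  refine Real.rpow_le_rpow_of_nonpos (by positivity) ?_ (neg_nonpos.2 (Nat.cast_nonneg _))
  have := norm_fstL_le (join x ξ)
  rw [fstL_join] at this
  linarith

theorem exists_decay_snd (a : 𝓢(Phase ι, ℂ)) :
    ∃ C, ∀ x ξ, ‖a (join x ξ)‖ ≤ C * (1 + ‖ξ‖) ^ (-((Fintype.card ι + 1 : ℕ) : ℝ)) := by
  obtain ⟨C, hC⟩ := exists_schwartz_decay a (Fintype.card ι + 1)
  have hC0 : 0 ≤ C := by
    have := (norm_nonneg _).trans (hC 0)
    rwa [norm_zero, add_zero, Real.one_rpow, mul_one] at this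
  refine ⟨C, fun x ξ => (hC _).trans (mul_le_mul_of_nonneg_left ?_ hC0)⟩
  refine Real.rpow_le_rpow_of_nonpos (by positivity) ?_ (neg_nonpos.2 (Nat.cast_nonneg _))
  have := norm_sndL_le (join x ξ)
  rw [sndL_join] at this
  linarith

theorem integrable_join (a : 𝓢(Phase ι, ℂ)) :
    Integrable fun p : Config ι × Config ι => a (join p.1 p.2) := by
  rw [← integrable_split_iff]
  simpa using a.integrable (μ := volume)

/-- The Fourier transform of a symbol in the momentum. -/
def momentumFourier (a : 𝓢(Phase ι, ℂ)) (q x : Config ι) : ℂ :=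
  ∫ ξ, Complex.exp ((-(2 * Real.pi * inner ℝ q ξ) : ℝ) * Complex.I) * a (join x ξ)

theorem continuous_momentumFourier_integrand (a : 𝓢(Phase ι, ℂ)) (q : Config ι) :
    Continuous fun p : Config ι × Config ι =>
      Complex.exp ((-(2 * Real.pi * inner ℝ q p.2) : ℝ) * Complex.I) * a (join p.1 p.2) := by
  have := a.continuous
  fun_prop

theorem integrable_momentumFourier_integrand (a : 𝓢(Phase ι, ℂ)) (q : Config ι) :
    Integrable fun p : Config ι × Config ι =>
      Complex.exp ((-(2 * Real.pi * inner ℝ q p.2) : ℝ) * Complex.I) * a (join p.1 p.2) := by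
  refine (integrable_join a).norm.mono'
    (continuous_momentumFourier_integrand a q).aestronglyMeasurable (.of_forall fun p => ?_)
  rw [norm_mul, Complex.norm_exp_ofReal_mul_I, one_mul]

theorem continuous_momentumFourier (a : 𝓢(Phase ι, ℂ)) (q : Config ι) :
    Continuous (momentumFourier a q) := by
  obtain ⟨C, hC⟩ := exists_decay_snd a
  have hc := continuous_momentumFourier_integrand a q
  unfold momentumFourier
  refine continuous_of_dominated
    (bound := fun ξ => C * (1 + ‖ξ‖) ^ (-((Fintype.card ι + 1 : ℕ) : ℝ)))
    (fun x => ?_) (fun x => .of_forall fun ξ => ?_)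
    ((integrable_config_bracket ι).const_mul C) (.of_forall fun ξ => ?_)
  · have h1 : Continuous fun ξ : Config ι => (x, ξ) := by fun_prop
    exact (hc.comp h1).aestronglyMeasurable
  · rw [norm_mul, Complex.norm_exp_ofReal_mul_I, one_mul]
    exact hC x ξ
  · have h1 : Continuous fun x : Config ι => (x, ξ) := by fun_prop
    have h2 := hc.comp h1
    simp only [Function.comp_def] at h2
    exact h2

theorem integrable_momentumFourier (a : 𝓢(Phase ι, ℂ)) (q : Config ι) :
    Integrable (momentumFourier a q) :=
  (integrable_momentumFourier_integrand a q).integral_prod_left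

open FourierTransform

/-- Fubini: the full transform is taken one variable at a time, which later allows inverting it in
the position alone. -/
theorem fourier_momentumFourier (a : 𝓢(Phase ι, ℂ)) (q p : Config ι) :
    𝓕 (momentumFourier a q) p = 𝓕 a (join p q) := by
  rw [SchwartzMap.fourier_coe, Real.fourier_eq', Real.fourier_eq']
  have h1 : ∫ v : Phase ι, Complex.exp ((-2 * Real.pi * inner ℝ v (join p q) : ℝ) * Complex.I) • a v =
      ∫ v : Phase ι, (fun z : Config ι × Config ι =>
        Complex.exp ((-2 * Real.pi * inner ℝ z.1 p : ℝ) * Complex.I) *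
          (Complex.exp ((-(2 * Real.pi * inner ℝ q z.2) : ℝ) * Complex.I) * a (join z.1 z.2)))
        (fstL v, sndL v) := by
    refine integral_congr_ae (.of_forall fun v => ?_)
    simp only [join_fstL_sndL, smul_eq_mul]
    rw [← mul_assoc, ← Complex.exp_add, inner_blocks, fstL_join, sndL_join,
      real_inner_comm (sndL v) q]
    congr 2
    push_cast
    ring
  rw [h1, integral_split fun z : Config ι × Config ι =>
        Complex.exp ((-2 * Real.pi * inner ℝ z.1 p : ℝ) * Complex.I) *
          (Complex.exp ((-(2 * Real.pi * inner ℝ q z.2) : ℝ) * Complex.I) * a (join z.1 z.2)),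
    Measure.volume_eq_prod, integral_prod]
  · simp only [integral_const_mul]
    rfl
  · have he : Continuous fun z : Config ι × Config ι =>
        Complex.exp ((-2 * Real.pi * inner ℝ z.1 p : ℝ) * Complex.I) := by fun_prop
    refine (integrable_momentumFourier_integrand a q).norm.mono'
      (he.mul (continuous_momentumFourier_integrand a q)).aestronglyMeasurable
      (.of_forall fun z => ?_)
    rw [norm_mul, Complex.norm_exp_ofReal_mul_I, one_mul]

/-- Fourier inversion in the position. -/
theorem integral_fourier_slice (a : 𝓢(Phase ι, ℂ)) (q x : Config ι) :
    ∫ p, Complex.exp ((2 * Real.pi * inner ℝ p x : ℝ) * Complex.I) * 𝓕 a (join p q) =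
      momentumFourier a q x := by
  have hi : Integrable (𝓕 (momentumFourier a q)) := by
    obtain ⟨C, hC⟩ := exists_decay_fst (𝓕 a)
    have hc := (𝓕 a).continuous
    refine ((integrable_config_bracket ι).const_mul C).mono' ?_ (.of_forall fun p => ?_)
    · refine Continuous.aestronglyMeasurable ?_
      simp only [funext (fourier_momentumFourier a q)]
      fun_prop
    · rw [fourier_momentumFourier]
      exact hC p q
  have h := (integrable_momentumFourier a q).fourierInv_fourier_eq hi
    (continuous_momentumFourier a q).continuousAt (v := x)
  rw [Real.fourierInv_eq'] at h
  simpa only [fourier_momentumFourier, smul_eq_mul] using h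

/-! ### From the Fourier–Weyl transform to the Weyl kernel -/

/-- The Fourier–Weyl transform of a symbol. -/
def weylChar (a : 𝓢(Phase ι, ℂ)) (ζ : Phase ι) : ℂ :=
  (((2 * Real.pi) ^ (2 * Fintype.card ι))⁻¹ : ℝ) * 𝓕 a ((2 * Real.pi)⁻¹ • ζ)

theorem integrable_weylChar (a : 𝓢(Phase ι, ℂ)) : Integrable (weylChar a) :=
  (((𝓕 a).integrable (μ := volume)).comp_smul (by positivity)).const_mul _

theorem integrable_mul_weylFun_apply {τ : Phase ι → ℂ} (hτ : Integrable τ) (ψ : 𝓢(Config ι, ℂ))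
    {v : Phase ι → Phase ι} (hv : Continuous v) (x : Config ι) :
    Integrable fun ζ => τ ζ * weylFun (v ζ) ψ x := by
  obtain ⟨C, hC⟩ := exists_bound ψ
  have hw : Continuous fun ζ => weylFun (v ζ) ψ x := by
    have := continuous_weylFun ψ
    fun_prop
  refine (hτ.norm.mul_const C).mono' (hτ.aestronglyMeasurable.mul hw.aestronglyMeasurable)
    (.of_forall fun ζ => ?_)
  rw [norm_mul, norm_weylFun]
  exact mul_le_mul_of_nonneg_left (hC _) (norm_nonneg _)

theorem weylFun_smul_join (p q x : Config ι) (ψ : 𝓢(Config ι, ℂ)) :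
    weylFun ((2 * Real.pi) • join p q) ψ x =
      Complex.exp ((2 * Real.pi * inner ℝ p (x + Real.pi • q) : ℝ) * Complex.I) *
        ψ (x + (2 * Real.pi) • q) := by
  simp only [weylFun, weylPhase, map_smul, fstL_join, sndL_join, real_inner_smul_left,
    real_inner_smul_right, inner_add_right]
  congr 3
  push_cast
  ring

/-- After rescaling by `2π`, the integral over `p` is Fourier inversion in the position, evaluated
at `x + π q`. With `y = x + 2π q` this point becomes the midpoint `(x + y) / 2`, and the Jacobian of
`q ↦ y` gives `(2π)⁻ⁿ`. -/
theorem integral_weylChar_mul_weylFun (a : 𝓢(Phase ι, ℂ)) (ψ : 𝓢(Config ι, ℂ)) (x : Config ι) :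
    ∫ ζ, weylChar a ζ * weylFun ζ ψ x = (((2 * Real.pi) ^ Fintype.card ι)⁻¹ : ℂ) *
        ∫ y : Config ι, ∫ ξ : Config ι,
          Complex.exp (Complex.I * ((inner ℝ (x - y) ξ : ℝ) : ℂ)) *
            a (phasePoint ((1 / 2 : ℝ) • (x + y)) ξ) * ψ y := by
  have hpi : (0 : ℝ) < 2 * Real.pi := by positivity
  have h1 : ∫ ζ, weylChar a ζ * weylFun ζ ψ x =
      ∫ ζ, 𝓕 a ζ * weylFun ((2 * Real.pi) • ζ) ψ x := by
    have h := Measure.integral_comp_smul (volume : Measure (Phase ι))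
      (fun ζ => 𝓕 a ((2 * Real.pi)⁻¹ • ζ) * weylFun ζ ψ x) (2 * Real.pi)
    simp only [inv_smul_smul₀ hpi.ne'] at h
    rw [h, finrank_euclideanSpace, Fintype.card_sum, ← two_mul (Fintype.card ι),
      abs_of_pos (by positivity), Complex.real_smul, ← integral_const_mul]
    simp only [weylChar, mul_assoc]
  have h2 : ∫ ζ, 𝓕 a ζ * weylFun ((2 * Real.pi) • ζ) ψ x = ∫ q : Config ι,
      ψ (x + (2 * Real.pi) • q) * momentumFourier a q (x + Real.pi • q) := by
    have hint := integrable_mul_weylFun_apply ((𝓕 a).integrable (μ := volume)) ψ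
      (v := fun ζ => (2 * Real.pi) • ζ) (by fun_prop) x
    have e1 : ∀ ζ : Phase ι, 𝓕 a ζ * weylFun ((2 * Real.pi) • ζ) ψ x =
      (fun p : Config ι × Config ι => 𝓕 a (join p.1 p.2) *
        weylFun ((2 * Real.pi) • join p.1 p.2) ψ x) (fstL ζ, sndL ζ) := fun ζ => by simp
    have hint' := (integrable_split_iff fun p : Config ι × Config ι => 𝓕 a (join p.1 p.2) *
        weylFun ((2 * Real.pi) • join p.1 p.2) ψ x).1 (hint.congr (.of_forall e1))
    rw [integral_congr_ae (.of_forall e1), integral_split (fun p : Config ι × Config ι => 𝓕 a (join p.1 p.2) *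
        weylFun ((2 * Real.pi) • join p.1 p.2) ψ x), Measure.volume_eq_prod,
      integral_prod_symm _ hint']
    refine integral_congr_ae (.of_forall fun q => ?_)
    simp only [weylFun_smul_join]
    rw [← integral_fourier_slice, ← integral_const_mul]
    refine integral_congr_ae (.of_forall fun p => ?_)
    simp only
    ring
  have h3 := Measure.integral_comp_smul (volume : Measure (Config ι))
    (fun y => ψ (x + y) * momentumFourier a ((2 * Real.pi)⁻¹ • y) (x + (1 / 2 : ℝ) • y))
    (2 * Real.pi)
  have e2 (q : Config ι) : (1 / 2 : ℝ) • (2 * Real.pi) • q = Real.pi • q := by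
    rw [smul_smul]; congr 1; ring
  simp only [inv_smul_smul₀ hpi.ne', e2] at h3
  have h4 := integral_add_left_eq_self (μ := (volume : Measure (Config ι)))
    (fun y => ψ y * momentumFourier a ((2 * Real.pi)⁻¹ • (y - x)) (x + (1 / 2 : ℝ) • (y - x))) x
  simp only [add_sub_cancel_left] at h4
  rw [h1, h2, h3, h4, finrank_euclideanSpace, abs_of_pos (by positivity), Complex.real_smul]
  congr 1
  · push_cast; rfl
  refine integral_congr_ae (.of_forall fun y => ?_)
  simp only [momentumFourier]
  rw [← integral_const_mul]
  refine integral_congr_ae (.of_forall fun ξ => ?_)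
  have e3 : x + (1 / 2 : ℝ) • (y - x) = (1 / 2 : ℝ) • (x + y) := by module
  simp only [e3, real_inner_smul_left]
  rw [mul_comm (ψ y)]
  congr 2
  congr 1
  have e4 : 2 * Real.pi * ((2 * Real.pi)⁻¹ * inner ℝ (y - x) ξ) = - inner ℝ (x - y) ξ := by
    rw [mul_inv_cancel_left₀ hpi.ne', ← inner_neg_left, neg_sub]
  rw [e4, neg_neg, mul_comm]

/-- The action of a Weyl operator on Schwartz functions. -/
theorem HasWeyl.coeFn_toL2 {A : Op ι} {τ : Phase ι → ℂ} (hA : HasWeyl A τ) (hτ : Integrable τ)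
    (ψ : 𝓢(Config ι, ℂ)) :
    A (toL2 ψ) =ᵐ[volume] fun x => ∫ ζ, τ ζ * weylFun ζ ψ x := by
  obtain ⟨C, hC⟩ := exists_bound ψ
  have hw : Continuous fun p : Config ι × Phase ι => weylFun p.2 ψ p.1 := by
    have := continuous_weylFun ψ
    fun_prop
  have hprod (φ : Config ι → ℂ) (hφ : Integrable φ) : Integrable
      (fun p : Config ι × Phase ι => φ p.1 * (τ p.2 * weylFun p.2 ψ p.1))
      ((volume : Measure (Config ι)).prod volume) := by
    have h := (hφ.mul_prod hτ)
    refine (h.norm.mul_const C).mono' ((h.aestronglyMeasurable.mul hw.aestronglyMeasurable).congr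
      (.of_forall fun p => ?_)) (.of_forall fun p => ?_)
    · simp only [Pi.mul_apply]; ring
    · rw [← mul_assoc, norm_mul, norm_weylFun]
      exact mul_le_mul_of_nonneg_left (hC _) (norm_nonneg _)
  have hmeas : AEStronglyMeasurable (fun x => ∫ ζ, τ ζ * weylFun ζ ψ x)
      (volume : Measure (Config ι)) := by
    exact AEStronglyMeasurable.integral_prod_right'
      (f := fun p : Config ι × Phase ι => τ p.2 * weylFun p.2 ψ p.1)
      (hτ.aestronglyMeasurable.comp_snd.mul hw.aestronglyMeasurable)
  -- The weak identity is turned into a pointwise one by testing with real bump functions, which are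
  -- Schwartz and invisible to complex conjugation.
  refine ae_eq_of_integral_contDiff_smul_eq ?_ ?_ fun g hg hgc => ?_
  · exact ((Lp.memLp (A (toL2 ψ))).locallyIntegrable (by norm_num))
  · refine MemLp.locallyIntegrable (p := ⊤) (memLp_top_of_bound hmeas (∫ ζ, ‖τ ζ‖ * C)
      (.of_forall fun x => ?_)) le_top
    refine norm_integral_le_of_norm_le (hτ.norm.mul_const C) (.of_forall fun ζ => ?_)
    rw [norm_mul, norm_weylFun]
    exact mul_le_mul_of_nonneg_left (hC _) (norm_nonneg _)
  · have hgc' : HasCompactSupport fun x => (g x : ℂ) := hgc.comp_left Complex.ofReal_zero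
    let φ : 𝓢(Config ι, ℂ) := hgc'.toSchwartzMap (Complex.ofRealCLM.contDiff.comp hg)
    have hφ (x : Config ι) : φ x = g x := rfl
    have h1 := hA (toL2 φ) (toL2 ψ)
    rw [L2.inner_def] at h1
    have h2 : ∫ x, g x • (A (toL2 ψ)) x = ∫ x, inner ℂ (toL2 φ x) (A (toL2 ψ) x) := by
      refine integral_congr_ae ?_
      filter_upwards [toL2_coeFn φ] with x hx
      rw [hx, hφ, RCLike.inner_apply, Complex.conj_ofReal, Complex.real_smul, mul_comm]
    rw [h2, h1]
    have h3 : ∀ x, g x • ∫ ζ, τ ζ * weylFun ζ ψ x = ∫ ζ, φ x * (τ ζ * weylFun ζ ψ x) :=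
      fun x => by rw [integral_const_mul, hφ, Complex.real_smul]
    simp only [h3]
    rw [integral_integral_swap (f := fun x ζ => φ x * (τ ζ * weylFun ζ ψ x))
      (hprod φ (φ.integrable))]
    refine integral_congr_ae (.of_forall fun ζ => ?_)
    simp only [inner_toL2_weyl, ← integral_const_mul]
    refine integral_congr_ae (.of_forall fun x => ?_)
    simp only [hφ, Complex.star_def, Complex.conj_ofReal]
    ring

theorem HasWeyl.isWeylSymbol {A : Op ι} {a : 𝓢(Phase ι, ℂ)} (hA : HasWeyl A (weylChar a)) :
    IsWeylSymbol A a := fun ψ => by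
  filter_upwards [hA.coeFn_toL2 (integrable_weylChar a) ψ] with x hx
  rw [hx, integral_weylChar_mul_weylFun]

theorem IsWeylSymbol.ext {A B : Op ι} {a : 𝓢(Phase ι, ℂ)} (hA : IsWeylSymbol A a)
    (hB : IsWeylSymbol B a) : A = B :=
  ContinuousLinearMap.coeFn_injective <| denseRange_toL2.equalizer A.continuous B.continuous <|
    funext fun ψ => Lp.ext ((hA ψ).trans (hB ψ).symm)

/-- Rather than inverting the kernel formula: the operator built from `weylChar a` has symbol `a`,
and a symbol determines its operator on the dense Schwartz space. -/
theorem IsWeylSymbol.hasWeyl {A : Op ι} {a : 𝓢(Phase ι, ℂ)} (hA : IsWeylSymbol A a) :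
    HasWeyl A (weylChar a) := by
  obtain ⟨B, hB⟩ := exists_hasWeyl (integrable_weylChar a)
  rwa [hA.ext hB.isWeylSymbol]

end Symbol

/-! ### Gaussians -/

section Gaussian

open FourierTransform

variable {n : Type} [Fintype n] [DecidableEq n]

theorem inner_toEuclideanLin_eq_dotProduct (M : Matrix n n ℝ) (x : EuclideanSpace ℝ n) :
    inner ℝ x (toEuclideanLin M x) = x.ofLp ⬝ᵥ (M *ᵥ x.ofLp) := by
  simp only [EuclideanSpace.inner_eq_star_dotProduct, ofLp_toEuclideanLin_apply, star_trivial]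
  exact dotProduct_comm _ _

-- Such a factor reduces the Gaussian integrals with covariance `Γ` to standard ones by a linear
-- change of variables.
open scoped MatrixOrder in
theorem exists_eq_mul_transpose {Γ : Matrix n n ℝ} (hΓ : Γ.PosDef) :
    ∃ C : Matrix n n ℝ, C.det ≠ 0 ∧ Γ = C * Cᵀ := by
  obtain ⟨B, hB⟩ := CStarAlgebra.nonneg_iff_eq_star_mul_self.mp hΓ.posSemidef.nonneg
  rw [star_eq_conjTranspose, conjTranspose_eq_transpose_of_trivial] at hB
  refine ⟨Bᵀ, fun h => hΓ.det_pos.ne' ?_, by rw [transpose_transpose, hB]⟩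
  rw [hB, det_mul, h, zero_mul]

theorem gaussKernel_mul_transpose {C : Matrix n n ℝ} (u : EuclideanSpace ℝ n) :
    gaussKernel (C * Cᵀ) u = Real.exp (-(1 / 2) * ‖toEuclideanLin C⁻¹ u‖ ^ 2) := by
  rw [gaussKernel, Matrix.mul_inv_rev, ← transpose_nonsing_inv,
    ← inner_toEuclideanLin_eq_dotProduct, toEuclideanLin_mul, inner_toEuclideanLin,
    transpose_transpose, real_inner_self_eq_norm_sq]

theorem continuous_gaussKernel (Γ : Matrix n n ℝ) : Continuous (gaussKernel Γ) := by
  have h : gaussKernel Γ = fun z => Real.exp (-(1 / 2) * inner ℝ z (toEuclideanLin Γ⁻¹ z)) := by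
    funext z
    rw [inner_toEuclideanLin_eq_dotProduct, gaussKernel]
  rw [h]
  have := continuous_toEuclideanLin Γ⁻¹
  fun_prop

theorem integrable_exp_neg_mul_norm_sq {c : ℝ} (hc : 0 < c) :
    Integrable fun v : EuclideanSpace ℝ n => ((Real.exp (-c * ‖v‖ ^ 2) : ℝ) : ℂ) := by
  have h := GaussianFourier.integrable_cexp_neg_mul_sq_norm_add (V := EuclideanSpace ℝ n)
    (b := c) (by simpa using hc) 0 0
  refine h.congr (.of_forall fun v => ?_)
  simp

theorem integrable_gaussKernel {Γ : Matrix n n ℝ} (hΓ : Γ.PosDef) :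
    Integrable fun u => ((gaussKernel Γ u : ℝ) : ℂ) := by
  obtain ⟨C, hC, rfl⟩ := exists_eq_mul_transpose hΓ
  simp only [gaussKernel_mul_transpose]
  have hC' : (C⁻¹).det ≠ 0 := by
    rw [det_nonsing_inv, Ring.inverse_eq_inv']; exact inv_ne_zero hC
  exact integrable_comp_toEuclideanLin hC'
    (f := fun v => ((Real.exp (-(1 / 2) * ‖v‖ ^ 2) : ℝ) : ℂ))
    (integrable_exp_neg_mul_norm_sq one_half_pos)

/-- The Fourier transform of the centred Gaussian measure with covariance `Θ`. -/
def gaussFourier (Θ : Matrix n n ℝ) (ζ : EuclideanSpace ℝ n) : ℝ :=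
  Real.exp (-(2 * Real.pi ^ 2) * inner ℝ ζ (toEuclideanLin Θ ζ))

theorem gaussFourier_neg (Θ : Matrix n n ℝ) (ζ : EuclideanSpace ℝ n) :
    gaussFourier Θ (-ζ) = gaussFourier Θ ζ := by
  simp [gaussFourier]

theorem gaussFourier_mul_transpose (C : Matrix n n ℝ) (ζ : EuclideanSpace ℝ n) :
    gaussFourier (C * Cᵀ) ζ =
      Real.exp (-(2 * Real.pi ^ 2) * ‖toEuclideanLin Cᵀ ζ‖ ^ 2) := by
  rw [gaussFourier, toEuclideanLin_mul, inner_toEuclideanLin, real_inner_self_eq_norm_sq]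

theorem continuous_gaussFourier (Θ : Matrix n n ℝ) : Continuous (gaussFourier Θ) := by
  have := continuous_toEuclideanLin Θ
  unfold gaussFourier
  fun_prop

theorem gaussFourier_le_one {Θ : Matrix n n ℝ} (hΘ : Θ.PosSemidef) (ζ : EuclideanSpace ℝ n) :
    gaussFourier Θ ζ ≤ 1 := by
  have h := hΘ.dotProduct_mulVec_nonneg ζ.ofLp
  rw [star_trivial, ← inner_toEuclideanLin_eq_dotProduct] at h
  rw [gaussFourier, Real.exp_le_one_iff]
  have : 0 ≤ 2 * Real.pi ^ 2 := by positivity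
  nlinarith

theorem norm_gaussFourier_le_one {Θ : Matrix n n ℝ} (hΘ : Θ.PosSemidef)
    (ζ : EuclideanSpace ℝ n) : ‖((gaussFourier Θ ζ : ℝ) : ℂ)‖ ≤ 1 := by
  rw [gaussFourier, Complex.norm_of_nonneg (Real.exp_pos _).le]
  exact gaussFourier_le_one hΘ ζ

theorem integrable_gaussFourier {Θ : Matrix n n ℝ} (hΘ : Θ.PosDef) :
    Integrable fun u => ((gaussFourier Θ u : ℝ) : ℂ) := by
  obtain ⟨C, hC, rfl⟩ := exists_eq_mul_transpose hΘ
  simp only [gaussFourier_mul_transpose]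
  exact integrable_comp_toEuclideanLin (by rwa [det_transpose])
    (f := fun v => ((Real.exp (-(2 * Real.pi ^ 2) * ‖v‖ ^ 2) : ℝ) : ℂ))
    (integrable_exp_neg_mul_norm_sq (by positivity))

variable {ι : Type} [Fintype ι] [DecidableEq ι]

/-- Substituting `u = C w` with `Γ = C Cᵀ` gives the standard Gaussian, and the Jacobian `|det C|`
cancels the prefactor `(det Γ)^(-1/2)`. In dimension `2n` the remaining constant is `(2π)^(2n/2)`.
-/
theorem fourier_gaussSymbol {Γ : Matrix (ι ⊕ ι) (ι ⊕ ι) ℝ} (hΓ : Γ.PosDef) (ζ : Phase ι) :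
    𝓕 (fun u : Phase ι => ((gaussSymbol Γ u : ℝ) : ℂ)) ζ =
      ((2 * Real.pi) ^ Fintype.card ι * gaussFourier Γ ζ : ℝ) := by
  obtain ⟨C, hC, rfl⟩ := exists_eq_mul_transpose hΓ
  have hd : √(C * Cᵀ).det = |C.det| := by rw [det_mul, det_transpose, Real.sqrt_mul_self_eq_abs]
  have hunit : IsUnit C.det := hC.isUnit
  have h1 := integral_comp_toEuclideanLin hC (fun u : Phase ι =>
    Complex.exp ((-2 * Real.pi * inner ℝ u ζ : ℝ) * Complex.I) •
      ((gaussKernel (C * Cᵀ) u : ℝ) : ℂ))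
  have h2 := fourier_gaussian_innerProductSpace (V := Phase ι) (b := (1 / 2 : ℂ)) (by norm_num)
    (toEuclideanLin Cᵀ ζ)
  rw [Real.fourier_eq'] at h2
  have h3 (w : Phase ι) : Complex.exp ((-2 * Real.pi * inner ℝ (toEuclideanLin C w) ζ : ℝ) *
      Complex.I) • ((gaussKernel (C * Cᵀ) (toEuclideanLin C w) : ℝ) : ℂ) =
      Complex.exp ((-2 * Real.pi * inner ℝ w (toEuclideanLin Cᵀ ζ) : ℝ) * Complex.I) •
        Complex.exp (-(1 / 2 : ℂ) * (‖w‖ : ℂ) ^ 2) := by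
    rw [gaussKernel_mul_transpose, ← toEuclideanLin_mul, nonsing_inv_mul _ hunit,
      toEuclideanLin_one, inner_toEuclideanLin, transpose_transpose]
    push_cast
    rfl
  simp only [h3] at h1
  rw [h2] at h1
  rw [Real.fourier_eq']
  simp only [gaussSymbol, hd, Complex.ofReal_mul, smul_eq_mul] at h1 ⊢
  simp only [mul_left_comm _ ((|C.det|⁻¹ : ℝ) : ℂ)]
  rw [integral_const_mul, ← Complex.real_smul, ← h1, ← Complex.ofReal_mul,
    gaussFourier_mul_transpose, finrank_euclideanSpace, Fintype.card_sum]
  have h4 : (((Fintype.card ι + Fintype.card ι : ℕ) : ℂ) / 2) = (Fintype.card ι : ℂ) := by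
    push_cast; ring
  rw [h4, Complex.cpow_natCast]
  push_cast
  congr 1
  · ring
  · congr 1; ring

/-- The Gaussian as an inverse Fourier transform. -/
theorem integral_gaussFourier {Γ : Matrix (ι ⊕ ι) (ι ⊕ ι) ℝ} (hΓ : Γ.PosDef) (z : Phase ι) :
    ∫ ζ, Complex.exp ((2 * Real.pi * inner ℝ ζ z : ℝ) * Complex.I) * ((gaussFourier Γ ζ : ℝ) : ℂ) =
      ((((2 * Real.pi) ^ Fintype.card ι)⁻¹ * gaussSymbol Γ z : ℝ) : ℂ) := by
  have hc : Continuous fun u : Phase ι => ((gaussSymbol Γ u : ℝ) : ℂ) := by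
    have := continuous_gaussKernel Γ
    unfold gaussSymbol
    fun_prop
  have hi : Integrable fun u : Phase ι => ((gaussSymbol Γ u : ℝ) : ℂ) := by
    simp only [gaussSymbol, Complex.ofReal_mul]
    exact (integrable_gaussKernel hΓ).const_mul _
  have hF : 𝓕 (fun u : Phase ι => ((gaussSymbol Γ u : ℝ) : ℂ)) = fun ζ =>
      (((2 * Real.pi) ^ Fintype.card ι : ℝ) : ℂ) * ((gaussFourier Γ ζ : ℝ) : ℂ) := by
    funext ζ
    rw [fourier_gaussSymbol hΓ, Complex.ofReal_mul]
  have hFi : Integrable (𝓕 (fun u : Phase ι => ((gaussSymbol Γ u : ℝ) : ℂ))) := by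
    rw [hF]
    exact (integrable_gaussFourier hΓ).const_mul _
  have h := hi.fourierInv_fourier_eq hFi hc.continuousAt (v := z)
  rw [hF, Real.fourierInv_eq'] at h
  simp only [smul_eq_mul, mul_left_comm _ ((((2 * Real.pi) ^ Fintype.card ι : ℝ)) : ℂ)] at h
  rw [integral_const_mul] at h
  have hpi : (((2 * Real.pi) ^ Fintype.card ι : ℝ) : ℂ) ≠ 0 :=
    Complex.ofReal_ne_zero.2 (by positivity)
  rw [Complex.ofReal_mul, ← h, Complex.ofReal_inv, inv_mul_cancel_left₀ hpi]

theorem schwartz_eq_integral_fourier (φ : 𝓢(EuclideanSpace ℝ n, ℂ)) (x : EuclideanSpace ℝ n) :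
    φ x = ∫ ζ, Complex.exp ((2 * Real.pi * inner ℝ ζ x : ℝ) * Complex.I) * 𝓕 φ ζ := by
  have h : 𝓕⁻ (𝓕 φ : 𝓢(EuclideanSpace ℝ n, ℂ)) = φ := FourierTransform.fourierInv_fourier_eq φ
  conv_lhs => rw [← h, SchwartzMap.fourierInv_coe, Real.fourierInv_eq']
  rfl

/-- Expanding `φ` by Fourier inversion leaves the characteristic function of the measure, taken at
`2π ζ`. No density is used, so degenerate covariances are covered. -/
theorem integral_multivariateGaussian {Θ : Matrix n n ℝ} (hΘ : Θ.PosSemidef)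
    (φ : 𝓢(EuclideanSpace ℝ n, ℂ)) (x : EuclideanSpace ℝ n) :
    ∫ w, φ (x + w) ∂(multivariateGaussian 0 Θ) =
      ∫ ζ, 𝓕 φ ζ * (gaussFourier Θ ζ : ℝ) *
        Complex.exp ((2 * Real.pi * inner ℝ ζ x : ℝ) * Complex.I) := by
  simp only [schwartz_eq_integral_fourier φ]
  rw [integral_integral_swap]
  · refine integral_congr_ae (.of_forall fun ζ => ?_)
    have h1 : charFun (multivariateGaussian 0 Θ) ((2 * Real.pi) • ζ) =
        ((gaussFourier Θ ζ : ℝ) : ℂ) := by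
      rw [charFun_multivariateGaussian hΘ, gaussFourier, inner_zero_right,
        ← inner_toEuclideanLin_eq_dotProduct, map_smul, real_inner_smul_left,
        real_inner_smul_right]
      push_cast
      congr 1
      ring
    rw [charFun_apply] at h1
    simp only
    rw [← h1, integral_mul_const, mul_assoc, mul_comm, ← integral_mul_const]
    congr 1
    refine integral_congr_ae (.of_forall fun w => ?_)
    simp only
    rw [← Complex.exp_add, inner_add_right, real_inner_smul_right, real_inner_comm w ζ]
    congr 1
    push_cast
    ring
  · have h := (integrable_const (μ := multivariateGaussian 0 Θ) (1 : ℂ)).mul_prod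
      ((𝓕 φ).integrable (μ := volume))
    have hc : Continuous fun p : EuclideanSpace ℝ n × EuclideanSpace ℝ n =>
        Complex.exp ((2 * Real.pi * inner ℝ p.2 (x + p.1) : ℝ) * Complex.I) * 𝓕 φ p.2 := by
      have := (𝓕 φ).continuous
      fun_prop
    refine h.norm.mono' hc.aestronglyMeasurable (.of_forall fun p => ?_)
    simp only [Function.uncurry]
    rw [norm_mul, Complex.norm_exp_ofReal_mul_I, one_mul, one_mul]

theorem fourierInv_schwartz_apply (f : 𝓢(EuclideanSpace ℝ n, ℂ)) (ζ : EuclideanSpace ℝ n) :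
    𝓕⁻ f ζ = 𝓕 f (-ζ) := by
  rw [SchwartzMap.fourierInv_coe, SchwartzMap.fourier_coe, Real.fourierInv_eq_fourier_neg]

/-- By Parseval the pairing with `φ` is an integral over frequencies, where `A` enters only through
`Aᵀ` and `Θ` only through its bounded Gaussian factor. Neither has to be inverted. -/
theorem integral_eq_convDist {A Θ : Matrix n n ℝ} (hΘ : Θ.PosSemidef)
    {ρ r : 𝓢(EuclideanSpace ℝ n, ℂ)}
    (h : ∀ ζ, 𝓕 r ζ = 𝓕 ρ (toEuclideanLin Aᵀ ζ) * (gaussFourier Θ ζ : ℝ))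
    (φ : 𝓢(EuclideanSpace ℝ n, ℂ)) :
    ∫ z, r z * φ z = convDist (imageDist A ρ) (gaussDist Θ) φ := by
  have h1 : ∫ z, r z * φ z = ∫ ζ, 𝓕⁻ r ζ * 𝓕 φ ζ := by
    rw [← SchwartzMap.integral_fourier_mul_eq, FourierTransform.fourier_fourierInv_eq]
  have hA := continuous_toEuclideanLin A
  simp only [convDist, imageDist, gaussDist, integral_multivariateGaussian hΘ,
    ← integral_const_mul]
  rw [h1, integral_integral_swap]
  · refine integral_congr_ae (.of_forall fun ζ => ?_)
    have h2 : 𝓕⁻ ρ (toEuclideanLin Aᵀ ζ) =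
        ∫ z, Complex.exp ((2 * Real.pi * inner ℝ ζ (toEuclideanLin A z) : ℝ) * Complex.I) * ρ z := by
      rw [SchwartzMap.fourierInv_coe, Real.fourierInv_eq']
      refine integral_congr_ae (.of_forall fun z => ?_)
      simp only [inner_toEuclideanLin A ζ z, smul_eq_mul, real_inner_comm z]
    simp only
    rw [fourierInv_schwartz_apply, h, gaussFourier_neg, map_neg, ← fourierInv_schwartz_apply, h2,
      mul_assoc, ← integral_mul_const]
    refine integral_congr_ae (.of_forall fun z => ?_)
    simp only
    ring
  · have hg := continuous_gaussFourier Θ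
    have hf := (𝓕 φ).continuous
    have hr := ρ.continuous
    have hc : Continuous fun p : EuclideanSpace ℝ n × EuclideanSpace ℝ n =>
        ρ p.1 * (𝓕 φ p.2 * (gaussFourier Θ p.2 : ℝ) *
          Complex.exp ((2 * Real.pi * inner ℝ p.2 (toEuclideanLin A p.1) : ℝ) * Complex.I)) := by
      fun_prop
    refine ((ρ.integrable (μ := volume)).mul_prod ((𝓕 φ).integrable (μ := volume))).norm.mono'
      hc.aestronglyMeasurable (.of_forall fun p => ?_)
    simp only [Function.uncurry]
    rw [norm_mul, norm_mul, norm_mul, norm_mul, Complex.norm_exp_ofReal_mul_I, mul_one]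
    exact mul_le_mul_of_nonneg_left
      (mul_le_of_le_one_right (norm_nonneg _) (norm_gaussFourier_le_one hΘ _)) (norm_nonneg _)

/-- The substitution `z' = A w` absorbs `A⁻¹` and `|det A|⁻¹`. The kernel is then written as an
inverse Fourier integral, and Fubini, justified by the definiteness of `Θ`, reassembles the inverse
transform of `𝓕 r`. -/
theorem eq_gaussConvolution {A Θ : Matrix (ι ⊕ ι) (ι ⊕ ι) ℝ} (hA : A.det ≠ 0) (hΘ : Θ.PosDef)
    {ρ r : 𝓢(Phase ι, ℂ)}
    (h : ∀ ζ, 𝓕 r ζ = 𝓕 ρ (toEuclideanLin Aᵀ ζ) * (gaussFourier Θ ζ : ℝ)) (z : Phase ι) :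
    r z = gaussConvolution A Θ ρ z := by
  have hAc := continuous_toEuclideanLin A
  have hsub := integral_comp_toEuclideanLin hA (fun z' : Phase ι =>
    ρ (toEuclideanLin A⁻¹ z') * ((gaussKernel Θ (z - z') : ℝ) : ℂ))
  simp only [← toEuclideanLin_mul, nonsing_inv_mul _ hA.isUnit, toEuclideanLin_one] at hsub
  have hker (w : Phase ι) : ((((2 * Real.pi) ^ Fintype.card ι)⁻¹ * (√Θ.det)⁻¹ : ℝ) : ℂ) *
      (ρ w * ((gaussKernel Θ (z - toEuclideanLin A w) : ℝ) : ℂ)) =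
      ∫ ζ, ρ w * (Complex.exp ((2 * Real.pi * inner ℝ ζ (z - toEuclideanLin A w) : ℝ) * Complex.I)
        * ((gaussFourier Θ ζ : ℝ) : ℂ)) := by
    rw [integral_const_mul, integral_gaussFourier hΘ, gaussSymbol]
    push_cast
    ring
  have h2 : gaussConvolution A Θ ρ z =
      ∫ w, ∫ ζ, ρ w * (Complex.exp ((2 * Real.pi * inner ℝ ζ (z - toEuclideanLin A w) : ℝ) *
        Complex.I) * ((gaussFourier Θ ζ : ℝ) : ℂ)) := by
    simp only [← hker]
    rw [integral_const_mul, hsub, gaussConvolution, Complex.real_smul]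
    push_cast
    ring
  rw [h2, schwartz_eq_integral_fourier r, integral_integral_swap]
  · refine integral_congr_ae (.of_forall fun ζ => ?_)
    simp only
    rw [h, SchwartzMap.fourier_coe, Real.fourier_eq', mul_comm, ← integral_mul_const,
      ← integral_mul_const]
    refine integral_congr_ae (.of_forall fun w => ?_)
    simp only [smul_eq_mul]
    have e1 : Complex.exp ((2 * Real.pi * inner ℝ ζ (z - toEuclideanLin A w) : ℝ) * Complex.I) =
        Complex.exp ((-2 * Real.pi * inner ℝ w (toEuclideanLin Aᵀ ζ) : ℝ) * Complex.I) *
          Complex.exp ((2 * Real.pi * inner ℝ ζ z : ℝ) * Complex.I) := by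
      rw [← Complex.exp_add, inner_sub_right, inner_toEuclideanLin A ζ w, real_inner_comm w]
      congr 1
      push_cast
      ring
    rw [e1]
    ring
  · have hg := continuous_gaussFourier Θ
    have hr := ρ.continuous
    have hc : Continuous fun p : Phase ι × Phase ι =>
        ρ p.1 * (Complex.exp ((2 * Real.pi * inner ℝ p.2 (z - toEuclideanLin A p.1) : ℝ) *
        Complex.I) * ((gaussFourier Θ p.2 : ℝ) : ℂ)) := by
      fun_prop
    refine ((ρ.integrable (μ := volume)).mul_prod (integrable_gaussFourier hΘ)).norm.mono'
      hc.aestronglyMeasurable (.of_forall fun p => ?_)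
    simp only [Function.uncurry]
    rw [norm_mul, norm_mul, norm_mul, Complex.norm_exp_ofReal_mul_I, one_mul]

variable {m : Type} [Fintype m] [DecidableEq m]

theorem posSemidef_thermalCov {Φ : Matrix (n ⊕ m) (n ⊕ m) ℝ} {Γ : Matrix m m ℝ}
    (hΓ : Γ.PosSemidef) : (thermalCov Φ Γ).PosSemidef := by
  have := hΓ.mul_mul_conjTranspose_same Φ.toBlocks₁₂
  rwa [conjTranspose_eq_transpose_of_trivial] at this

/-- Invertibility of `B Bᵀ` makes `x ↦ x B` injective, and a definite form stays definite when
pulled back along an injective map. -/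
theorem posDef_thermalCov {Φ : Matrix (n ⊕ m) (n ⊕ m) ℝ} {Γ : Matrix m m ℝ} (hΓ : Γ.PosDef)
    (h : (Φ.toBlocks₁₂ * Φ.toBlocks₁₂ᵀ).det ≠ 0) : (thermalCov Φ Γ).PosDef := by
  have := hΓ.mul_mul_conjTranspose_same (B := Φ.toBlocks₁₂) ?_
  · rwa [conjTranspose_eq_transpose_of_trivial] at this
  · have hinj : Function.Injective (Φ.toBlocks₁₂ * Φ.toBlocks₁₂ᵀ).vecMul :=
      vecMul_injective_of_isUnit ((isUnit_iff_isUnit_det _).2 h.isUnit)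
    intro x y hxy
    apply hinj
    simp only at hxy ⊢
    rw [← vecMul_vecMul, ← vecMul_vecMul, hxy]

theorem isReducedSymbol_of_fourier {Φ : Matrix ((ι ⊕ ι) ⊕ m) ((ι ⊕ ι) ⊕ m) ℝ} {Γ : Matrix m m ℝ}
    (hΓ : Γ.PosDef) {ρ r : 𝓢(Phase ι, ℂ)}
    (h : ∀ ζ, 𝓕 r ζ =
      𝓕 ρ (toEuclideanLin Φ.toBlocks₁₁ᵀ ζ) * (gaussFourier (thermalCov Φ Γ) ζ : ℝ)) :
    IsReducedSymbol Φ Γ ρ r where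
  integral_formula hA hB := eq_gaussConvolution hA (posDef_thermalCov hΓ hB) h
  distribution_formula := integral_eq_convDist (posSemidef_thermalCov hΓ.posSemidef) h

end Gaussian

/-! ### Reduced dynamics -/

section Reduced

open FourierTransform

variable {ι κ : Type} [Fintype ι] [DecidableEq ι] [Fintype κ] [DecidableEq κ]

/-- An invertible matrix as an automorphism of Euclidean space. -/
def matrixEquiv {n : Type} [Fintype n] [DecidableEq n] (A : Matrix n n ℝ) (hA : A.det ≠ 0) :
    EuclideanSpace ℝ n ≃L[ℝ] EuclideanSpace ℝ n :=
  (LinearEquiv.ofLinear (toEuclideanLin A) (toEuclideanLin A⁻¹)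
    (LinearMap.ext fun x => by
      rw [LinearMap.comp_apply, ← toEuclideanLin_mul, mul_nonsing_inv _ hA.isUnit,
        toEuclideanLin_one, LinearMap.id_apply])
    (LinearMap.ext fun x => by
      rw [LinearMap.comp_apply, ← toEuclideanLin_mul, nonsing_inv_mul _ hA.isUnit,
        toEuclideanLin_one, LinearMap.id_apply])).toContinuousLinearEquiv

/-- A Schwartz function transformed by an invertible matrix. -/
def schwartzComp {n : Type} [Fintype n] [DecidableEq n] (A : Matrix n n ℝ) (hA : A.det ≠ 0)
    (f : 𝓢(EuclideanSpace ℝ n, ℂ)) : 𝓢(EuclideanSpace ℝ n, ℂ) :=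
  SchwartzMap.compCLMOfContinuousLinearEquiv ℂ (matrixEquiv A hA) f

theorem schwartzComp_apply {n : Type} [Fintype n] [DecidableEq n] (A : Matrix n n ℝ)
    (hA : A.det ≠ 0) (f : 𝓢(EuclideanSpace ℝ n, ℂ)) (x : EuclideanSpace ℝ n) :
    schwartzComp A hA f x = f (toEuclideanLin A x) := rfl

/-- A rescaled Schwartz function. -/
def schwartzScale {E : Type*} [NormedAddCommGroup E] [NormedSpace ℝ E] (c : ℝ) (hc : c ≠ 0)
    (f : 𝓢(E, ℂ)) : 𝓢(E, ℂ) :=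
  SchwartzMap.compCLMOfContinuousLinearEquiv ℂ
    (ContinuousLinearEquiv.smulLeft (R₁ := ℝ) (M₁ := E) (Units.mk0 c hc)) f

theorem two_pi_ne_zero : 2 * Real.pi ≠ 0 := by positivity

/-- The Fourier–Weyl transform of a symbol, as a Schwartz function. -/
def weylCharSchwartz (a : 𝓢(Phase ι, ℂ)) : 𝓢(Phase ι, ℂ) :=
  ((((2 * Real.pi) ^ (2 * Fintype.card ι))⁻¹ : ℝ) : ℂ) •
    schwartzScale (2 * Real.pi)⁻¹ (inv_ne_zero two_pi_ne_zero) (𝓕 a)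

/-- The symbol with a given Fourier–Weyl transform. -/
def symbolOfChar (c : 𝓢(Phase ι, ℂ)) : 𝓢(Phase ι, ℂ) :=
  𝓕⁻ ((((2 * Real.pi) ^ (2 * Fintype.card ι) : ℝ) : ℂ) •
    schwartzScale (2 * Real.pi) two_pi_ne_zero c : 𝓢(Phase ι, ℂ))

theorem fourier_symbolOfChar (c : 𝓢(Phase ι, ℂ)) (ζ : Phase ι) :
    𝓕 (symbolOfChar c) ζ =
      (((2 * Real.pi) ^ (2 * Fintype.card ι) : ℝ) : ℂ) * c ((2 * Real.pi) • ζ) := by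
  rw [symbolOfChar, FourierTransform.fourier_fourierInv_eq]
  rfl

theorem weylChar_symbolOfChar (c : 𝓢(Phase ι, ℂ)) : weylChar (symbolOfChar c) = c := by
  funext ζ
  have h : (((2 * Real.pi) ^ (2 * Fintype.card ι) : ℝ) : ℂ) ≠ 0 :=
    Complex.ofReal_ne_zero.2 (by positivity)
  rw [weylChar, fourier_symbolOfChar, smul_inv_smul₀ two_pi_ne_zero, Complex.ofReal_inv,
    inv_mul_cancel_left₀ h]

theorem weylChar_smul (a : 𝓢(Phase ι, ℂ)) (ζ : Phase ι) :
    weylChar a ((2 * Real.pi) • ζ) =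
      (((2 * Real.pi) ^ (2 * Fintype.card ι))⁻¹ : ℝ) * 𝓕 a ζ := by
  rw [weylChar, inv_smul_smul₀ two_pi_ne_zero]

/-- The inclusion of the phase space of the first subsystem. -/
def phaseIncl : Phase ι →L[ℝ] Phase (ι ⊕ κ) :=
  (reorder ι κ).symm.toContinuousLinearEquiv.toContinuousLinearMap.comp
    ((EuclideanSpace.sumEquivProd (𝕜 := ℝ) (ι := ι ⊕ ι)
      (κ := κ ⊕ κ)).symm.toContinuousLinearMap.comp (ContinuousLinearMap.inl ℝ _ _))

theorem phaseIncl_apply (z : Phase ι) : phaseIncl z = phaseJoin z (0 : Phase κ) := rfl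

/-- The restriction of a Schwartz function to the phase space of the first subsystem. -/
def schwartzRestrict (f : 𝓢(Phase (ι ⊕ κ), ℂ)) : 𝓢(Phase ι, ℂ) :=
  SchwartzMap.compCLMOfAntilipschitz ℂ (K := 1)
    (g := fun z => (phaseIncl : Phase ι →L[ℝ] Phase (ι ⊕ κ)) z)
    (phaseIncl (ι := ι) (κ := κ)).hasTemperateGrowth
    -- Decay survives the restriction because `phaseFst` is a contraction that inverts the inclusion
    -- from the left.
    (AddMonoidHomClass.antilipschitz_of_bound _ fun z => by
      have := norm_phaseFst_le (phaseJoin z (0 : Phase κ))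
      rw [phaseFst_join] at this
      simpa [phaseIncl_apply] using this) f

/-! ### Flows and blocks in the two orders of coordinates -/

theorem positionsFirst_mul
    (A B : Matrix ((ι ⊕ ι) ⊕ (κ ⊕ κ)) ((ι ⊕ ι) ⊕ (κ ⊕ κ)) ℝ) :
    positionsFirst (A * B) = positionsFirst A * positionsFirst B :=
  (submatrix_mul_equiv A B _ _ _).symm

theorem sympJ_sum (ι κ : Type) [DecidableEq ι] [DecidableEq κ] :
    sympJ (ι ⊕ κ) = positionsFirst (totalJ ι κ) := by
  ext a b
  rcases a with (a | a) | (a | a) <;> rcases b with (b | b) | (b | b) <;>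
    simp [sympJ, positionsFirst, totalJ, Matrix.one_apply]

theorem IsHamiltonianFlow.positionsFirst
    {M Φ : ℝ → Matrix ((ι ⊕ ι) ⊕ (κ ⊕ κ)) ((ι ⊕ ι) ⊕ (κ ⊕ κ)) ℝ}
    (h : IsHamiltonianFlow (totalJ ι κ) M Φ) :
    IsHamiltonianFlow (sympJ (ι ⊕ κ)) (fun t => OpenQuantum.positionsFirst (M t))
      (fun t => OpenQuantum.positionsFirst (Φ t)) where
  initial := by
    simp only [h.initial]
    exact submatrix_one_equiv _
  hamilton t i j := by
    rw [sympJ_sum, ← positionsFirst_mul, ← positionsFirst_mul]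
    exact h.hamilton t _ _

theorem isSymm_totalHessian {S : Matrix (ι ⊕ ι) (ι ⊕ ι) ℝ} {E : Matrix (κ ⊕ κ) (κ ⊕ κ) ℝ}
    (G : Matrix (ι ⊕ ι) (κ ⊕ κ) ℝ) (hS : S.IsSymm) (hE : E.IsSymm) :
    (positionsFirst (totalHessian S E G)).IsSymm :=
  (IsSymm.fromBlocks hS rfl hE).submatrix _

theorem IsHamiltonianFlow.det_ne_zero {M Φ : ℝ → Matrix (ι ⊕ ι) (ι ⊕ ι) ℝ}
    (h : IsHamiltonianFlow (sympJ ι) M Φ) (hM : ∀ t, (M t).IsSymm) (t : ℝ) :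
    (Φ t).det ≠ 0 := by
  have h1 := abs_det_of_symplectic (sympJ_mul_self ι)
    (h.transpose_mul_mul (sympJ_mul_self ι) (sympJ_transpose ι) hM t)
  intro h0
  rw [h0] at h1
  simp at h1

theorem reorder_toEuclideanLin (A : Matrix ((ι ⊕ ι) ⊕ (κ ⊕ κ)) ((ι ⊕ ι) ⊕ (κ ⊕ κ)) ℝ)
    (ζ : Phase (ι ⊕ κ)) :
    reorder ι κ (toEuclideanLin (positionsFirst A) ζ) = toEuclideanLin A (reorder ι κ ζ) := by
  ext i
  have h1 (w : Phase (ι ⊕ κ)) (i : (ι ⊕ ι) ⊕ (κ ⊕ κ)) :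
      reorder ι κ w i = w ((Equiv.sumSumSumComm ι κ ι κ).symm i) := rfl
  rw [h1, ofLp_toEuclideanLin_apply, ofLp_toEuclideanLin_apply]
  simp only [mulVec, dotProduct, positionsFirst, submatrix_apply, Equiv.apply_symm_apply, h1]
  exact Fintype.sum_equiv (Equiv.sumSumSumComm ι κ ι κ) _ _ fun j => by
    rw [Equiv.symm_apply_apply]

theorem toEuclideanLin_join_zero {m n : Type} [Fintype m] [Fintype n] [DecidableEq m]
    [DecidableEq n] (A : Matrix (m ⊕ n) (m ⊕ n) ℝ) (z : EuclideanSpace ℝ m) :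
    toEuclideanLin A (join z 0) =
      join (toEuclideanLin A.toBlocks₁₁ z) (toEuclideanLin A.toBlocks₂₁ z) := by
  ext i
  rcases i with i | i <;>
    simp [mulVec, dotProduct, toBlocks₁₁, toBlocks₂₁]

theorem transpose_positionsFirst (A : Matrix ((ι ⊕ ι) ⊕ (κ ⊕ κ)) ((ι ⊕ ι) ⊕ (κ ⊕ κ)) ℝ) :
    (positionsFirst A)ᵀ = positionsFirst Aᵀ := rfl

/-- The transpose turns the first block row of the flow into a block column. This is why the reduced
state sees only the blocks `Φ_ii` and `Φ_ie`. -/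
theorem toEuclideanLin_positionsFirst_phaseJoin
    (A : Matrix ((ι ⊕ ι) ⊕ (κ ⊕ κ)) ((ι ⊕ ι) ⊕ (κ ⊕ κ)) ℝ) (z : Phase ι) :
    toEuclideanLin (positionsFirst A)ᵀ (phaseJoin z 0) =
      phaseJoin (toEuclideanLin A.toBlocks₁₁ᵀ z) (toEuclideanLin A.toBlocks₁₂ᵀ z) := by
  apply (reorder ι κ).injective
  rw [transpose_positionsFirst, reorder_toEuclideanLin, phaseJoin, phaseJoin,
    LinearIsometryEquiv.apply_symm_apply, LinearIsometryEquiv.apply_symm_apply,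
    toEuclideanLin_join_zero]
  rfl

theorem gaussFourier_toEuclideanLin {m n : Type} [Fintype m] [Fintype n] [DecidableEq m]
    [DecidableEq n] (B : Matrix m n ℝ) (Γ : Matrix n n ℝ) (ζ : EuclideanSpace ℝ m) :
    gaussFourier Γ (toEuclideanLin Bᵀ ζ) = gaussFourier (B * Γ * Bᵀ) ζ := by
  rw [gaussFourier, gaussFourier, ← inner_toEuclideanLin]
  simp [toEuclideanLin_apply, mulVec_mulVec, Matrix.mul_assoc]

/-- The free flow is block diagonal, so in the first block row of `Ψ` only `Φ_S⁻¹` acts and the free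
flow of the environment drops out. -/
theorem toBlocks_interactingFlow {m n : Type} [Fintype m] [DecidableEq m] [Fintype n]
    [DecidableEq n] {ΦS : Matrix m m ℝ} {ΦE : Matrix n n ℝ} (hS : ΦS.det ≠ 0) (hE : ΦE.det ≠ 0)
    (Φ : Matrix (m ⊕ n) (m ⊕ n) ℝ) :
    (interactingFlow ΦS ΦE Φ).toBlocks₁₁ = ΦS⁻¹ * Φ.toBlocks₁₁ ∧
      (interactingFlow ΦS ΦE Φ).toBlocks₁₂ = ΦS⁻¹ * Φ.toBlocks₁₂ := by
  have h : IsUnit ΦS ↔ IsUnit ΦE := by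
    simp [isUnit_iff_isUnit_det, hS, hE]
  rw [interactingFlow, inv_fromBlocks_zero₂₁_of_isUnit_iff _ _ _ h]
  conv_lhs => rw [← fromBlocks_toBlocks Φ, fromBlocks_multiply]
  conv_rhs => rw [← fromBlocks_toBlocks Φ]
  simp [fromBlocks_multiply]

/-- The Fourier–Weyl transform of the evolved state. -/
def evolvedChar (ρ : 𝓢(Phase ι, ℂ)) (σ : 𝓢(Phase κ, ℂ))
    (A : Matrix ((ι ⊕ κ) ⊕ (ι ⊕ κ)) ((ι ⊕ κ) ⊕ (ι ⊕ κ)) ℝ) (hA : A.det ≠ 0) :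
    𝓢(Phase (ι ⊕ κ), ℂ) :=
  schwartzComp Aᵀ (by rwa [det_transpose])
    (externalProduct (weylCharSchwartz ρ) (weylCharSchwartz σ) phaseFst phaseSnd norm_le_phase)

theorem evolvedChar_apply (ρ : 𝓢(Phase ι, ℂ)) (σ : 𝓢(Phase κ, ℂ))
    (A : Matrix ((ι ⊕ κ) ⊕ (ι ⊕ κ)) ((ι ⊕ κ) ⊕ (ι ⊕ κ)) ℝ) (hA : A.det ≠ 0)
    (ζ : Phase (ι ⊕ κ)) :
    evolvedChar ρ σ A hA ζ = weylChar ρ (phaseFst (toEuclideanLin Aᵀ ζ)) *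
      weylChar σ (phaseSnd (toEuclideanLin Aᵀ ζ)) := rfl

/-- The Fourier–Weyl transform of the reduced state. -/
def reducedChar (ρ : 𝓢(Phase ι, ℂ)) (σ : 𝓢(Phase κ, ℂ))
    (A : Matrix ((ι ⊕ κ) ⊕ (ι ⊕ κ)) ((ι ⊕ κ) ⊕ (ι ⊕ κ)) ℝ) (hA : A.det ≠ 0) : 𝓢(Phase ι, ℂ) :=
  (((2 * Real.pi) ^ Fintype.card κ : ℝ) : ℂ) • schwartzRestrict (evolvedChar ρ σ A hA)

theorem reducedChar_apply (ρ : 𝓢(Phase ι, ℂ)) (σ : 𝓢(Phase κ, ℂ))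
    (A : Matrix ((ι ⊕ κ) ⊕ (ι ⊕ κ)) ((ι ⊕ κ) ⊕ (ι ⊕ κ)) ℝ) (hA : A.det ≠ 0) (z : Phase ι) :
    reducedChar ρ σ A hA z =
      (((2 * Real.pi) ^ Fintype.card κ : ℝ) : ℂ) * evolvedChar ρ σ A hA (phaseJoin z 0) := rfl

/-- All powers of `2π` cancel: `2d` from passing back to a symbol, `N` from the partial trace, `-2d`
and `-2N` from the two initial transforms, `N` from the Gaussian. -/
theorem fourier_reduced {Φ : Matrix ((ι ⊕ ι) ⊕ (κ ⊕ κ)) ((ι ⊕ ι) ⊕ (κ ⊕ κ)) ℝ}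
    (hΦ : (positionsFirst Φ).det ≠ 0) {Γ : Matrix (κ ⊕ κ) (κ ⊕ κ) ℝ} (hΓ : Γ.PosDef)
    (ρ : 𝓢(Phase ι, ℂ)) {σ : 𝓢(Phase κ, ℂ)} (hσ : ∀ u, σ u = ((gaussSymbol Γ u : ℝ) : ℂ))
    (ζ : Phase ι) :
    𝓕 (symbolOfChar (reducedChar ρ σ (positionsFirst Φ) hΦ)) ζ =
      𝓕 ρ (toEuclideanLin Φ.toBlocks₁₁ᵀ ζ) * (gaussFourier (thermalCov Φ Γ) ζ : ℝ) := by
  have h1 (η : Phase κ) : 𝓕 σ η =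
      ((2 * Real.pi) ^ Fintype.card κ * gaussFourier Γ η : ℝ) := by
    rw [SchwartzMap.fourier_coe, funext hσ, fourier_gaussSymbol hΓ]
  have hpi : (Real.pi : ℂ) ≠ 0 := Complex.ofReal_ne_zero.2 Real.pi_ne_zero
  rw [fourier_symbolOfChar, reducedChar_apply, evolvedChar_apply,
    toEuclideanLin_positionsFirst_phaseJoin, phaseFst_join, phaseSnd_join, map_smul, map_smul,
    weylChar_smul, weylChar_smul, h1, gaussFourier_toEuclideanLin, thermalCov]
  push_cast
  field_simp
  ring

/-- The reduced state and its interaction picture. -/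
theorem exists_reduced
    {S : ℝ → Matrix (ι ⊕ ι) (ι ⊕ ι) ℝ} {E : ℝ → Matrix (κ ⊕ κ) (κ ⊕ κ) ℝ}
    {G : ℝ → Matrix (ι ⊕ ι) (κ ⊕ κ) ℝ}
    (hS : ∀ t, (S t).IsSymm) (hE : ∀ t, (E t).IsSymm)
    {ΦS : ℝ → Matrix (ι ⊕ ι) (ι ⊕ ι) ℝ} {ΦE : ℝ → Matrix (κ ⊕ κ) (κ ⊕ κ) ℝ}
    {Φ : ℝ → Matrix ((ι ⊕ ι) ⊕ (κ ⊕ κ)) ((ι ⊕ ι) ⊕ (κ ⊕ κ)) ℝ}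
    (hΦS : IsHamiltonianFlow (sympJ ι) S ΦS) (hΦE : IsHamiltonianFlow (sympJ κ) E ΦE)
    (hΦ : IsHamiltonianFlow (totalJ ι κ) (fun t => totalHessian (S t) (E t) (G t)) Φ)
    {US : ℝ → unitary (Op ι)} {U : ℝ → unitary (Op (ι ⊕ κ))} (hUS : IsPropagator S US)
    (hU : IsPropagator (fun t => positionsFirst (totalHessian (S t) (E t) (G t))) U)
    {opS : Op ι} {ρS : 𝓢(Phase ι, ℂ)} (hopS : IsWeylSymbol opS ρS)
    {Γ : Matrix (κ ⊕ κ) (κ ⊕ κ) ℝ} (hΓ : Γ.PosDef) {opE : Op κ} {ρE : 𝓢(Phase κ, ℂ)}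
    (hρE : ∀ u, ρE u = ((gaussSymbol Γ u : ℝ) : ℂ)) (hopE : IsWeylSymbol opE ρE)
    {op0 : Op (ι ⊕ κ)} (hop0 : IsTensorOp op0 opS opE) (t : ℝ) :
    ∃ (R : Op ι) (r rI : 𝓢(Phase ι, ℂ)),
      IsPartialTrace ((U t : Op (ι ⊕ κ)) * op0 * star (U t : Op (ι ⊕ κ))) R ∧
      IsWeylSymbol R r ∧ IsWeylSymbol (star (US t : Op ι) * R * (US t : Op ι)) rI ∧
      IsReducedSymbol (interactingFlow (ΦS t) (ΦE t) (Φ t)) Γ ρS rI ∧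
      IsReducedSymbol (Φ t) Γ ρS r := by
  have hM (t : ℝ) := isSymm_totalHessian (G t) (hS t) (hE t)
  have hdet : (positionsFirst (Φ t)).det ≠ 0 := hΦ.positionsFirst.det_ne_zero hM t
  have hdS := hΦS.det_ne_zero hS t
  have hdE := hΦE.det_ne_zero hE t
  have hdS' : (ΦS t)⁻¹ᵀ.det ≠ 0 := by
    rw [det_transpose, det_nonsing_inv, Ring.inverse_eq_inv']
    exact inv_ne_zero hdS
  have h0 := hop0.hasWeyl (integrable_weylChar ρS) (integrable_weylChar ρE) hopS.hasWeyl
    hopE.hasWeyl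
  have hT : HasWeyl ((U t : Op (ι ⊕ κ)) * op0 * star (U t : Op (ι ⊕ κ)))
      (evolvedChar ρS ρE (positionsFirst (Φ t)) hdet) :=
    h0.conj_propagator hM hU hΦ.positionsFirst t
  set c := reducedChar ρS ρE (positionsFirst (Φ t)) hdet with hc
  -- The reduced operator is defined by its expected transform; that it is the partial trace is then
  -- a theorem about `R`, not a construction.
  obtain ⟨R, hR⟩ := exists_hasWeyl (c.integrable (μ := volume))
  have hRI := hR.conj_star_propagator hS hUS hΦS t
  have hF := fourier_reduced hdet hΓ ρS hρE
  refine ⟨R, symbolOfChar c, symbolOfChar (schwartzComp (ΦS t)⁻¹ᵀ hdS' c),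
    hT.isPartialTrace hR, ?_, ?_, ?_, ?_⟩
  · refine HasWeyl.isWeylSymbol ?_
    rwa [weylChar_symbolOfChar]
  · refine HasWeyl.isWeylSymbol ?_
    rwa [weylChar_symbolOfChar]
  · refine isReducedSymbol_of_fourier hΓ fun ζ => ?_
    obtain ⟨h11, h12⟩ := toBlocks_interactingFlow hdS hdE (Φ t)
    -- The interaction picture evaluates the same transform at `Φ_S⁻ᵀ ζ`; the rest is `Φ_iiᵀ Φ_S⁻ᵀ =
    -- Ψ_iiᵀ`, and likewise for `Φ_ie` inside the covariance.
    have h1 : 𝓕 (symbolOfChar (schwartzComp (ΦS t)⁻¹ᵀ hdS' c)) ζ =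
        𝓕 (symbolOfChar c) (toEuclideanLin (ΦS t)⁻¹ᵀ ζ) := by
      rw [fourier_symbolOfChar, fourier_symbolOfChar, schwartzComp_apply, map_smul]
    rw [h1, hF, h11, gaussFourier_toEuclideanLin, transpose_mul, toEuclideanLin_mul, thermalCov,
      thermalCov, h12, transpose_mul]
    simp only [Matrix.mul_assoc]
  · exact isReducedSymbol_of_fourier hΓ hF

end Reduced

end OpenQuantum

end

theorem mainTheorem4 (d N : ℕ)
    -- Hamiltonians of the system and of the environment, and the bilinear coupling
    (S : ℝ → Matrix (Fin d ⊕ Fin d) (Fin d ⊕ Fin d) ℝ)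
    (E : ℝ → Matrix (Fin N ⊕ Fin N) (Fin N ⊕ Fin N) ℝ)
    (G : ℝ → Matrix (Fin d ⊕ Fin d) (Fin N ⊕ Fin N) ℝ)
    (hS : Continuous S) (hE : Continuous E) (hG : Continuous G)
    (hSsymm : ∀ t, (S t).IsSymm) (hEsymm : ∀ t, (E t).IsSymm)
    -- classical flows of the system, of the environment and of the total system
    (ΦS : ℝ → Matrix (Fin d ⊕ Fin d) (Fin d ⊕ Fin d) ℝ)
    (ΦE : ℝ → Matrix (Fin N ⊕ Fin N) (Fin N ⊕ Fin N) ℝ)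
    (Φ : ℝ → Matrix ((Fin d ⊕ Fin d) ⊕ (Fin N ⊕ Fin N)) ((Fin d ⊕ Fin d) ⊕ (Fin N ⊕ Fin N)) ℝ)
    (hΦS : OpenQuantum.IsHamiltonianFlow (OpenQuantum.sympJ (Fin d)) S ΦS)
    (hΦE : OpenQuantum.IsHamiltonianFlow (OpenQuantum.sympJ (Fin N)) E ΦE)
    (hΦ : OpenQuantum.IsHamiltonianFlow (OpenQuantum.totalJ (Fin d) (Fin N))
      (fun t => OpenQuantum.totalHessian (S t) (E t) (G t)) Φ)
    -- quantum propagators of the system and of the total system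
    (US : ℝ → unitary (OpenQuantum.Op (Fin d)))
    (U : ℝ → unitary (OpenQuantum.Op (Fin d ⊕ Fin N)))
    (hUS : OpenQuantum.IsPropagator S US)
    (hU : OpenQuantum.IsPropagator
      (fun t => OpenQuantum.positionsFirst (OpenQuantum.totalHessian (S t) (E t) (G t))) U)
    -- initial states: Schwartz symbol for the system, centred Gaussian for the environment
    (opS : OpenQuantum.Op (Fin d)) (ρS : 𝓢(OpenQuantum.Phase (Fin d), ℂ))
    (hopS : OpenQuantum.IsWeylSymbol opS ρS)
    (ΓE : Matrix (Fin N ⊕ Fin N) (Fin N ⊕ Fin N) ℝ) (hΓE : ΓE.PosDef)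
    (opE : OpenQuantum.Op (Fin N)) (ρE : 𝓢(OpenQuantum.Phase (Fin N), ℂ))
    (hρE : ∀ u, ρE u = ((OpenQuantum.gaussSymbol ΓE u : ℝ) : ℂ))
    (hopE : OpenQuantum.IsWeylSymbol opE ρE)
    (op0 : OpenQuantum.Op (Fin d ⊕ Fin N)) (hop0 : OpenQuantum.IsTensorOp op0 opS opE)
    (t : ℝ) :
    -- the reduced operator at time `t`, its symbol, and its symbol in the interaction picture
    ∃ (R : OpenQuantum.Op (Fin d)) (r rI : 𝓢(OpenQuantum.Phase (Fin d), ℂ)),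
      OpenQuantum.IsPartialTrace
        ((U t : OpenQuantum.Op (Fin d ⊕ Fin N)) * op0 *
          star (U t : OpenQuantum.Op (Fin d ⊕ Fin N))) R ∧
      OpenQuantum.IsWeylSymbol R r ∧
      OpenQuantum.IsWeylSymbol
        (star (US t : OpenQuantum.Op (Fin d)) * R * (US t : OpenQuantum.Op (Fin d))) rI ∧
      OpenQuantum.IsReducedSymbol (OpenQuantum.interactingFlow (ΦS t) (ΦE t) (Φ t)) ΓE ρS rI ∧
      OpenQuantum.IsReducedSymbol (Φ t) ΓE ρS r := by 
  exact OpenQuantum.exists_reduced hSsymm hEsymm hΦS hΦE hΦ hUS hU hopS hΓE hρE hopE hop0 t
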